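/- An instance of the minimum congestion problem consists of a finite simple undirected graph $G$ with rational capacities $c_e>0$ on its edges, a finite set $\mathcal H$ of commodities, each having two distinct endpoints $s(h),t(h)\in V(G)$, and a nonempty polytope $\mathcal D\subseteq\mathbb R_{\ge 0}^{\mathcal H}$ of demand vectors given by rational data $A,B,b$ as $\mathcal D=\{d:\exists\psi,\ Ad+B\psi\le b\}$. The size of $\mathcal D$ is the total binary encoding length of the entries of $A$, $B$ and $b$. Let $\mathcal U(\mathcal D)\subseteq\mathbb R^{E(G)}$ be the set of all vectors $u$ such that for every $d\in\mathcal D$ there are (fractional, $d$-dependent) flows, one of intensity $d_h$ between $s(h)$ and $t(h)$ for each $h\in\mathcal H$, whose total on each edge $e$ is at most $u_e$. The optimal congestion is $\mathrm{cong}=\inf_{u\in\mathcal U(\mathcal D)}\max_{e\in E(G)}u_e/c_e$. For a 3-SAT formula $\varphi$ with $m\ge 1$ clauses (each clause consisting of three literals, repetitions allowed), let $\mathrm{val}(\varphi)$ be the maximum fraction of the clauses that can be satisfied simultaneously. Let $\rho$ be a rational number with $0<\rho<1$. There is a constant $c>0$ such that for every $\gamma\in\mathbb N$ there is a map $f_\gamma$,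 computable in polynomial time, from 3-SAT formulas to instances of the minimum congestion problem such that, for every formula $\varphi$ with $m$ clauses, the instance $f_\gamma(\varphi)$, with graph $G_\gamma$ and polytope $\mathcal D_\gamma$, has the following properties. We have $|V(G_\gamma)|=O(m^\gamma)$, $|E(G_\gamma)|=O(m^\gamma)$, and the size of $\mathcal D_\gamma$ is $O(m^{c\gamma})$, where the constants hidden in $O$ may depend on $\rho$ and $\gamma$ only. The set $\mathcal U(\mathcal D_\gamma)$ is nonempty, and \[ \mathrm{val}(\varphi)=1\ \Longrightarrow\ \mathrm{cong}(f_\gamma(\varphi))\ge 1+\gamma(1-\rho), \qquad \mathrm{val}(\varphi)<\rho\ \Longrightarrow\ \mathrm{cong}(f_\gamma(\varphi))\le 1 . \] -/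

import Mathlib

open Computability

/-! ### 3-SAT formulas -/

/-- A literal: a variable (named by a natural number) together with a sign;
`(v, true)` is the variable `v`, `(v, false)` is its negation. -/
abbrev Literal : Type := ℕ × Bool

/-- A clause with exactly three literal positions (repetitions are allowed). -/
abbrev Clause : Type := Fin 3 → Literal

/-- A 3-SAT formula: a nonempty finite list of clauses. -/
structure ThreeSAT where
  /-- the clauses -/
  clauses : List Clause
  clauses_ne_nil : clauses ≠ []

/-- The assignment `τ` satisfies the clause `C`: some literal of `C` is true. -/
def Clause.Sat (τ : ℕ → Bool) (C : Clause) : Prop := ∃ j, τ (C j).1 = (C j).2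

instance (τ : ℕ → Bool) : DecidablePred (Clause.Sat τ) := fun C =>
  inferInstanceAs (Decidable (∃ j, τ (C j).1 = (C j).2))

namespace ThreeSAT

/-- The number `m` of clauses. -/
def numClauses (φ : ThreeSAT) : ℕ := φ.clauses.length

/-- The number of clauses satisfied by the assignment `τ`. -/
def numSat (φ : ThreeSAT) (τ : ℕ → Bool) : ℕ :=
  φ.clauses.countP fun C => decide (C.Sat τ)

/-- The maximum number of simultaneously satisfiable clauses
(a maximum: the set is nonempty and bounded by the number of clauses). -/
noncomputable def maxSat (φ : ThreeSAT) : ℕ := sSup (Set.range φ.numSat)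

/-- `val φ`: the maximum fraction of simultaneously satisfiable clauses. -/
noncomputable def val (φ : ThreeSAT) : ℚ := (φ.maxSat : ℚ) / (φ.numClauses : ℚ)

end ThreeSAT

/-! ### Strings over a finite alphabet, and self-delimiting codes -/

/-- Binary code of a natural number, closed by a comma. -/
def encNat (n : ℕ) : List Γ' := (encodeNat n).map Γ'.bit ++ [Γ'.comma]

/-- Unary code of a natural number, closed by a comma (used for vertices and counts of a graph). -/
def encUnary (n : ℕ) : List Γ' := List.replicate n (Γ'.bit true) ++ [Γ'.comma]

/-- Code of a rational number: sign, numerator and denominator (in lowest terms) in binary. -/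
def encRat (q : ℚ) : List Γ' :=
  Γ'.bit (decide (q.num < 0)) :: (encNat q.num.natAbs ++ encNat q.den)

/-- Code of a list: the codes of its entries between brackets. -/
def encList {α : Type} (e : α → List Γ') (l : List α) : List Γ' :=
  Γ'.bra :: (l.flatMap e ++ [Γ'.ket])

/-- Code of a literal: sign and variable name. -/
def encLiteral (l : Literal) : List Γ' := Γ'.bit l.2 :: encNat l.1

/-- Code of a clause: its three literals. -/
def encClause (C : Clause) : List Γ' := encLiteral (C 0) ++ encLiteral (C 1) ++ encLiteral (C 2)

/-- Code of a 3-SAT formula: the list of its clauses. -/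
def ThreeSAT.encode (φ : ThreeSAT) : List Γ' := encList encClause φ.clauses

/-! ### Uncertainty polytopes -/

/-- Rational data `(A, B, b)` describing `{d | ∃ ψ, A d + B ψ ≤ b}` in the space of demand vectors
of `k` commodities, with auxiliary variables `ψ`. -/
structure PolyhedronData (k : ℕ) where
  /-- number of auxiliary variables -/
  numAux : ℕ
  /-- number of inequalities -/
  numRows : ℕ
  /-- coefficients of the demands -/
  A : Matrix (Fin numRows) (Fin k) ℚ
  /-- coefficients of the auxiliary variables -/
  B : Matrix (Fin numRows) (Fin numAux) ℚ
  /-- right-hand side -/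
  b : Fin numRows → ℚ

namespace PolyhedronData

variable {k : ℕ}

/-- The set `{d | ∃ ψ, A d + B ψ ≤ b}`. -/
def toSet (P : PolyhedronData k) : Set (Fin k → ℝ) :=
  {d | ∃ ψ : Fin P.numAux → ℝ, ∀ i,
    ∑ h, (P.A i h : ℝ) * d h + ∑ a, (P.B i a : ℝ) * ψ a ≤ (P.b i : ℝ)}

/-- The size of the description: the total encoding size of the entries of `A`, `B` and `b`. -/
def size (P : PolyhedronData k) : ℕ :=
  ∑ i, ((∑ h, (encRat (P.A i h)).length) + (∑ a, (encRat (P.B i a)).length)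
    + (encRat (P.b i)).length)

/-- Code of the `i`-th inequality: the rows of `A` and `B` and the entry of `b`. -/
def encRow (P : PolyhedronData k) (i : Fin P.numRows) : List Γ' :=
  encList encRat (List.ofFn (P.A i)) ++ encList encRat (List.ofFn (P.B i)) ++ encRat (P.b i)

/-- Code of `(A, B, b)`: the number of auxiliary variables and the list of inequalities. -/
def encode (P : PolyhedronData k) : List Γ' :=
  encUnary P.numAux ++ encList P.encRow (List.finRange P.numRows)

end PolyhedronData

/-! ### The minimum congestion problem -/

/-- An instance of the minimum congestion problem: a finite simple undirected graph with positive
edge capacities, a finite set of commodities, and an uncertainty polytope of demand vectors.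
Each edge `e` is listed once, with its extremities `src e` and `tgt e` in an arbitrary order. -/
structure CongestionInstance where
  /-- number of vertices of the graph `G` -/
  numV : ℕ
  /-- number of edges of the graph `G` -/
  numE : ℕ
  /-- number of commodities -/
  numH : ℕ
  /-- first extremity of an edge -/
  src : Fin numE → Fin numV
  /-- second extremity of an edge -/
  tgt : Fin numE → Fin numV
  /-- capacity of an edge -/
  cap : Fin numE → ℚ
  /-- first endpoint of a commodity -/
  source : Fin numH → Fin numV
  /-- second endpoint of a commodity -/
  sink : Fin numH → Fin numV
  /-- description of the uncertainty set -/
  poly : PolyhedronData numH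
  src_ne_tgt : ∀ e, src e ≠ tgt e
  edge_injective : Function.Injective fun e => s(src e, tgt e)
  cap_pos : ∀ e, 0 < cap e
  source_ne_sink : ∀ h, source h ≠ sink h
  demand_nonneg : ∀ d ∈ poly.toSet, ∀ h, 0 ≤ d h
  demand_bounded : Bornology.IsBounded poly.toSet
  demand_nonempty : poly.toSet.Nonempty

namespace CongestionInstance

/-- `x` is a (fractional) flow of intensity `a` from `s` to `t`. The number `x e` is the
amount sent along the edge `e`, counted positively in the direction from `src e` to `tgt e` and
negatively in the opposite direction; the net amount leaving a vertex `v` is `a` at `s`,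
`-a` at `t`, and `0` elsewhere. -/
def IsFlow (I : CongestionInstance) (s t : Fin I.numV) (a : ℝ) (x : Fin I.numE → ℝ) : Prop :=
  ∀ v, (∑ e, if I.src e = v then x e else 0) - (∑ e, if I.tgt e = v then x e else 0)
    = (if v = s then a else 0) - (if v = t then a else 0)

/-- The demand vector `d` can be routed when the capacity `u e` is reserved on each edge `e`:
there is a flow for every commodity such that the total flow on each edge is at most `u e`. -/
def Routable (I : CongestionInstance) (u : Fin I.numE → ℝ) (d : Fin I.numH → ℝ) : Prop :=
  ∃ x : Fin I.numH → Fin I.numE → ℝ,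
    (∀ h, I.IsFlow (I.source h) (I.sink h) (d h) (x h)) ∧ ∀ e, ∑ h, |x h e| ≤ u e

/-- The set `𝒰(𝒟)` of the reservation vectors with which every demand vector of the uncertainty
set can be routed (the routing may depend on the demand vector). -/
def reservations (I : CongestionInstance) : Set (Fin I.numE → ℝ) :=
  {u | ∀ d ∈ I.poly.toSet, I.Routable u d}

/-- The optimal congestion: the infimum over `u ∈ 𝒰(𝒟)` of the largest ratio `u e / c e`
(`⊤` if no reservation vector is feasible). -/
noncomputable def cong (I : CongestionInstance) : EReal :=
  ⨅ u ∈ I.reservations, ⨆ e, ((u e / (I.cap e : ℝ) : ℝ) : EReal)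

/-- Code of an edge: extremities and capacity. -/
def encEdge (I : CongestionInstance) (e : Fin I.numE) : List Γ' :=
  encUnary (I.src e) ++ encUnary (I.tgt e) ++ encRat (I.cap e)

/-- Code of a commodity: its endpoints. -/
def encCommodity (I : CongestionInstance) (h : Fin I.numH) : List Γ' :=
  encUnary (I.source h) ++ encUnary (I.sink h)

/-- Code of an instance: number of vertices, edges, commodities, polytope. -/
def encode (I : CongestionInstance) : List Γ' :=
  encUnary I.numV ++ encList I.encEdge (List.finRange I.numE)
    ++ encList I.encCommodity (List.finRange I.numH) ++ I.poly.encode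

end CongestionInstance

/-- `f` is computable in polynomial time by a Turing machine. -/
def PolyTimeMap (f : ThreeSAT → CongestionInstance) : Prop :=
  Nonempty (Turing.TM2ComputableInPolyTime ThreeSAT.encode CongestionInstance.encode f)

/-! Start from a single edge and, `γ` times, replace every edge by a gadget: `m` parallel paths, one
per clause, each made of three edges, one per literal of the clause. The edges that occur on the way
are the words of length `κ ≤ γ` over the `3m` literal positions. The words of length `γ` are the
edges of the final graph, all of capacity one, so that `m ^ (γ - κ)` units fit through a word of
length `κ`. Between the ends of a word of length `κ < γ` there are `(3m) ^ (γ - κ)` commodities,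
each with demand at most `(1 - ρ) / 3 ^ (γ - κ)`: together they ask for at most the fraction `1 - ρ`
of that capacity. A commodity at a word of length `γ` asks for at most one unit. Divided by these
maxima, the demands along a leaf word decrease with the level, and two demands that branch off at
the same word towards opposite literals sum to at most the demand above them. Hence a demand vector
induces a fractional assignment at every word.

If all clauses can be satisfied, choose a true literal in every clause and ask for the maximal
demand at every word made of chosen letters only. Give length one to the `m ^ γ` edges made of
chosen letters. A potential on the vertices drops along each edge by its length, and by one between
the ends of each active word; so every unit of demand uses at least one unit of length. Each of the
levels `κ < γ` contributes `(1 - ρ) m ^ γ` and the last one `m ^ γ`, and averaging over the chosen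
edges gives `ThreeSAT.le_cong`.

If `val φ < ρ`, let `l w` be the largest normalized demand at the word `w`. Rounding at a random
threshold shows that the maxima of the weights over the clauses sum to at most `ρ m l w`
(`ThreeSAT.sum_clauseMax_le`). Suppose that every child `p :: w` can keep the fraction `1 - l (p ::
w)` of its capacity for flows from above. Then `w` carries at least `m ^ (γ - κ) (1 - ρ l w)`, its
own demand takes at most `m ^ (γ - κ) (1 - ρ) l w`, and the fraction `1 - l w` remains: the
induction closes. `ThreeSAT.routable_one` turns this bookkeeping into a routing with load at most
one, and `ThreeSAT.cong_le_one` follows.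

For the computability, the instance is printed by loops of fixed nesting depth over pointers into
the formula (`PtrProg`). Such programs are compiled into stack programs and these into Turing
machines, with polynomial running time (`PtrProg.polyTime`). All coefficients of the polytope depend
on `ρ` and `γ` only. -/

/-! ### Structured programs on stacks -/

/-- Elementary actions of a stack machine with stacks indexed by `K` and internal state in `σ`. -/
inductive StackAct (K σ : Type)
  | push (k : K) (f : σ → Γ')
  | pop (k : K) (f : σ → Option Γ' → σ)
  | load (f : σ → σ)

/-- Structured programs on stacks. -/
inductive Cmd (K σ : Type)
  | act (a : StackAct K σ)
  | seq (p q : Cmd K σ)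
  | ite (b : σ → Bool) (p q : Cmd K σ)
  | loop (b : σ → Bool) (p : Cmd K σ)

section Semantics

variable {K σ : Type} [DecidableEq K]

/-- Effect of an elementary action. -/
def StackAct.apply : StackAct K σ → σ × (K → List Γ') → σ × (K → List Γ')
  | .push k f, c => (c.1, Function.update c.2 k (f c.1 :: c.2 k))
  | .pop k f, c => (f c.1 (c.2 k).head?, Function.update c.2 k (c.2 k).tail)
  | .load f, c => (f c.1, c.2)

/-- `p.Runs c c' t`: started in `c`, the program `p` ends in `c'` after `t` steps. -/
inductive Cmd.Runs : Cmd K σ → σ × (K → List Γ') → σ × (K → List Γ') → ℕ → Prop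
  | act (a c) : Runs (.act a) c (a.apply c) 1
  | seq {p q c c' c'' t t'} : Runs p c c' t → Runs q c' c'' t' → Runs (.seq p q) c c'' (t + t')
  | ite_true {b p q c c' t} : b c.1 = true → Runs p c c' t → Runs (.ite b p q) c c' (t + 1)
  | ite_false {b p q c c' t} : b c.1 = false → Runs q c c' t → Runs (.ite b p q) c c' (t + 1)
  | loop_false {b p c} : b c.1 = false → Runs (.loop b p) c c 1
  | loop_true {b p c c' c'' t t'} : b c.1 = true → Runs p c c' t → Runs (.loop b p) c' c'' t' →
      Runs (.loop b p) c c'' (t + t' + 1)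

end Semantics

namespace Cmd

variable {K σ Λ : Type}

/-- The labels of the machine of a program. -/
def Lab : Cmd K σ → Type
  | .act _ => Unit
  | .seq p q => Lab p ⊕ Lab q
  | .ite _ p q => Option (Lab p ⊕ Lab q)
  | .loop _ p => Option (Lab p)

/-- A program has finitely many labels. -/
@[reducible] def fintypeLab : (p : Cmd K σ) → Fintype p.Lab
  | .act _ => inferInstanceAs (Fintype Unit)
  | .seq p q =>
    letI := fintypeLab p
    letI := fintypeLab q
    inferInstanceAs (Fintype (Lab p ⊕ Lab q))
  | .ite _ p q =>
    letI := fintypeLab p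
    letI := fintypeLab q
    inferInstanceAs (Fintype (Option (Lab p ⊕ Lab q)))
  | .loop _ p =>
    letI := fintypeLab p
    inferInstanceAs (Fintype (Option (Lab p)))

/-- The first label. -/
def entry : (p : Cmd K σ) → p.Lab
  | .act _ => ()
  | .seq p _ => Sum.inl (entry p)
  | .ite _ _ _ => (none : Option _)
  | .loop _ _ => (none : Option _)

/-- The statement of an elementary action followed by a jump. -/
def actStmt (x : Λ) : StackAct K σ → Turing.TM2.Stmt (fun _ : K => Γ') Λ σ
  | .push k f => .push k f (.goto fun _ => x)
  | .pop k f => .pop k f (.goto fun _ => x)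
  | .load f => .load f (.goto fun _ => x)

/-- The machine of a program, with labels embedded by `e` in `Λ`, which jumps to `x` at the end. -/
def code : (p : Cmd K σ) → (p.Lab → Λ) → Λ → p.Lab → Turing.TM2.Stmt (fun _ : K => Γ') Λ σ
  | .act a, _, x, _ => actStmt x a
  | .seq p q, e, x, l =>
    match l with
    | Sum.inl l => code p (fun l => e (Sum.inl l)) (e (Sum.inr (entry q))) l
    | Sum.inr l => code q (fun l => e (Sum.inr l)) x l
  | .ite b p q, e, x, l =>
    match (l : Option (Lab p ⊕ Lab q)) with
    | none => .branch b (.goto fun _ => e (some (Sum.inl (entry p))))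
        (.goto fun _ => e (some (Sum.inr (entry q))))
    | some (Sum.inl l) => code p (fun l => e (some (Sum.inl l))) x l
    | some (Sum.inr l) => code q (fun l => e (some (Sum.inr l))) x l
  | .loop b p, e, x, l =>
    match (l : Option (Lab p)) with
    | none => .branch b (.goto fun _ => e (some (entry p))) (.goto fun _ => x)
    | some l => code p (fun l => e (some l)) (e none) l

variable [DecidableEq K]

/-- A program that runs is simulated, step by step, by every machine that contains its code. -/
theorem Runs.iterate_step {p : Cmd K σ} {c c' : σ × (K → List Γ')} {t : ℕ} (h : p.Runs c c' t) :
    ∀ (M : Λ → Turing.TM2.Stmt (fun _ : K => Γ') Λ σ) (e : p.Lab → Λ) (x : Λ),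
      (∀ l, M (e l) = p.code e x l) →
      (flip bind (Turing.TM2.step M))^[t] (some ⟨some (e p.entry), c.1, c.2⟩)
        = some ⟨some x, c'.1, c'.2⟩ := by
  induction h with
  | act a c =>
    intro M e x hM
    have := hM ()
    cases a <;>
    simp only [Function.iterate_succ, Function.iterate_zero, Function.comp, flip, id, bind,
      Option.bind, entry, Turing.TM2.step, this, code, actStmt, Turing.TM2.stepAux,
      StackAct.apply]
  | @seq p q c c' c'' t t' _ _ ihp ihq =>
    intro M e x hM
    rw [add_comm, Function.iterate_add_apply]
    have h1 := ihp M (fun l => e (Sum.inl l)) (e (Sum.inr (entry q))) (fun l => hM (Sum.inl l))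
    have h2 := ihq M (fun l => e (Sum.inr l)) x (fun l => hM (Sum.inr l))
    exact (congrArg _ h1).trans h2
  | @ite_true b p q c c' t hb _ ih =>
    intro M e x hM
    have h1 := ih M (fun l => e (some (Sum.inl l))) x (fun l => hM (some (Sum.inl l)))
    rw [Function.iterate_succ_apply, ← h1]
    congr 1
    have := hM none
    simp only [flip, bind, Option.bind, entry, Turing.TM2.step, this, code, Turing.TM2.stepAux,
      hb, cond]
  | @ite_false b p q c c' t hb _ ih =>
    intro M e x hM
    have h1 := ih M (fun l => e (some (Sum.inr l))) x (fun l => hM (some (Sum.inr l)))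
    rw [Function.iterate_succ_apply, ← h1]
    congr 1
    have := hM none
    simp only [flip, bind, Option.bind, entry, Turing.TM2.step, this, code, Turing.TM2.stepAux,
      hb, cond]
  | @loop_false b p c hb =>
    intro M e x hM
    have := hM none
    simp only [Function.iterate_succ, Function.iterate_zero, Function.comp, id, flip, bind,
      Option.bind, entry, Turing.TM2.step, this, code, Turing.TM2.stepAux, hb, cond]
  | @loop_true b p c c' c'' t t' hb _ _ ih ih' =>
    intro M e x hM
    have h1 := ih M (fun l => e (some l)) (e none) (fun l => hM (some l))
    have h2 := ih' M e x hM
    rw [Function.iterate_succ_apply, add_comm, Function.iterate_add_apply, ← h2]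
    congr 1
    refine Eq.trans ?_ h1
    congr 1
    have := hM none
    simp only [flip, bind, Option.bind, entry, Turing.TM2.step, this, code, Turing.TM2.stepAux,
      hb, cond]

/-- The machine of a program, with one more label for the end. -/
def machine (p : Cmd K σ) : Option p.Lab → Turing.TM2.Stmt (fun _ : K => Γ') (Option p.Lab) σ
  | none => .halt
  | some l => p.code some none l

/-- The additional step executes `halt` at the label `none`. -/
theorem Runs.iterate_machine {p : Cmd K σ} {c c' : σ × (K → List Γ')} {t : ℕ}
    (h : p.Runs c c' t) :
    (flip bind (Turing.TM2.step p.machine))^[t + 1] (some ⟨some (some p.entry), c.1, c.2⟩)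
      = some ⟨none, c'.1, c'.2⟩ := by
  rw [add_comm, Function.iterate_add_apply, h.iterate_step p.machine some none fun l => rfl]
  simp [flip, machine, Turing.TM2.step, Turing.TM2.stepAux]

end Cmd

/-! ### Stacks indexed by natural numbers -/

namespace Cmd

variable {σ : Type}

/-- All stacks of the action have an index below `N`. -/
def _root_.StackAct.Below (N : ℕ) : StackAct ℕ σ → Prop
  | .push k _ => k < N
  | .pop k _ => k < N
  | .load _ => True

/-- All stacks of the program have an index below `N`. -/
def Below (N : ℕ) : Cmd ℕ σ → Prop
  | .act a => a.Below N
  | .seq p q => p.Below N ∧ q.Below N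
  | .ite _ p q => p.Below N ∧ q.Below N
  | .loop _ p => p.Below N

theorem Below.mono {N N' : ℕ} (h : N ≤ N') : {p : Cmd ℕ σ} → p.Below N → p.Below N'
  | .act (.push _ _), hp => lt_of_lt_of_le (b := N) hp h
  | .act (.pop _ _), hp => lt_of_lt_of_le (b := N) hp h
  | .act (.load _), _ => trivial
  | .seq _ _, hp => ⟨hp.1.mono h, hp.2.mono h⟩
  | .ite _ _ _, hp => ⟨hp.1.mono h, hp.2.mono h⟩
  | .loop _ p, hp => Below.mono (p := p) h hp

theorem exists_below : (p : Cmd ℕ σ) → ∃ N, p.Below N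
  | .act (.push k _) => ⟨k + 1, Nat.lt_succ_self k⟩
  | .act (.pop k _) => ⟨k + 1, Nat.lt_succ_self k⟩
  | .act (.load _) => ⟨0, trivial⟩
  | .seq p q =>
    let ⟨N, h⟩ := exists_below p
    let ⟨N', h'⟩ := exists_below q
    ⟨max N N', h.mono (le_max_left _ _), h'.mono (le_max_right _ _)⟩
  | .ite _ p q =>
    let ⟨N, h⟩ := exists_below p
    let ⟨N', h'⟩ := exists_below q
    ⟨max N N', h.mono (le_max_left _ _), h'.mono (le_max_right _ _)⟩
  | .loop _ p => exists_below p

/-- The action on the stacks `0, …, N`. -/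
def _root_.StackAct.restrict (N : ℕ) : StackAct ℕ σ → StackAct (Fin (N + 1)) σ
  | .push k f => .push (Fin.ofNat (N + 1) k) f
  | .pop k f => .pop (Fin.ofNat (N + 1) k) f
  | .load f => .load f

/-- The program on the stacks `0, …, N`. -/
def restrict (N : ℕ) : Cmd ℕ σ → Cmd (Fin (N + 1)) σ
  | .act a => .act (a.restrict N)
  | .seq p q => .seq (p.restrict N) (q.restrict N)
  | .ite b p q => .ite b (p.restrict N) (q.restrict N)
  | .loop b p => .loop b (p.restrict N)

theorem update_comp_val {N k : ℕ} (hk : k < N + 1) (S : ℕ → List Γ') (l : List Γ') :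
    (fun i : Fin (N + 1) => Function.update S k l i)
      = Function.update (fun i : Fin (N + 1) => S i) (Fin.ofNat (N + 1) k) l := by
  funext i
  have : i = Fin.ofNat (N + 1) k ↔ (i : ℕ) = k := by
    rw [Fin.ext_iff, Fin.val_ofNat, Nat.mod_eq_of_lt hk]
  by_cases h : (i : ℕ) = k
  · rw [h, Function.update_self, this.2 h, Function.update_self]
  · rw [Function.update_of_ne h, Function.update_of_ne (fun h' => h (this.1 h'))]

theorem Runs.restrict {N : ℕ} {p : Cmd ℕ σ} {c c' : σ × (ℕ → List Γ')} {t : ℕ}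
    (h : p.Runs c c' t) (hp : p.Below (N + 1)) :
    (p.restrict N).Runs (c.1, fun i => c.2 i) (c'.1, fun i => c'.2 i) t := by
  induction h with
  | act a c =>
    have key : ((a.apply c).1, fun i : Fin (N + 1) => (a.apply c).2 i)
        = (a.restrict N).apply (c.1, fun i : Fin (N + 1) => c.2 i) := by
      have val {k : ℕ} (hk : k < N + 1) : ((Fin.ofNat (N + 1) k : Fin (N + 1)) : ℕ) = k := by
        rw [Fin.val_ofNat, Nat.mod_eq_of_lt hk]
      cases a with
      | push k f =>
        have hk : k < N + 1 := hp
        simp only [StackAct.apply, StackAct.restrict]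
        rw [update_comp_val hk, val hk]
      | pop k f =>
        have hk : k < N + 1 := hp
        simp only [StackAct.apply, StackAct.restrict]
        rw [update_comp_val hk, val hk]
      | load f => rfl
    rw [key]
    exact .act _ _
  | seq _ _ ih ih' => exact .seq (ih hp.1) (ih' hp.2)
  | ite_true hb _ ih => exact .ite_true hb (ih hp.1)
  | ite_false hb _ ih => exact .ite_false hb (ih hp.2)
  | loop_false hb => exact .loop_false hb
  | loop_true hb _ _ ih ih' => exact .loop_true hb (ih hp) (ih' hp)

/-- A function that is computed by a structured program in polynomial time, from the stack `k₀`
to the stack `k₁`, is computed by a Turing machine in polynomial time. -/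
theorem polyTime_of_runs [Fintype σ] {α β : Type} {ea : α → List Γ'} {eb : β → List Γ'}
    {f : α → β} (p : Cmd ℕ σ) (s : σ) (k₀ k₁ : ℕ) (T : Polynomial ℕ)
    (h : ∀ a, ∃ t ≤ T.eval (ea a).length,
      p.Runs (s, Function.update (fun _ => []) k₀ (ea a))
        (s, Function.update (fun _ => []) k₁ (eb (f a))) t) :
    Nonempty (Turing.TM2ComputableInPolyTime ea eb f) := by
  obtain ⟨N₀, hN₀⟩ := p.exists_below
  obtain ⟨N, hN, hk₀, hk₁⟩ : ∃ N, p.Below (N + 1) ∧ k₀ < N + 1 ∧ k₁ < N + 1 :=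
    ⟨N₀ + k₀ + k₁, hN₀.mono (by omega), by omega, by omega⟩
  let tm : Turing.FinTM2 :=
    { K := Fin (N + 1)
      k₀ := Fin.ofNat (N + 1) k₀
      k₁ := Fin.ofNat (N + 1) k₁
      Γ := fun _ => Γ'
      Λ := Option (p.restrict N).Lab
      main := some (p.restrict N).entry
      ΛFin := letI := (p.restrict N).fintypeLab; inferInstance
      σ := σ
      initialState := s
      Γk₀Fin := inferInstanceAs (Fintype Γ')
      m := (p.restrict N).machine }
  -- Initial and final configurations of a `FinTM2` are given by a `dite` on the stack index.
  have stk (k : Fin (N + 1)) (l : List Γ') : (fun i : Fin (N + 1) =>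
      @dite (List Γ') (i = k) (inferInstanceAs (Decidable (i = k))) (fun _ => l) fun _ => [])
      = Function.update (fun _ => []) k l := by
    funext i
    by_cases hi : i = k
    · rw [hi, Function.update_self, dif_pos rfl]
    · rw [Function.update_of_ne hi, dif_neg hi]
  refine ⟨{ tm := tm, inputAlphabet := Equiv.refl Γ', outputAlphabet := Equiv.refl Γ',
            time := T + 1, outputsFun := fun a => ?_ }⟩
  choose t ht hrun using h
  refine { steps := t a + 1, evals_in_steps := ?_, steps_le_m := ?_ }
  · have := ((hrun a).restrict hN).iterate_machine
    simp only [update_comp_val hk₀, update_comp_val hk₁] at this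
    have e0 := stk (Fin.ofNat (N + 1) k₀) (ea a)
    have e1 := stk (Fin.ofNat (N + 1) k₁) (eb (f a))
    rw [← e0, ← e1] at this
    have m0 : List.map (Equiv.refl Γ').invFun (ea a) = ea a := List.map_id _
    have m1 : List.map (Equiv.refl Γ').invFun (eb (f a)) = eb (f a) := List.map_id _
    rw [m0, m1]
    exact this
  · simpa using ht a

end Cmd

/-! ### Programs with pointers into the input

A pointer is represented by the suffix of the input that starts at its position. -/

/-- The nonempty suffixes of a list, from the longest to the shortest. -/
def suffixes {α : Type} : List α → List (List α)
  | [] => []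
  | a :: l => (a :: l) :: suffixes l

/-- The state reached by an automaton that reads two lists in parallel. -/
def lockstep (δ : Fin 6 → Option Γ' → Option Γ' → Fin 6) : Fin 6 → List Γ' → List Γ' → Fin 6
  | q, [], [] => q
  | q, a :: x, [] => lockstep δ (δ q (some a) none) x []
  | q, [], b :: y => lockstep δ (δ q none (some b)) [] y
  | q, a :: x, b :: y => lockstep δ (δ q (some a) (some b)) x y
termination_by _ x y => x.length + y.length

/-- Programs that print a string; the variables are pointers into the input.
`loop x p` runs `p` for every suffix of the variable `x`, bound to the next free variable;
`test δ acc x y p q` branches on the result of reading `x` and `y` in parallel. -/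
inductive PtrProg
  | skip
  | emit (a : Γ')
  | seq (p q : PtrProg)
  | loop (src : ℕ) (p : PtrProg)
  | test (δ : Fin 6 → Option Γ' → Option Γ' → Fin 6) (acc : Fin 6 → Bool) (x y : ℕ)
      (p q : PtrProg)

namespace PtrProg

/-- The string printed by a program, when the first `n` variables are bound by `env`. -/
def eval : PtrProg → ℕ → (ℕ → List Γ') → List Γ'
  | skip, _, _ => []
  | emit a, _, _ => [a]
  | seq p q, n, env => eval p n env ++ eval q n env
  | loop src p, n, env =>
    (suffixes (env src)).flatMap fun s => eval p (n + 1) (Function.update env n s)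
  | test δ acc x y p q, n, env =>
    if acc (lockstep δ 0 (env x) (env y)) then eval p n env else eval q n env

/-- The program uses bound variables only, when the first `n` variables are bound. -/
def WF : ℕ → PtrProg → Prop
  | _, skip => True
  | _, emit _ => True
  | n, seq p q => WF n p ∧ WF n q
  | n, loop src p => src < n ∧ WF (n + 1) p
  | n, test _ _ x y p q => x < n ∧ y < n ∧ WF n p ∧ WF n q

/-- Internal states of the machines: two buffers and the state of an automaton. -/
abbrev State : Type := Option Γ' × Option Γ' × Fin 6

/-- The rest state. -/
abbrev rest : State := (none, none, 0)

/-! ### Moving and copying stacks. -/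

/-- Pop a symbol to the first buffer. -/
def popTo (k : ℕ) : Cmd ℕ State := .act (.pop k fun s o => (o, s.2))

/-- Push the first buffer on several stacks. -/
def pushAll : List ℕ → Cmd ℕ State
  | [] => .act (.load id)
  | k :: ks => .seq (.act (.push k fun s => s.1.getD Γ'.blank)) (pushAll ks)

/-- Move the contents of a stack to the top of several stacks, in reverse order. -/
def sweep (k : ℕ) (ks : List ℕ) : Cmd ℕ State :=
  .seq (popTo k) (.loop (fun s => s.1.isSome) (.seq (pushAll ks) (popTo k)))

theorem runs_popTo (k : ℕ) (s : State) (S : ℕ → List Γ') : (popTo k).Runs (s, S)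
    (((S k).head?, s.2), Function.update S k (S k).tail) 1 :=
  .act _ _

theorem runs_load (f : State → State) (s : State) (S : ℕ → List Γ') :
    (Cmd.act (.load f)).Runs (s, S) (f s, S) 1 :=
  .act _ _

theorem _root_.Cmd.Runs.of_eq {p : Cmd ℕ State} {c c' d : State × (ℕ → List Γ')} {t t' : ℕ}
    (h : p.Runs c c' t) (hc : c' = d) (ht : t = t') : p.Runs c d t' :=
  hc ▸ ht ▸ h

theorem runs_pushAll (a : Γ') (s : Option Γ' × Fin 6) :
    ∀ (ks : List ℕ) (_ : ks.Nodup) (S : ℕ → List Γ'), (pushAll ks).Runs ((some a, s), S)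
      ((some a, s), fun i => if i ∈ ks then a :: S i else S i) (ks.length + 1)
  | [], _, S => (runs_load id (some a, s) S).of_eq (by simp) rfl
  | k :: ks, hk, S => by
    rw [List.nodup_cons] at hk
    have h1 := Cmd.Runs.act (.push k fun s : State => s.1.getD Γ'.blank) ((some a, s), S)
    have h2 := runs_pushAll a s ks hk.2 (Function.update S k (a :: S k))
    have h3 := Cmd.Runs.seq h1 h2
    refine h3.of_eq ?_ ?_
    · congr 1
      funext i
      by_cases hi : i = k
      · subst hi; simp [hk.1]
      · simp [hi]
    · simp [add_comm]

/-- Each symbol costs `ks.length` pushes, the closing `load`, one pop and one test of the loop. The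
symbol in the buffer counts too, hence `l.length + 1`. -/
theorem runs_sweep_loop (k : ℕ) (ks : List ℕ) (hks : ks.Nodup) (hk : k ∉ ks)
    (s : Option Γ' × Fin 6) : ∀ (l : List Γ') (a : Γ') (S : ℕ → List Γ') (_ : S k = l),
    (Cmd.loop (fun s : State => s.1.isSome) (.seq (pushAll ks) (popTo k))).Runs
      ((some a, s), S)
      ((none, s), fun i => if i = k then [] else if i ∈ ks then l.reverse ++ a :: S i else S i)
      ((l.length + 1) * (ks.length + 3) + 1)
  | [], a, S, hS => by
    have h1 := runs_pushAll a s ks hks S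
    have h2 := runs_popTo k (some a, s) (fun i => if i ∈ ks then a :: S i else S i)
    have h3 := Cmd.Runs.loop_true (b := fun s : State => s.1.isSome) rfl (h1.seq h2)
      (.loop_false (by simp [hk, hS]))
    refine h3.of_eq ?_ ?_
    · simp only [hk, hS, if_false, List.head?_nil, Prod.mk.injEq, true_and]
      funext i
      by_cases hi : i = k
      · subst hi; simp
      · simp [hi]
    · simp
  | b :: l, a, S, hS => by
    have h1 := runs_pushAll a s ks hks S
    have h2 := runs_popTo k (some a, s) (fun i => if i ∈ ks then a :: S i else S i)
    have h4 := runs_sweep_loop k ks hks hk s l b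
      (Function.update (fun i => if i ∈ ks then a :: S i else S i) k l) (by simp)
    have h3 := Cmd.Runs.loop_true (b := fun s : State => s.1.isSome) (c := ((some a, s), S)) rfl
      (h1.seq h2) (by simpa [hk, hS] using h4)
    refine h3.of_eq ?_ ?_
    · congr 1
      funext i
      by_cases hi : i = k
      · subst hi; simp
      · by_cases hi' : i ∈ ks <;> simp [hi, hi']
    · simp; ring

theorem runs_sweep (k : ℕ) (ks : List ℕ) (hks : ks.Nodup) (hk : k ∉ ks)
    (s : State) (S : ℕ → List Γ') : (sweep k ks).Runs (s, S)
      ((none, s.2), fun i => if i = k then [] else if i ∈ ks then (S k).reverse ++ S i else S i)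
      ((S k).length * (ks.length + 3) + 2) := by
  have h1 := runs_popTo k s S
  rcases hS : S k with _ | ⟨a, l⟩
  · have h3 := h1.seq (.loop_false (b := fun s : State => s.1.isSome)
      (p := .seq (pushAll ks) (popTo k)) (by simp [hS]))
    refine h3.of_eq ?_ ?_
    · simp only [hS, List.head?_nil, Prod.mk.injEq, true_and]
      funext i
      by_cases hi : i = k
      · subst hi; simp
      · simp [hi]
    · simp
  · have h2 := runs_sweep_loop k ks hks hk s.2 l a (Function.update S k l) (by simp)
    have h3 := h1.seq (by simpa [hS] using h2)
    refine h3.of_eq ?_ ?_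
    · congr 1
      funext i
      by_cases hi : i = k
      · subst hi; simp
      · by_cases hi' : i ∈ ks <;> simp [hi, hi']
    · simp; ring

/-- Copy a stack on an empty one. -/
def copy (x y : ℕ) : Cmd ℕ State := .seq (sweep x [0]) (sweep 0 [x, y])

/-- Passing through stack `0` reverses the contents twice; the second sweep restores the original
while it writes the copy. -/
theorem runs_copy {x y : ℕ} (hx : x ≠ 0) (hy : y ≠ 0) (hxy : x ≠ y) {S : ℕ → List Γ'}
    (h0 : S 0 = []) (hSy : S y = []) (s : State) :
    (copy x y).Runs (s, S) ((none, s.2), Function.update S y (S x))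
      ((S x).length * 9 + 4) := by
  have h1 := runs_sweep x [0] (by simp) (by simpa using hx) s S
  have h2 := runs_sweep 0 [x, y] (by simpa using hxy) (by simp [hx.symm, hy.symm]) (none, s.2)
    (fun i => if i = x then [] else if i ∈ [0] then (S x).reverse ++ S i else S i)
  refine (h1.seq h2).of_eq ?_ ?_
  · congr 1
    funext i
    simp only [Function.update_apply, List.mem_cons, List.not_mem_nil, or_false]
    by_cases i0 : i = 0
    · subst i0; simp [h0, hy.symm]
    · by_cases ix : i = x
      · subst ix; simp [h0, hx, hx.symm, hxy]
      · by_cases iy : i = y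
        · subst iy; simp [h0, hSy, hx.symm, i0, ix]
        · simp [i0, ix, iy]
  · simp [h0, hx.symm]; ring

/-- The loop that runs an automaton on the stacks `1` and `2`. -/
def lockstepLoop (δ : Fin 6 → Option Γ' → Option Γ' → Fin 6) : Cmd ℕ State :=
  .loop (fun s => s.1.isSome || s.2.1.isSome) (.seq (popTo 1) (.act (.pop 2 fun s o =>
    (s.1, o, if s.1.isSome || o.isSome then δ s.2.2 s.1 o else s.2.2))))

/-- The buffers hold the symbols read last, which `δ` has already processed, so their values do not
affect the result; they only have to let the loop continue. -/
theorem runs_lockstepLoop (δ : Fin 6 → Option Γ' → Option Γ' → Fin 6) (q : Fin 6)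
    (x y : List Γ') : ∀ (a b : Option Γ') (_ : (a.isSome || b.isSome) = true) (S : ℕ → List Γ'),
    ∃ t ≤ (x.length + y.length) * 3 + 4, (lockstepLoop δ).Runs
      ((a, b, q), Function.update (Function.update S 1 x) 2 y)
      ((none, none, lockstep δ q x y), Function.update (Function.update S 1 []) 2 []) t := by
  have step (q : Fin 6) (x y : List Γ') (a b : Option Γ') (S : ℕ → List Γ') :
      (Cmd.seq (popTo 1) (.act (.pop 2 fun s o =>
        (s.1, o, if s.1.isSome || o.isSome then δ s.2.2 s.1 o else s.2.2)))).Runs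
      ((a, b, q), Function.update (Function.update S 1 x) 2 y)
      ((x.head?, y.head?, if x.head?.isSome || y.head?.isSome then δ q x.head? y.head? else q),
        Function.update (Function.update S 1 x.tail) 2 y.tail) 2 := by
    have h1 := runs_popTo 1 (a, b, q) (Function.update (Function.update S 1 x) 2 y)
    have h2 := Cmd.Runs.act (.pop 2 fun (s : State) o =>
      (s.1, o, if s.1.isSome || o.isSome then δ s.2.2 s.1 o else s.2.2))
      ((x.head?, b, q), Function.update (Function.update S 1 x.tail) 2 y)
    refine (Cmd.Runs.seq (h1.of_eq (d := ((x.head?, b, q),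
      Function.update (Function.update S 1 x.tail) 2 y)) ?_ rfl) h2).of_eq ?_ rfl
    · rw [Function.update_comm (show (2 : ℕ) ≠ 1 by omega)]
      simp
    · simp [StackAct.apply]
  induction q, x, y using lockstep.induct δ with
  | case1 q =>
    intro a b hab S
    have h := Cmd.Runs.loop_true (b := fun s : State => s.1.isSome || s.2.1.isSome) hab
      (step q [] [] a b S) (.loop_false (by simp))
    exact ⟨4, by simp, by simpa [lockstep, lockstepLoop] using h⟩
  | case2 q c x ih =>
    intro a b hab S
    obtain ⟨t, ht, h⟩ := ih (some c) none rfl S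
    refine ⟨2 + t + 1, by simp at ht ⊢; omega, ?_⟩
    rw [lockstep]
    exact .loop_true hab (step q (c :: x) [] a b S) h
  | case3 q c y ih =>
    intro a b hab S
    obtain ⟨t, ht, h⟩ := ih none (some c) rfl S
    refine ⟨2 + t + 1, by simp at ht ⊢; omega, ?_⟩
    rw [lockstep]
    exact .loop_true hab (step q [] (c :: y) a b S) h
  | case4 q c x d y ih =>
    intro a b hab S
    obtain ⟨t, ht, h⟩ := ih (some c) (some d) rfl S
    refine ⟨2 + t + 1, by simp at ht ⊢; omega, ?_⟩
    rw [lockstep]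
    exact .loop_true hab (step q (c :: x) (d :: y) a b S) h

/-! ### Compilation of pointer programs and their running time. -/

/-- The stack program of a pointer program: stack `i + 5` holds the variable `i`, the output is
pushed on stack `3`, and the stacks `0`, `1`, `2` are scratch. -/
def compile : ℕ → PtrProg → Cmd ℕ State
  | _, skip => .act (.load id)
  | _, emit a => .act (.push 3 fun _ => a)
  | n, seq p q => .seq (compile n p) (compile n q)
  | n, loop src p => .seq (copy (src + 5) (n + 5)) (.seq (popTo (n + 5))
      (.loop (fun s => s.1.isSome)
        -- The popped symbol is put back so that the body sees the whole suffix, and is removed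
        -- again after the body.
        (.seq (.act (.push (n + 5) fun s => s.1.getD Γ'.blank))
          (.seq (.act (.load fun _ => rest)) (.seq (compile (n + 1) p)
            (.seq (.act (.pop (n + 5) fun s _ => s)) (popTo (n + 5))))))))
  | n, test δ acc x y p q => .seq (copy (x + 5) 1) (.seq (copy (y + 5) 2)
      -- The blank is a dummy that makes the first test of the loop succeed.
      (.seq (.act (.load fun _ => (some Γ'.blank, none, 0))) (.seq (lockstepLoop δ)
        (.ite (fun s => acc s.2.2) (.seq (.act (.load fun _ => rest)) (compile n p))
          (.seq (.act (.load fun _ => rest)) (compile n q))))))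

open Polynomial in
/-- A bound for the running time, in terms of the length of the variables. -/
noncomputable def time : PtrProg → Polynomial ℕ
  | skip => 1
  | emit _ => 1
  | seq p q => time p + time q
  | loop _ p => X * 9 + 6 + X * (time p + 5)
  | test _ _ _ _ p q => X * 24 + 15 + time p + time q

/-- The stacks hold the values of the first `n` variables, and the scratch stacks are empty. -/
structure Holds (n : ℕ) (env : ℕ → List Γ') (S : ℕ → List Γ') : Prop where
  zero : S 0 = []
  one : S 1 = []
  two : S 2 = []
  val : ∀ i < n, S (i + 5) = env i
  free : ∀ i, n ≤ i → S (i + 5) = []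

/-- The output is produced in reverse order on its stack, and reversing it takes time proportional
to its length; hence the need for this bound. -/
theorem length_eval_le {L : ℕ} : ∀ (p : PtrProg) (n : ℕ) (env : ℕ → List Γ'), p.WF n →
    (∀ i < n, (env i).length ≤ L) → (p.eval n env).length ≤ p.time.eval L := by
  intro p
  induction p with
  | skip => intro n env _ _; simp [eval]
  | emit a => intro n env _ _; simp [eval, time]
  | seq p q ihp ihq =>
    intro n env h hL
    simpa [eval, time] using add_le_add (ihp n env h.1 hL) (ihq n env h.2 hL)
  | loop src p ih =>
    intro n env h hL
    have key : ∀ l : List Γ', l.length ≤ L →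
        ((suffixes l).flatMap fun s => eval p (n + 1) (Function.update env n s)).length
          ≤ l.length * (p.time.eval L) := by
      intro l hl
      induction l with
      | nil => simp [suffixes]
      | cons a l ih' =>
        have h1 := ih' (by simp at hl; omega)
        have h2 := ih (n + 1) (Function.update env n (a :: l)) h.2 (by
          intro i hi
          by_cases hin : i = n
          · subst hin; simpa using hl
          · rw [Function.update_of_ne hin]; exact hL i (by omega))
        simp only [suffixes, List.flatMap_cons, List.length_append, List.length_cons, add_mul,
          one_mul]
        omega
    have h1 := key (env src) (hL src h.1)
    have h2 : (env src).length * p.time.eval L ≤ L * p.time.eval L :=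
      Nat.mul_le_mul_right _ (hL src h.1)
    simp only [eval, time, Polynomial.eval_add, Polynomial.eval_mul, Polynomial.eval_X,
      Polynomial.eval_ofNat, mul_add]
    omega
  | test δ acc x y p q ihp ihq =>
    intro n env h hL
    have h1 := ihp n env h.2.2.1 hL
    have h2 := ihq n env h.2.2.2 hL
    simp only [eval, time, Polynomial.eval_add, Polynomial.eval_mul, Polynomial.eval_X,
      Polynomial.eval_ofNat]
    split <;> omega

theorem runs_compile {L : ℕ} : ∀ (p : PtrProg) (n : ℕ) (env S : ℕ → List Γ'), p.WF n →
    Holds n env S → (∀ i < n, (env i).length ≤ L) →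
    ∃ t ≤ p.time.eval L, (p.compile n).Runs (rest, S)
      (rest, Function.update S 3 ((p.eval n env).reverse ++ S 3)) t := by
  intro p
  induction p with
  | skip =>
    intro n env S _ _ _
    exact ⟨1, by simp [time], (runs_load id rest S).of_eq (by simp [eval]) rfl⟩
  | emit a =>
    intro n env S _ _ _
    exact ⟨1, by simp [time], Cmd.Runs.act (.push 3 fun _ => a) (rest, S)⟩
  | seq p q ihp ihq =>
    intro n env S h hS hL
    obtain ⟨t, ht, hp⟩ := ihp n env S h.1 hS hL
    obtain ⟨t', ht', hq⟩ := ihq n env (Function.update S 3 ((p.eval n env).reverse ++ S 3)) h.2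
      ⟨by simp [hS.zero], by simp [hS.one], by simp [hS.two],
        fun i hi => by simp [hS.val i hi], fun i hi => by simp [hS.free i hi]⟩ hL
    refine ⟨t + t', by simpa [time] using add_le_add ht ht', ?_⟩
    have := hp.seq hq
    simpa [eval, compile] using this
  | loop src p ih =>
    intro n env S h hS hL
    have hsrc : src < n := h.1
    have h1 := runs_copy (x := src + 5) (y := n + 5) (by omega) (by omega) (by omega) hS.zero
      (hS.free n le_rfl) rest
    rw [hS.val src hsrc] at h1
    have h2 := runs_popTo (n + 5) rest (Function.update S (n + 5) (env src))
    simp only [Function.update_self, Function.update_idem] at h2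
    -- Loop invariant: `l` is the suffix still to be visited, with its first symbol in the buffer
    -- and its tail on the stack, and `o` is the content of the output stack.
    have key : ∀ l : List Γ', l.length ≤ L → ∀ o : List Γ', ∃ t ≤ l.length * (p.time.eval L + 5) + 1,
        (Cmd.loop (fun s : State => s.1.isSome)
          (.seq (.act (.push (n + 5) fun s => s.1.getD Γ'.blank))
          (.seq (.act (.load fun _ => rest)) (.seq (compile (n + 1) p)
            (.seq (.act (.pop (n + 5) fun s _ => s)) (popTo (n + 5))))))).Runs
          ((l.head?, none, 0), Function.update (Function.update S 3 o) (n + 5) l.tail)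
          (rest, Function.update S 3 (((suffixes l).flatMap fun s =>
            eval p (n + 1) (Function.update env n s)).reverse ++ o)) t := by
      intro l
      induction l with
      | nil =>
        intro _ o
        refine ⟨1, by simp, ?_⟩
        have e : Function.update (Function.update S 3 o) (n + 5) [] = Function.update S 3 o := by
          rw [Function.update_eq_self_iff]
          simp [hS.free n le_rfl]
        have := Cmd.Runs.loop_false (b := fun s : State => s.1.isSome)
          (p := .seq (.act (.push (n + 5) fun s => s.1.getD Γ'.blank))
          (.seq (.act (.load fun _ => rest)) (.seq (compile (n + 1) p)
            (.seq (.act (.pop (n + 5) fun s _ => s)) (popTo (n + 5))))))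
          (c := (rest, Function.update S 3 o)) rfl
        simpa [suffixes, e] using this
      | cons a l ihl =>
        intro hl o
        have r1 := Cmd.Runs.act (.push (n + 5) fun s : State => s.1.getD Γ'.blank)
          ((some a, none, 0), Function.update (Function.update S 3 o) (n + 5) l)
        have r2 := Cmd.Runs.act (.load fun _ : State => rest)
          ((some a, none, 0), Function.update (Function.update S 3 o) (n + 5) (a :: l))
        have hH : Holds (n + 1) (Function.update env n (a :: l))
            (Function.update (Function.update S 3 o) (n + 5) (a :: l)) := by
          refine ⟨by simp [hS.zero], by simp [hS.one], by simp [hS.two], fun i hi => ?_,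
            fun i hi => ?_⟩
          · by_cases hin : i = n
            · subst hin; simp
            · simp [hin, hS.val i (by omega)]
          · have hin : i ≠ n := by omega
            simp [hin, hS.free i (by omega)]
        obtain ⟨t, ht, r3⟩ := ih (n + 1) _ _ h.2 hH (by
          intro i hi
          by_cases hin : i = n
          · subst hin; simpa using hl
          · rw [Function.update_of_ne hin]; exact hL i (by omega))
        generalize hw : eval p (n + 1) (Function.update env n (a :: l)) = w at r3
        have e3 : Function.update (Function.update (Function.update S 3 o) (n + 5) (a :: l)) 3
            (w.reverse ++ (Function.update (Function.update S 3 o) (n + 5) (a :: l)) 3)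
            = Function.update (Function.update S 3 (w.reverse ++ o)) (n + 5) (a :: l) := by
          rw [Function.update_comm (by omega), Function.update_idem,
            Function.update_of_ne (by omega), Function.update_self]
        rw [e3] at r3
        have r4 := Cmd.Runs.act (.pop (n + 5) fun (s : State) _ => s)
          (rest, Function.update (Function.update S 3 (w.reverse ++ o)) (n + 5) (a :: l))
        have r5 := runs_popTo (n + 5) rest
          (Function.update (Function.update S 3 (w.reverse ++ o)) (n + 5) l)
        simp only [StackAct.apply, Function.update_self, Function.update_idem, List.tail_cons,
          Option.getD_some] at r1 r2 r4 r5
        obtain ⟨t', ht', r6⟩ := ihl (by simp at hl; omega) (w.reverse ++ o)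
        have r7 := Cmd.Runs.loop_true (b := fun s : State => s.1.isSome) rfl
          (r1.seq (r2.seq (r3.seq (r4.seq r5)))) r6
        refine ⟨_, ?_, by simpa [suffixes, hw] using r7⟩
        simp only [List.length_cons, add_mul, one_mul]
        omega
    obtain ⟨t, ht, h3⟩ := key (env src) (hL src hsrc) (S 3)
    rw [Function.update_eq_self] at h3
    refine ⟨_, ?_, h1.seq (h2.seq h3)⟩
    have h5 := hL src hsrc
    have h4 : (env src).length * (p.time.eval L + 5) ≤ L * (p.time.eval L + 5) :=
      Nat.mul_le_mul_right _ h5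
    simp only [time, Polynomial.eval_add, Polynomial.eval_mul, Polynomial.eval_X,
      Polynomial.eval_ofNat]
    omega
  | test δ acc x y p q ihp ihq =>
    intro n env S h hS hL
    obtain ⟨hx, hy, hp, hq⟩ := h
    have h1 := runs_copy (x := x + 5) (y := 1) (by omega) (by omega) (by omega) hS.zero
      hS.one rest
    rw [hS.val x hx] at h1
    have h2 := runs_copy (x := y + 5) (y := 2) (S := Function.update S 1 (env x))
      (by omega) (by omega) (by omega) (by simp [hS.zero]) (by simp [hS.two]) rest
    rw [Function.update_of_ne (by omega), hS.val y hy] at h2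
    have h3 := Cmd.Runs.act (.load fun _ : State => (some Γ'.blank, none, 0))
      (rest, Function.update (Function.update S 1 (env x)) 2 (env y))
    obtain ⟨t, ht, h4⟩ := runs_lockstepLoop δ 0 (env x) (env y) (some Γ'.blank) none rfl S
    have e : Function.update (Function.update S 1 []) 2 [] = S := by
      have e1 : Function.update S 1 [] = S := by rw [← hS.one, Function.update_eq_self]
      rw [e1, ← hS.two, Function.update_eq_self]
    rw [e] at h4
    have h5 := Cmd.Runs.act (.load fun _ : State => rest)
      ((none, none, lockstep δ 0 (env x) (env y)), S)
    have lx := hL x hx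
    have ly := hL y hy
    cases hacc : acc (lockstep δ 0 (env x) (env y)) with
    | true =>
      obtain ⟨t', ht', h6⟩ := ihp n env S hp hS hL
      have e' : (test δ acc x y p q).eval n env = p.eval n env := by rw [eval, if_pos hacc]
      rw [e']
      refine ⟨_, ?_, h1.seq (h2.seq (h3.seq (h4.seq (.ite_true hacc (h5.seq h6)))))⟩
      simp only [time, Polynomial.eval_add, Polynomial.eval_mul, Polynomial.eval_X,
        Polynomial.eval_ofNat]
      omega
    | false =>
      obtain ⟨t', ht', h6⟩ := ihq n env S hq hS hL
      have e' : (test δ acc x y p q).eval n env = q.eval n env := by rw [eval, if_neg (by simp [hacc])]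
      rw [e']
      refine ⟨_, ?_, h1.seq (h2.seq (h3.seq (h4.seq (.ite_false hacc (h5.seq h6)))))⟩
      simp only [time, Polynomial.eval_add, Polynomial.eval_mul, Polynomial.eval_X,
        Polynomial.eval_ofNat]
      omega

open Polynomial in
/-- A function whose values are printed by a pointer program is computable in polynomial time. -/
theorem polyTime {α β : Type} {ea : α → List Γ'} {eb : β → List Γ'} {f : α → β} (p : PtrProg)
    (hp : p.WF 1) (h : ∀ a, p.eval 1 (fun _ => ea a) = eb (f a)) :
    Nonempty (Turing.TM2ComputableInPolyTime ea eb f) := by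
  refine Cmd.polyTime_of_runs (.seq (p.compile 1) (.seq (sweep 5 []) (sweep 3 [4]))) rest 5 4
    -- One `time` for the program and four for reversing the output at four steps per symbol;
    -- erasing the input costs three steps per symbol.
    (p.time * 5 + X * 3 + 4) fun a => ?_
  obtain ⟨t, ht, h1⟩ := runs_compile (L := (ea a).length) p 1 (fun _ => ea a)
    (Function.update (fun _ => []) 5 (ea a)) hp
    ⟨by simp, by simp, by simp, fun i hi => by simp [Nat.lt_one_iff.1 hi],
      fun i hi => by
        have : i + 5 ≠ 5 := by omega
        exact Function.update_of_ne this _ _⟩ fun _ _ => le_rfl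
  have hlen := length_eval_le (L := (ea a).length) p 1 (fun _ => ea a) hp fun _ _ => le_rfl
  rw [h a] at h1 hlen
  rw [Function.update_of_ne (by omega), List.append_nil] at h1
  have h2 := runs_sweep 5 [] (by simp) (by simp) rest
    (Function.update (Function.update (fun _ => []) 5 (ea a)) 3 (eb (f a)).reverse)
  have e2 : (fun i => if i = 5 then [] else if i ∈ ([] : List ℕ) then
      ((Function.update (Function.update (fun _ => []) 5 (ea a)) 3 (eb (f a)).reverse :
        ℕ → List Γ') 5).reverse ++
      (Function.update (Function.update (fun _ => []) 5 (ea a)) 3 (eb (f a)).reverse :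
        ℕ → List Γ') i else
      (Function.update (Function.update (fun _ => []) 5 (ea a)) 3 (eb (f a)).reverse :
        ℕ → List Γ') i) = Function.update (fun _ => []) 3 (eb (f a)).reverse := by
    funext i
    by_cases h5 : i = 5
    · simp [h5]
    · by_cases h3 : i = 3 <;> simp [h5, h3]
  rw [e2] at h2
  have h3 := runs_sweep 3 [4] (by simp) (by simp) rest
    (Function.update (fun _ => []) 3 (eb (f a)).reverse)
  have e3 : (fun i => if i = 3 then [] else if i ∈ ([4] : List ℕ) then
      ((Function.update (fun _ => []) 3 (eb (f a)).reverse : ℕ → List Γ') 3).reverse ++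
      (Function.update (fun _ => []) 3 (eb (f a)).reverse : ℕ → List Γ') i else
      (Function.update (fun _ => []) 3 (eb (f a)).reverse : ℕ → List Γ') i)
      = Function.update (fun _ => []) 4 (eb (f a)) := by
    funext i
    by_cases h3 : i = 3
    · simp [h3]
    · by_cases h4 : i = 4 <;> simp [h3, h4]
  rw [e3] at h3
  refine ⟨_, ?_, h1.seq (h2.seq h3)⟩
  simp only [Function.update_self, Function.update_of_ne (show (5 : ℕ) ≠ 3 by omega),
    List.length_nil, List.length_cons, List.length_reverse, eval_add, eval_mul, eval_X,
    eval_ofNat]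
  omega

end PtrProg

/-! ### Words -/

/-- The words obtained from `w` by adding `r` letters below `M` in front of it, in the order of
nested loops. -/
def extensions (M : ℕ) : ℕ → List ℕ → List (List ℕ)
  | 0, w => [w]
  | r + 1, w => (List.range M).flatMap fun p => extensions M r (p :: w)

theorem mem_extensions {M : ℕ} : ∀ {r : ℕ} {w W : List ℕ}, W ∈ extensions M r w ↔
    ∃ v : List ℕ, v.length = r ∧ (∀ p ∈ v, p < M) ∧ W = v ++ w
  | 0, w, W => by
    simp only [extensions, List.mem_singleton, List.length_eq_zero_iff]
    constructor
    · rintro rfl; exact ⟨[], rfl, by simp, rfl⟩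
    · rintro ⟨v, rfl, -, rfl⟩; rfl
  | r + 1, w, W => by
    simp only [extensions, List.mem_flatMap, List.mem_range, mem_extensions]
    constructor
    · rintro ⟨p, hp, v, hv, hvM, rfl⟩
      exact ⟨v ++ [p], by simp [hv], by
        intro q hq
        rcases List.mem_append.1 hq with hq | hq
        · exact hvM q hq
        · rwa [List.mem_singleton.1 hq], by simp⟩
    · rintro ⟨v, hv, hvM, rfl⟩
      obtain ⟨u, p, rfl⟩ : ∃ u p, v = u ++ [p] := by
        rcases List.eq_nil_or_concat v with rfl | ⟨u, p, rfl⟩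
        · simp at hv
        · exact ⟨u, p, by simp⟩
      exact ⟨p, hvM p (by simp), u, by simpa using hv, fun q hq => hvM q (by simp [hq]),
        by simp⟩

theorem drop_of_mem_extensions {M r : ℕ} {w W : List ℕ} (h : W ∈ extensions M r w) :
    W.drop r = w := by
  obtain ⟨v, rfl, -, rfl⟩ := mem_extensions.1 h
  simp

theorem length_of_mem_extensions {M r : ℕ} {w W : List ℕ} (h : W ∈ extensions M r w) :
    W.length = r + w.length := by
  obtain ⟨v, rfl, -, rfl⟩ := mem_extensions.1 h
  simp

theorem length_extensions (M : ℕ) : ∀ (r : ℕ) (w : List ℕ), (extensions M r w).length = M ^ r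
  | 0, w => by simp [extensions]
  | r + 1, w => by simp [extensions, List.length_flatMap, length_extensions M r, pow_succ']

theorem nodup_extensions (M : ℕ) : ∀ (r : ℕ) (w : List ℕ), (extensions M r w).Nodup
  | 0, w => by simp [extensions]
  | r + 1, w => by
    rw [extensions, List.nodup_flatMap]
    refine ⟨fun p _ => nodup_extensions M r _, ?_⟩
    refine List.Pairwise.imp ?_ List.nodup_range
    intro p q hpq W hp hq
    have := (drop_of_mem_extensions hp).symm.trans (drop_of_mem_extensions hq)
    simp only [List.cons.injEq, and_true] at this
    exact hpq this

/-- Words with letters below `M`. -/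
def IsWord (M : ℕ) (w : List ℕ) : Prop := ∀ p ∈ w, p < M

theorem mem_leaves {M r : ℕ} {W : List ℕ} :
    W ∈ extensions M r [] ↔ W.length = r ∧ IsWord M W := by
  rw [mem_extensions]
  constructor
  · rintro ⟨v, hv, h, rfl⟩
    rw [List.append_nil]
    exact ⟨hv, h⟩
  · rintro ⟨hv, h⟩
    exact ⟨W, hv, h, by simp⟩

theorem IsWord.drop {M : ℕ} {w : List ℕ} (h : IsWord M w) (i : ℕ) : IsWord M (w.drop i) :=
  fun p hp => h p (List.mem_of_mem_drop hp)

theorem isWord_cons {M p : ℕ} {w : List ℕ} : IsWord M (p :: w) ↔ p < M ∧ IsWord M w :=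
  List.forall_mem_cons

/-! ### Vertices

Every word `w` of length less than `γ` stands for a gadget made of `M / 3` paths with three edges;
the `p`-th of the `M` edges is in turn the word `p :: w`. -/

/-- The address of a word. -/
def address (M : ℕ) (w : List ℕ) : List ℕ := w.map (M - ·)

/-- The source of a word. -/
def wordSource (M : ℕ) : List ℕ → Option (List ℕ)
  | [] => some []
  -- The first edge of a path inherits the source of `w`. Otherwise the source is the target of the
  -- preceding edge `(p - 1) :: w`, whose address starts with `M - (p - 1)`.
  | p :: w => if p % 3 = 0 then wordSource M w else some ((M - p + 1) :: address M w)

/-- The target of a word. -/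
def wordTarget (M : ℕ) : List ℕ → Option (List ℕ)
  | [] => none
  | p :: w => if p % 3 = 2 then wordTarget M w else some (address M (p :: w))

/-- The number of a vertex. -/
def vertexNum (γ M : ℕ) : Option (List ℕ) → ℕ
  | none => (M + 1) ^ γ
  | some l => Nat.ofDigits (M + 1) l

/-- The addresses of vertices. -/
def IsVertex (γ M : ℕ) (v : Option (List ℕ)) : Prop :=
  ∀ l ∈ v, l.length ≤ γ ∧ ∀ i ∈ l, 1 ≤ i ∧ i ≤ M

theorem vertexNum_lt {γ M : ℕ} (hM : 0 < M) {v : Option (List ℕ)} (h : IsVertex γ M v) :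
    vertexNum γ M v < (M + 1) ^ γ + 1 := by
  cases v with
  | none => simp [vertexNum]
  | some l =>
    obtain ⟨h1, h2⟩ := h l rfl
    have := Nat.ofDigits_lt_base_pow_length (b := M + 1) (l := l) (by omega)
      (fun i hi => Nat.lt_succ_of_le (h2 i hi).2)
    have : (M + 1) ^ l.length ≤ (M + 1) ^ γ := Nat.pow_le_pow_right (Nat.succ_pos M) h1
    simp only [vertexNum]
    omega

/-- The entries `M - p` of an address lie between `1` and `M`, so no digit in base `M + 1` is zero
and the number determines the address, including its length. The choice of `M - p` also suits the
printing: it is the number of positions from the `p`-th one to the end. -/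
theorem digits_vertexNum {γ M : ℕ} (hM : 0 < M) {l : List ℕ} (h : IsVertex γ M (some l)) :
    Nat.digits (M + 1) (vertexNum γ M (some l)) = l :=
  Nat.digits_ofDigits _ (by omega) l (fun i hi => Nat.lt_succ_of_le ((h l rfl).2 i hi).2)
    fun hl => Nat.one_le_iff_ne_zero.1 ((h l rfl).2 _ (List.getLast_mem hl)).1

theorem vertexNum_some_lt {γ M : ℕ} (hM : 0 < M) {l : List ℕ} (h : IsVertex γ M (some l)) :
    vertexNum γ M (some l) < (M + 1) ^ γ :=
  lt_of_lt_of_le (Nat.ofDigits_lt_base_pow_length (b := M + 1) (l := l) (by omega)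
      (fun i hi => Nat.lt_succ_of_le ((h l rfl).2 i hi).2))
    (Nat.pow_le_pow_right (Nat.succ_pos M) (h l rfl).1)

theorem vertexNum_inj {γ M : ℕ} (hM : 0 < M) {v v' : Option (List ℕ)} (h : IsVertex γ M v)
    (h' : IsVertex γ M v') (e : vertexNum γ M v = vertexNum γ M v') : v = v' := by
  cases v with
  | none =>
    cases v' with
    | none => rfl
    | some l' =>
      have := vertexNum_some_lt hM h'
      simp only [vertexNum] at *
      omega
  | some l =>
    cases v' with
    | none =>
      have := vertexNum_some_lt hM h
      simp only [vertexNum] at *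
      omega
    | some l' => rw [← digits_vertexNum hM h, ← digits_vertexNum hM h', e]

theorem IsVertex.mono {γ γ' M : ℕ} {v : Option (List ℕ)} (h : IsVertex γ M v) (hγ : γ ≤ γ') :
    IsVertex γ' M v :=
  fun l hl => ⟨(h l hl).1.trans hγ, (h l hl).2⟩

theorem mem_address {M : ℕ} {w : List ℕ} (h : IsWord M w) :
    ∀ i ∈ address M w, 1 ≤ i ∧ i ≤ M := by
  intro i hi
  obtain ⟨p, hp, rfl⟩ := List.mem_map.1 hi
  have := h p hp
  omega

theorem isVertex_wordSource {M : ℕ} : ∀ {w : List ℕ}, IsWord M w →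
    IsVertex w.length M (wordSource M w)
  | [], _ => by simp [IsVertex, wordSource]
  | p :: w, h => by
    rw [isWord_cons] at h
    rw [wordSource]
    split
    · exact (isVertex_wordSource h.2).mono (by simp)
    · intro l hl
      rw [Option.mem_some_iff] at hl
      subst hl
      refine ⟨by simp [address], ?_⟩
      rw [List.forall_mem_cons]
      exact ⟨by omega, mem_address h.2⟩

theorem isVertex_wordTarget {M : ℕ} : ∀ {w : List ℕ}, IsWord M w →
    IsVertex w.length M (wordTarget M w)
  | [], _ => by simp [IsVertex, wordTarget]
  | p :: w, h => by
    rw [wordTarget]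
    split
    · exact (isVertex_wordTarget (isWord_cons.1 h).2).mono (by simp)
    · intro l hl
      rw [Option.mem_some_iff] at hl
      subst hl
      exact ⟨by simp [address], mem_address h⟩

/-- Interior vertices of the gadget of `w` have addresses longer than `w`, whereas the ends of a
word never have an address longer than the word. This length count separates new vertices from old
ones. -/
theorem wordSource_ne_of_length {M : ℕ} {w l : List ℕ} (h : IsWord M w)
    (hl : w.length < l.length) : wordSource M w ≠ some l := by
  intro e
  have := (isVertex_wordSource h l e).1
  omega

theorem wordTarget_ne_of_length {M : ℕ} {w l : List ℕ} (h : IsWord M w)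
    (hl : w.length < l.length) : wordTarget M w ≠ some l := by
  intro e
  have := (isVertex_wordTarget h l e).1
  omega

theorem wordSource_ne_wordTarget {M : ℕ} : ∀ {w : List ℕ}, IsWord M w →
    wordSource M w ≠ wordTarget M w
  | [], _ => by simp [wordSource, wordTarget]
  | p :: w, h => by
    rw [isWord_cons] at h
    rw [wordSource, wordTarget]
    split
    · rw [if_neg (by omega)]
      exact wordSource_ne_of_length h.2 (by simp [address])
    · split
      · exact (wordTarget_ne_of_length h.2 (by simp [address])).symm
      · simp [address]

theorem address_inj {M : ℕ} : ∀ {w w' : List ℕ}, IsWord M w → IsWord M w' →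
    address M w = address M w' → w = w'
  | [], [], _, _, _ => rfl
  | [], _ :: _, _, _, e => by simp [address] at e
  | _ :: _, [], _, _, e => by simp [address] at e
  | p :: w, p' :: w', h, h', e => by
    rw [isWord_cons] at h h'
    simp only [address, List.map_cons, List.cons.injEq] at e
    rw [address_inj h.2 h'.2 e.2]
    have : p = p' := by omega
    rw [this]

-- Each edge of a three-edge path has an interior vertex of the path among its ends, and the address
-- of that vertex contains the parent word. The residues modulo 3 tell which ends are interior, and
-- then the letter is determined.
set_option linter.unusedSimpArgs false in
theorem word_eq_of_edge_eq {M : ℕ} {w w' : List ℕ} (h : IsWord M w) (h' : IsWord M w')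
    (hl : w.length = w'.length)
    (e : s(wordSource M w, wordTarget M w) = s(wordSource M w', wordTarget M w')) : w = w' := by
  cases w with
  | nil => exact (List.length_eq_zero_iff.1 hl.symm).symm
  | cons p w =>
    cases w' with
    | nil => simp at hl
    | cons p' w' =>
      have hw := isWord_cons.1 h
      have hw' := isWord_cons.1 h'
      have hl : w.length = w'.length := by simpa using hl
      have s1 (i) : wordSource M w ≠ some (i :: address M w') :=
        wordSource_ne_of_length hw.2 (by simp [address, hl])
      have s2 (i) : wordSource M w' ≠ some (i :: address M w) :=
        wordSource_ne_of_length hw'.2 (by simp [address, hl])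
      have t1 (i) : wordTarget M w ≠ some (i :: address M w') :=
        wordTarget_ne_of_length hw.2 (by simp [address, hl])
      have t2 (i) : wordTarget M w' ≠ some (i :: address M w) :=
        wordTarget_ne_of_length hw'.2 (by simp [address, hl])
      have a (q : ℕ) (u : List ℕ) : address M (q :: u) = (M - q) :: address M u := rfl
      have key : p = p' ∧ address M w = address M w' := by
        have s1' (i) := (s1 i).symm
        have s2' (i) := (s2 i).symm
        have t1' (i) := (t1 i).symm
        have t2' (i) := (t2 i).symm
        simp only [wordSource, wordTarget, a, Sym2.eq_iff] at e
        obtain h0 | h1 | h2 : p % 3 = 0 ∨ p % 3 = 1 ∨ p % 3 = 2 := by omega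
        · obtain h0' | h1' | h2' : p' % 3 = 0 ∨ p' % 3 = 1 ∨ p' % 3 = 2 := by omega
          · simp [h0, h0', s1, s1', s2, s2', t1, t1', t2, t2'] at e
            exact ⟨by omega, e.2.2⟩
          · simp [h0, h1', s1, s1', s2, s2', t1, t1', t2, t2'] at e
          · simp [h0, h2', s1, s1', s2, s2', t1, t1', t2, t2'] at e
            omega
        · obtain h0' | h1' | h2' : p' % 3 = 0 ∨ p' % 3 = 1 ∨ p' % 3 = 2 := by omega
          · simp [h1, h0', s1, s1', s2, s2', t1, t1', t2, t2'] at e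
          · simp [h1, h1', s1, s1', s2, s2', t1, t1', t2, t2'] at e
            rcases e with e | e
            · exact ⟨by omega, e.2⟩
            · omega
          · simp [h1, h2', s1, s1', s2, s2', t1, t1', t2, t2'] at e
        · obtain h0' | h1' | h2' : p' % 3 = 0 ∨ p' % 3 = 1 ∨ p' % 3 = 2 := by omega
          · simp [h2, h0', s1, s1', s2, s2', t1, t1', t2, t2'] at e
            omega
          · simp [h2, h1', s1, s1', s2, s2', t1, t1', t2, t2'] at e
          · simp [h2, h2', s1, s1', s2, s2', t1, t1', t2, t2'] at e
            exact ⟨by omega, e.1.2⟩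
      rw [key.1, address_inj hw.2 hw'.2 key.2]

/-! ### The instance of a formula -/

/-- The commodities: a level and a word of length `γ`. -/
def commodityList (γ M : ℕ) : List (ℕ × List ℕ) :=
  (List.range (γ + 1)).flatMap fun κ => (extensions M γ []).map fun W => (κ, W)

theorem mem_commodityList {γ M : ℕ} {c : ℕ × List ℕ} :
    c ∈ commodityList γ M ↔ c.1 ≤ γ ∧ c.2.length = γ ∧ IsWord M c.2 := by
  obtain ⟨κ, W⟩ := c
  simp only [commodityList, List.mem_flatMap, List.mem_range, List.mem_map, Prod.mk.injEq,
    ← mem_leaves]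
  constructor
  · rintro ⟨κ', h, W', h', rfl, rfl⟩
    exact ⟨by omega, h'⟩
  · rintro ⟨h, h'⟩
    exact ⟨κ, by omega, W, h', rfl, rfl⟩

theorem nodup_commodityList (γ M : ℕ) : (commodityList γ M).Nodup := by
  rw [commodityList, List.nodup_flatMap]
  refine ⟨fun κ _ => (nodup_extensions M γ []).map fun W W' h => (Prod.mk.inj h).2, ?_⟩
  refine List.Pairwise.imp ?_ List.nodup_range
  intro κ κ' hκ c h h'
  obtain ⟨W, -, rfl⟩ := List.mem_map.1 h
  obtain ⟨W', -, e⟩ := List.mem_map.1 h'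
  exact hκ (Prod.mk.inj e).1.symm

theorem length_commodityList (γ M : ℕ) :
    (commodityList γ M).length = (γ + 1) * M ^ γ := by
  simp [commodityList, List.length_flatMap, length_extensions]

/-- The largest demand of a commodity of level `κ`. -/
def share (ρ : ℚ) (γ κ : ℕ) : ℚ := if κ < γ then (1 - ρ) / 3 ^ (γ - κ) else 1

theorem share_pos {ρ : ℚ} (hρ : ρ < 1) (γ κ : ℕ) : 0 < share ρ γ κ := by
  rw [share]
  split
  · exact div_pos (by linarith) (by positivity)
  · exact one_pos

/-- The node of a commodity. -/
def node (γ : ℕ) (c : ℕ × List ℕ) : List ℕ := c.2.drop (γ - c.1)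

theorem isWord_node {γ M : ℕ} {c : ℕ × List ℕ} (h : c ∈ commodityList γ M) :
    IsWord M (node γ c) :=
  (mem_commodityList.1 h).2.2.drop _

theorem length_node {γ M : ℕ} {c : ℕ × List ℕ} (h : c ∈ commodityList γ M) :
    (node γ c).length = c.1 := by
  have := mem_commodityList.1 h
  simp only [node, List.length_drop]
  omega

/-- A linear inequality: the coefficients of the demands and the right-hand side. -/
abbrev DemandRow : Type := (ℕ × List ℕ → ℚ) × ℚ

/-- The inequality `0 ≤ d c`. -/
def nonnegRow (c : ℕ × List ℕ) : DemandRow := (fun x => if x = c then -1 else 0, 0)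

/-- The inequality `d c ≤ share c.1`. -/
def shareRow (ρ : ℚ) (γ : ℕ) (c : ℕ × List ℕ) : DemandRow :=
  (fun x => if x = c then 1 else 0, share ρ γ c.1)

/-! ### The uncertainty polytope and the instance. -/

namespace ThreeSAT

/-- The literals of the formula. -/
def literals (φ : ThreeSAT) : List Literal := φ.clauses.flatMap fun C => [C 0, C 1, C 2]

/-- The number of literals of the formula. -/
def width (φ : ThreeSAT) : ℕ := 3 * φ.numClauses

/-- The `p`-th literal of the formula. -/
def literal (φ : ThreeSAT) (p : ℕ) : Literal := φ.literals.getD p (0, true)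

/-- The `p`-th and the `q`-th literal are opposite. -/
def Conflict (φ : ThreeSAT) (p q : ℕ) : Prop :=
  (φ.literal p).1 = (φ.literal q).1 ∧ (φ.literal p).2 ≠ (φ.literal q).2

instance (φ : ThreeSAT) (p q : ℕ) : Decidable (φ.Conflict p q) :=
  inferInstanceAs (Decidable (_ ∧ _))

/-- The words `W` and `W'` agree up to level `k` and continue with opposite literals. -/
def Clash (φ : ThreeSAT) (γ k : ℕ) (W W' : List ℕ) : Prop :=
  W.drop (γ - k) = W'.drop (γ - k) ∧
    φ.Conflict ((W.drop (γ - (k + 1))).headD 0) ((W'.drop (γ - (k + 1))).headD 0)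

instance (φ : ThreeSAT) (γ k : ℕ) (W W' : List ℕ) : Decidable (φ.Clash γ k W W') :=
  inferInstanceAs (Decidable (_ ∧ _))

/-- The inequality that bounds the demands of level `k + 1` by the demands of level `k`. -/
def linkRow (ρ : ℚ) (γ : ℕ) (φ : ThreeSAT) (k : ℕ) (W W' : List ℕ) : DemandRow :=
  (fun x =>
    if x.1 = k + 1 then
      if x.2 = W then 1 / share ρ γ (k + 1)
      -- A word does not clash with itself, so the coefficients for `W` and `W'` never fall on the
      -- same variable. Without a clash the row just compares two consecutive levels of `W`.
      else if φ.Clash γ k W W' then if x.2 = W' then 1 / share ρ γ (k + 1) else 0 else 0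
    else if x.1 = k then if x.2 = W then -1 / share ρ γ k else 0 else 0, 0)

/-- The inequalities of the uncertainty polytope. -/
def demandRows (ρ : ℚ) (γ : ℕ) (φ : ThreeSAT) : List DemandRow :=
  (commodityList γ φ.width).map nonnegRow ++ (commodityList γ φ.width).map (shareRow ρ γ) ++
    (List.range γ).flatMap fun k => (extensions φ.width γ []).flatMap fun W =>
      (extensions φ.width γ []).map fun W' => linkRow ρ γ φ k W W'

/-- The uncertainty polytope. -/
def demandPolytope (ρ : ℚ) (γ : ℕ) (φ : ThreeSAT) :
    PolyhedronData (commodityList γ φ.width).length where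
  numAux := 0
  numRows := (demandRows ρ γ φ).length
  A i h := ((demandRows ρ γ φ).get i).1 ((commodityList γ φ.width).get h)
  B _ j := j.elim0
  b i := ((demandRows ρ γ φ).get i).2

theorem mem_demandPolytope {ρ : ℚ} {γ : ℕ} {φ : ThreeSAT}
    {d : Fin (commodityList γ φ.width).length → ℝ} : d ∈ (demandPolytope ρ γ φ).toSet ↔
      ∀ R ∈ demandRows ρ γ φ,
        ∑ h, (R.1 ((commodityList γ φ.width).get h) : ℝ) * d h ≤ (R.2 : ℝ) := by
  constructor
  · rintro ⟨ψ, hψ⟩ R hR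
    obtain ⟨i, rfl⟩ := List.get_of_mem hR
    have := hψ i
    have e : ∑ a, ((demandPolytope ρ γ φ).B i a : ℝ) * ψ a = 0 :=
      Fintype.sum_eq_zero _ fun a => a.elim0
    rw [e, add_zero] at this
    exact this
  · intro h
    refine ⟨fun a => a.elim0, fun i => ?_⟩
    have e : ∑ a, ((demandPolytope ρ γ φ).B i a : ℝ) * (fun a => a.elim0 : Fin 0 → ℝ) a = 0 :=
      Fintype.sum_eq_zero _ fun a => a.elim0
    rw [e, add_zero]
    exact h _ (List.get_mem _ _)

theorem nonneg_of_mem_demandPolytope {ρ : ℚ} {γ : ℕ} {φ : ThreeSAT}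
    {d : Fin (commodityList γ φ.width).length → ℝ} (hd : d ∈ (demandPolytope ρ γ φ).toSet)
    (h : Fin (commodityList γ φ.width).length) : 0 ≤ d h := by
  have h1 := mem_demandPolytope.1 hd (nonnegRow ((commodityList γ φ.width).get h)) (by
    simp only [demandRows, List.mem_append, List.mem_map]
    exact Or.inl (Or.inl ⟨_, List.get_mem _ _, rfl⟩))
  have h2 (i) : (commodityList γ φ.width).get i = (commodityList γ φ.width).get h ↔ i = h :=
    (nodup_commodityList γ φ.width).injective_get.eq_iff
  simp only [nonnegRow, h2] at h1
  rw [Fintype.sum_eq_single h fun i hi => by simp [hi]] at h1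
  simpa using h1

theorem le_share_of_mem_demandPolytope {ρ : ℚ} {γ : ℕ} {φ : ThreeSAT}
    {d : Fin (commodityList γ φ.width).length → ℝ} (hd : d ∈ (demandPolytope ρ γ φ).toSet)
    (h : Fin (commodityList γ φ.width).length) :
    d h ≤ share ρ γ ((commodityList γ φ.width).get h).1 := by
  have h1 := mem_demandPolytope.1 hd (shareRow ρ γ ((commodityList γ φ.width).get h)) (by
    simp only [demandRows, List.mem_append, List.mem_map]
    exact Or.inl (Or.inr ⟨_, List.get_mem _ _, rfl⟩))
  have h2 (i) : (commodityList γ φ.width).get i = (commodityList γ φ.width).get h ↔ i = h :=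
    (nodup_commodityList γ φ.width).injective_get.eq_iff
  simp only [shareRow, h2] at h1
  rw [Fintype.sum_eq_single h fun i hi => by simp [hi]] at h1
  simpa using h1

theorem zero_mem_demandPolytope {ρ : ℚ} (hρ : ρ < 1) {γ : ℕ} {φ : ThreeSAT} :
    0 ∈ (demandPolytope ρ γ φ).toSet := by
  rw [mem_demandPolytope]
  intro R hR
  simp only [Pi.zero_apply, mul_zero, Finset.sum_const_zero, Rat.cast_nonneg]
  simp only [demandRows, List.mem_append, List.mem_map, List.mem_flatMap] at hR
  rcases hR with (⟨c, -, rfl⟩ | ⟨c, -, rfl⟩) | ⟨k, -, W, -, W', -, rfl⟩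
  · exact le_rfl
  · exact (share_pos hρ _ _).le
  · exact le_rfl

theorem numClauses_pos (φ : ThreeSAT) : 0 < φ.numClauses :=
  List.length_pos_iff.2 φ.clauses_ne_nil

theorem width_pos (φ : ThreeSAT) : 0 < φ.width :=
  Nat.mul_pos (by norm_num) φ.numClauses_pos

theorem vertexNum_wordSource_lt (γ : ℕ) (φ : ThreeSAT) {w : List ℕ} (h : IsWord φ.width w)
    (hw : w.length ≤ γ) :
    vertexNum γ φ.width (wordSource φ.width w) < (φ.width + 1) ^ γ + 1 :=
  vertexNum_lt φ.width_pos ((isVertex_wordSource h).mono hw)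

theorem vertexNum_wordTarget_lt (γ : ℕ) (φ : ThreeSAT) {w : List ℕ} (h : IsWord φ.width w)
    (hw : w.length ≤ γ) :
    vertexNum γ φ.width (wordTarget φ.width w) < (φ.width + 1) ^ γ + 1 :=
  vertexNum_lt φ.width_pos ((isVertex_wordTarget h).mono hw)

theorem isWord_leaf {γ M : ℕ} (e : Fin (extensions M γ []).length) :
    IsWord M ((extensions M γ []).get e) :=
  (mem_leaves.1 (List.get_mem _ e)).2

theorem length_leaf {γ M : ℕ} (e : Fin (extensions M γ []).length) :
    ((extensions M γ []).get e).length = γ :=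
  (mem_leaves.1 (List.get_mem _ e)).1

theorem length_node_le {γ M : ℕ} {c : ℕ × List ℕ} (h : c ∈ commodityList γ M) :
    (node γ c).length ≤ γ :=
  (length_node h).trans_le (mem_commodityList.1 h).1

theorem vertexNum_source_ne_target (γ : ℕ) (φ : ThreeSAT) {w : List ℕ} (h : IsWord φ.width w)
    (hw : w.length ≤ γ) :
    vertexNum γ φ.width (wordSource φ.width w) ≠ vertexNum γ φ.width (wordTarget φ.width w) :=
  fun e => wordSource_ne_wordTarget h (vertexNum_inj φ.width_pos
    ((isVertex_wordSource h).mono hw) ((isVertex_wordTarget h).mono hw) e)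

/-- The instance of the minimum congestion problem of a formula. -/
def toCongestion (ρ : ℚ) (hρ : ρ < 1) (γ : ℕ) (φ : ThreeSAT) : CongestionInstance where
  -- Numbers that are not the number of an end of an edge are isolated vertices.
  numV := (φ.width + 1) ^ γ + 1
  numE := (extensions φ.width γ []).length
  numH := (commodityList γ φ.width).length
  src e := ⟨vertexNum γ φ.width (wordSource φ.width ((extensions φ.width γ []).get e)),
    vertexNum_wordSource_lt γ φ (isWord_leaf e) (length_leaf e).le⟩
  tgt e := ⟨vertexNum γ φ.width (wordTarget φ.width ((extensions φ.width γ []).get e)),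
    vertexNum_wordTarget_lt γ φ (isWord_leaf e) (length_leaf e).le⟩
  cap _ := 1
  source h := ⟨vertexNum γ φ.width
    (wordSource φ.width (node γ ((commodityList γ φ.width).get h))),
    vertexNum_wordSource_lt γ φ (isWord_node (List.get_mem _ _))
      (length_node_le (List.get_mem _ _))⟩
  sink h := ⟨vertexNum γ φ.width
    (wordTarget φ.width (node γ ((commodityList γ φ.width).get h))),
    vertexNum_wordTarget_lt γ φ (isWord_node (List.get_mem _ _))
      (length_node_le (List.get_mem _ _))⟩
  poly := demandPolytope ρ γ φ
  src_ne_tgt e h :=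
    vertexNum_source_ne_target γ φ (isWord_leaf e) (length_leaf e).le (Fin.mk.inj h)
  edge_injective e e' h := by
    apply (nodup_extensions φ.width γ []).injective_get
    apply word_eq_of_edge_eq (isWord_leaf e) (isWord_leaf e')
      ((length_leaf e).trans (length_leaf e').symm)
    have s (e : Fin (extensions φ.width γ []).length) :=
      (isVertex_wordSource (isWord_leaf e)).mono (length_leaf e).le
    have t (e : Fin (extensions φ.width γ []).length) :=
      (isVertex_wordTarget (isWord_leaf e)).mono (length_leaf e).le
    have inj {v v'} (h : IsVertex γ φ.width v) (h' : IsVertex γ φ.width v') :=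
      vertexNum_inj φ.width_pos h h'
    simp only [Sym2.eq_iff, Fin.mk.injEq] at h
    rw [Sym2.eq_iff]
    exact h.imp (fun h => ⟨inj (s e) (s e') h.1, inj (t e) (t e') h.2⟩)
      (fun h => ⟨inj (s e) (t e') h.1, inj (t e) (s e') h.2⟩)
  cap_pos _ := one_pos
  source_ne_sink h e := vertexNum_source_ne_target γ φ (isWord_node (List.get_mem _ _))
    (length_node_le (List.get_mem _ _)) (Fin.mk.inj e)
  demand_nonneg _ hd h := nonneg_of_mem_demandPolytope hd h
  demand_bounded := by
    refine (Metric.isBounded_Icc (0 : Fin (commodityList γ φ.width).length → ℝ)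
      (fun h => (share ρ γ ((commodityList γ φ.width).get h).1 : ℝ))).subset fun d hd => ?_
    exact ⟨fun h => nonneg_of_mem_demandPolytope hd h,
      fun h => le_share_of_mem_demandPolytope hd h⟩
  demand_nonempty := ⟨0, zero_mem_demandPolytope hρ⟩

end ThreeSAT

/-! ### Positions of literals in the code of a formula -/

namespace ThreeSAT

/-- The code of a list of literals, up to the end of the formula. -/
def tailCode (ls : List Literal) : List Γ' := ls.flatMap encLiteral ++ [Γ'.ket]

/-- The suffix of the code of the formula that starts just before the `p`-th literal. -/
def suffixAt (φ : ThreeSAT) (p : ℕ) : List Γ' :=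
  (if p = 0 then Γ'.bra else Γ'.comma) :: tailCode (φ.literals.drop p)

theorem encode_eq_suffixAt (φ : ThreeSAT) : φ.encode = φ.suffixAt 0 := by
  have (l : List Clause) : l.flatMap encClause
      = (l.flatMap fun C => [C 0, C 1, C 2]).flatMap encLiteral := by
    induction l with
    | nil => rfl
    | cons C l ih => simp [ih, encClause]
  simp [encode, encList, suffixAt, tailCode, literals, this]

theorem length_literals (φ : ThreeSAT) : φ.literals.length = φ.width := by
  simp [literals, width, numClauses, List.length_flatMap, mul_comm]

theorem tailCode_cons (l : Literal) (ls : List Literal) :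
    tailCode (l :: ls) = Γ'.bit l.2 :: ((encodeNat l.1).map Γ'.bit ++ Γ'.comma :: tailCode ls) := by
  simp [tailCode, encLiteral, encNat]

theorem drop_literals (φ : ThreeSAT) {p : ℕ} (hp : p < φ.width) :
    φ.literals.drop p = φ.literal p :: φ.literals.drop (p + 1) := by
  have hp' : p < φ.literals.length := by rwa [length_literals]
  rw [List.drop_eq_getElem_cons hp', literal, List.getD_eq_getElem _ _ hp']

theorem suffixAt_eq (φ : ThreeSAT) {p : ℕ} (hp : p < φ.width) :
    φ.suffixAt p = (if p = 0 then Γ'.bra else Γ'.comma) :: Γ'.bit (φ.literal p).2 ::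
      ((encodeNat (φ.literal p).1).map Γ'.bit ++ φ.suffixAt (p + 1)) := by
  rw [suffixAt, drop_literals φ hp, tailCode_cons, suffixAt, if_neg (Nat.succ_ne_zero p)]

end ThreeSAT

/-- The automaton that checks that a suffix starts just before a literal, and counts the commas
modulo 3. -/
def posStep (q : Fin 6) (a _ : Option Γ') : Fin 6 :=
  match q, a with
  | 0, some .bra => 1
  | 0, some .comma => 1
  | 1, some (.bit _) => 2
  | 2, some .comma => 3
  | 3, some .comma => 4
  | 4, some .comma => 2
  | 2, _ => 2
  | 3, _ => 3
  | 4, _ => 4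
  | _, _ => 5

/-- The accepting states of `posStep`. -/
def posAcc (q : Fin 6) : Bool := q = 2 || q = 3 || q = 4

/-- The result of `posStep`. -/
def posClass (x : List Γ') : Fin 6 := lockstep posStep 0 x x

theorem lockstep_self_cons (δ : Fin 6 → Option Γ' → Option Γ' → Fin 6) (q : Fin 6) (a : Γ')
    (x : List Γ') : lockstep δ q (a :: x) (a :: x) = lockstep δ (δ q (some a) (some a)) x x := by
  rw [lockstep]

theorem lockstep_posStep_five : ∀ x : List Γ', lockstep posStep 5 x x = 5
  | [] => by rw [lockstep]
  | a :: x => by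
    rw [lockstep_self_cons]
    exact lockstep_posStep_five x

theorem posStep_bit {q : Fin 6} (hq : posAcc q = true) (b : Bool) (o : Option Γ') :
    posStep q (some (.bit b)) o = q := by
  revert hq
  revert q
  decide +revert

theorem lockstep_posStep_bits {q : Fin 6} (hq : posAcc q = true) (x : List Γ') :
    ∀ bs : List Bool, lockstep posStep q (bs.map Γ'.bit ++ x) (bs.map Γ'.bit ++ x)
      = lockstep posStep q x x
  | [] => rfl
  | b :: bs => by
    rw [List.map_cons, List.cons_append, lockstep_self_cons, posStep_bit hq,
      lockstep_posStep_bits hq x bs]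

/-- Advance the state of `posStep` by one comma. -/
def nextClass (q : Fin 6) : Fin 6 := posStep q (some .comma) none

theorem posAcc_nextClass {q : Fin 6} (hq : posAcc q = true) : posAcc (nextClass q) = true := by
  revert hq
  revert q
  decide

theorem lockstep_posStep_tailCode : ∀ (ls : List Literal) (q : Fin 6), posAcc q = true →
    lockstep posStep q (ThreeSAT.tailCode ls) (ThreeSAT.tailCode ls) = nextClass^[ls.length] q
  | [], q, hq => by
    simp only [ThreeSAT.tailCode, List.flatMap_nil, List.nil_append, List.length_nil,
      Function.iterate_zero, id]
    rw [lockstep_self_cons, lockstep]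
    revert hq
    revert q
    decide
  | l :: ls, q, hq => by
    rw [ThreeSAT.tailCode_cons, lockstep_self_cons, posStep_bit hq, lockstep_posStep_bits hq,
      lockstep_self_cons, List.length_cons, Function.iterate_succ_apply]
    exact lockstep_posStep_tailCode ls _ (posAcc_nextClass hq)

theorem iterate_nextClass (n : ℕ) : nextClass^[n] 2 = if n % 3 = 0 then 2 else
    if n % 3 = 1 then 3 else 4 := by
  induction n with
  | zero => rfl
  | succ n ih =>
    rw [Function.iterate_succ_apply', ih]
    obtain h | h | h : n % 3 = 0 ∨ n % 3 = 1 ∨ n % 3 = 2 := by omega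
    · rw [if_pos h, if_neg (by omega), if_pos (by omega)]; rfl
    · rw [if_neg (by omega), if_pos h, if_neg (by omega), if_neg (by omega)]; rfl
    · rw [if_neg (by omega), if_neg (by omega), if_pos (by omega)]; rfl

namespace ThreeSAT

/-- After the opening symbol, `width - p` commas follow. As `width` is a multiple of 3, counting
them modulo 3 yields `p % 3`, with the residues 1 and 2 exchanged. -/
theorem posClass_suffixAt (φ : ThreeSAT) {p : ℕ} (hp : p < φ.width) :
    posClass (φ.suffixAt p) = if p % 3 = 0 then 2 else if p % 3 = 1 then 4 else 3 := by
  have hw : φ.width = 3 * φ.numClauses := rfl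
  have h1 : posStep 0 (some (if p = 0 then Γ'.bra else Γ'.comma))
      (some (if p = 0 then Γ'.bra else Γ'.comma)) = 1 := by split <;> rfl
  rw [posClass, suffixAt, lockstep_self_cons, h1, drop_literals φ hp, tailCode_cons,
    lockstep_self_cons]
  change lockstep posStep 2 _ _ = _
  rw [lockstep_posStep_bits rfl, lockstep_self_cons]
  change lockstep posStep 3 _ _ = _
  rw [lockstep_posStep_tailCode _ _ rfl]
  change nextClass^[_] (nextClass 2) = _
  rw [← Function.iterate_succ_apply, iterate_nextClass, List.length_drop, length_literals]
  obtain h | h | h : p % 3 = 0 ∨ p % 3 = 1 ∨ p % 3 = 2 := by omega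
  · rw [if_pos (by omega), if_pos h]
  · rw [if_neg (by omega), if_neg (by omega), if_neg (by omega), if_pos h]
  · rw [if_neg (by omega), if_pos (by omega), if_neg (by omega), if_neg (by omega)]

/-- The suffixes that start just before a literal. -/
def positions (x : List Γ') : List (List Γ') :=
  (suffixes x).filter fun s => posAcc (posClass s)

theorem positions_bit (b : Bool) (x : List Γ') : positions (.bit b :: x) = positions x := by
  have : posAcc (posClass (.bit b :: x)) = false := by
    rw [posClass, lockstep_self_cons]
    change posAcc (lockstep posStep 5 x x) = false
    rw [lockstep_posStep_five]
    rfl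
  simp [positions, suffixes, this]

theorem positions_bits (x : List Γ') : ∀ bs : List Bool,
    positions (bs.map Γ'.bit ++ x) = positions x
  | [] => rfl
  | b :: bs => by rw [List.map_cons, List.cons_append, positions_bit, positions_bits x bs]

/-- Between two positions there are only bits, at which no position starts. The last comma is
rejected because a bracket, not a sign, follows it. -/
theorem positions_suffixAt (φ : ThreeSAT) : ∀ (n p : ℕ), p + n = φ.width →
    positions (φ.suffixAt p) = (List.range n).map fun i => φ.suffixAt (p + i)
  | 0, p, h => by
    have hp : p ≠ 0 := by
      have := φ.width_pos
      omega
    rw [suffixAt, if_neg hp, List.drop_of_length_le (by rw [length_literals]; omega)]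
    simp only [tailCode, List.flatMap_nil, List.nil_append, List.range_zero, List.map_nil]
    simp [positions, suffixes, posClass, lockstep, posStep, posAcc]
  | n + 1, p, h => by
    have hp : p < φ.width := by omega
    have h1 : posAcc (posClass (φ.suffixAt p)) = true := by
      rw [posClass_suffixAt φ hp]
      split
      · rfl
      · split <;> rfl
    have h2 : positions (φ.suffixAt p) = φ.suffixAt p :: positions (φ.suffixAt (p + 1)) := by
      rw [suffixAt_eq φ hp] at h1 ⊢
      conv_lhs => rw [positions, suffixes, List.filter_cons_of_pos (by simpa using h1)]
      rw [← positions_bits, ← positions_bit (φ.literal p).2, positions]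
    rw [h2, positions_suffixAt φ n (p + 1) (by omega), List.range_succ_eq_map]
    simp only [List.map_cons, List.map_map, add_zero, List.cons.injEq, true_and]
    refine List.map_congr_left fun i _ => ?_
    rw [Function.comp_apply, Nat.succ_eq_add_one, add_assoc, add_comm 1]

/-- The number of positions left in a suffix tells where it starts. -/
theorem suffixAt_inj (φ : ThreeSAT) {p q : ℕ} (hp : p < φ.width) (hq : q < φ.width) :
    φ.suffixAt p = φ.suffixAt q ↔ p = q := by
  refine ⟨fun h => ?_, fun h => h ▸ rfl⟩
  have h1 := positions_suffixAt φ (φ.width - p) p (by omega)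
  have h2 := positions_suffixAt φ (φ.width - q) q (by omega)
  rw [h, h2] at h1
  have := congrArg List.length h1
  simp only [List.length_map, List.length_range] at this
  omega

end ThreeSAT

/-! ### Comparing pointers and recognizing opposite literals. -/

/-- The automaton that compares two lists. -/
def eqStep (q : Fin 6) (a b : Option Γ') : Fin 6 := if q = 0 ∧ a = b then 0 else 1

/-- The accepting state of `eqStep`. -/
def eqAcc (q : Fin 6) : Bool := q = 0

theorem lockstep_eqStep (x y : List Γ') (q : Fin 6) :
    lockstep eqStep q x y = 0 ↔ q = 0 ∧ x = y := by
  induction q, x, y using lockstep.induct eqStep with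
  | case1 q => simp [lockstep]
  | case2 q a x ih => rw [lockstep, ih]; simp [eqStep]
  | case3 q b y ih => rw [lockstep, ih]; simp [eqStep]
  | case4 q a x b y ih =>
    rw [lockstep, ih, eqStep]
    by_cases h : q = 0 ∧ a = b
    · simp [h.1, h.2]
    · have h' : ¬ (q = 0 ∧ some a = some b) := by simpa using h
      rw [if_neg h']
      simp only [Fin.isValue, one_ne_zero, List.cons.injEq, false_and, false_iff]
      tauto

/-- The automaton that checks that the literals after two positions are opposite. -/
def conflictStep (q : Fin 6) (a b : Option Γ') : Fin 6 :=
  match q, a, b with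
  | 0, _, _ => 1
  | 1, some (.bit s), some (.bit s') => if s = s' then 4 else 2
  | 2, some (.bit s), some (.bit s') => if s = s' then 2 else 4
  | 2, some .comma, some .comma => 3
  | 3, _, _ => 3
  | _, _, _ => 4

/-- The accepting state of `conflictStep`. -/
def conflictAcc (q : Fin 6) : Bool := q = 3

theorem lockstep_fixed {δ : Fin 6 → Option Γ' → Option Γ' → Fin 6} {q : Fin 6}
    (h : ∀ a b, δ q a b = q) (x y : List Γ') : lockstep δ q x y = q := by
  induction x generalizing y with
  | nil =>
    induction y with
    | nil => rw [lockstep]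
    | cons b y ih => rw [lockstep, h, ih]
  | cons a x ih =>
    cases y with
    | nil => rw [lockstep, h, ih]
    | cons b y => rw [lockstep, h, ih]

theorem lockstep_conflictStep_two (x y : List Γ') : ∀ bs cs : List Bool,
    lockstep conflictStep 2 (bs.map Γ'.bit ++ .comma :: x) (cs.map Γ'.bit ++ .comma :: y)
      = if bs = cs then 3 else 4
  | [], [] => by
    simp only [List.map_nil, List.nil_append, if_true]
    rw [lockstep]
    exact lockstep_fixed (fun _ _ => rfl) x y
  | [], c :: cs => by
    simp only [List.map_nil, List.nil_append, List.map_cons, List.cons_append]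
    rw [lockstep]
    exact lockstep_fixed (fun _ _ => rfl) _ _
  | b :: bs, [] => by
    simp only [List.map_nil, List.nil_append, List.map_cons, List.cons_append]
    rw [lockstep]
    exact lockstep_fixed (fun _ _ => rfl) _ _
  | b :: bs, c :: cs => by
    simp only [List.map_cons, List.cons_append]
    rw [lockstep]
    by_cases h : b = c
    · subst h
      have : conflictStep 2 (some (.bit b)) (some (.bit b)) = 2 := if_pos rfl
      rw [this, lockstep_conflictStep_two x y bs cs]
      simp
    · have : conflictStep 2 (some (.bit b)) (some (.bit c)) = 4 := if_neg h
      rw [this, lockstep_fixed fun _ _ => rfl, if_neg (by simp [h])]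

theorem encodeNat_injective : Function.Injective encodeNat :=
  Function.LeftInverse.injective decode_encodeNat

/-- The automaton skips the symbols before the literals, requires different signs, then requires
equal bits until both names end with a comma at the same time. What follows is ignored. -/
theorem ThreeSAT.conflictAcc_suffixAt (φ : ThreeSAT) {p q : ℕ} (hp : p < φ.width)
    (hq : q < φ.width) :
    conflictAcc (lockstep conflictStep 0 (φ.suffixAt p) (φ.suffixAt q)) = true ↔
      φ.Conflict p q := by
  have hs (p : ℕ) : φ.suffixAt (p + 1) = .comma :: tailCode (φ.literals.drop (p + 1)) := by
    rw [suffixAt, if_neg (Nat.succ_ne_zero p)]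
  rw [suffixAt_eq φ hp, suffixAt_eq φ hq, lockstep, hs p, hs q]
  change conflictAcc (lockstep conflictStep 1 _ _) = true ↔ _
  rw [lockstep, Conflict]
  by_cases h : (φ.literal p).2 = (φ.literal q).2
  · have : conflictStep 1 (some (.bit (φ.literal p).2)) (some (.bit (φ.literal q).2)) = 4 :=
      if_pos h
    rw [this, lockstep_fixed fun _ _ => rfl]
    simp [h, conflictAcc]
  · have : conflictStep 1 (some (.bit (φ.literal p).2)) (some (.bit (φ.literal q).2)) = 2 :=
      if_neg h
    rw [this, lockstep_conflictStep_two]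
    by_cases h' : (φ.literal p).1 = (φ.literal q).1
    · simp [h, h', conflictAcc]
    · rw [if_neg (fun e => h' (encodeNat_injective e))]
      simp [h', conflictAcc]

/-! ### Programs that print the instance of a formula -/

namespace PtrProg

/-- Print a constant string. -/
def emitAll : List Γ' → PtrProg
  | [] => skip
  | a :: l => seq (emit a) (emitAll l)

theorem eval_emitAll (n : ℕ) (env : ℕ → List Γ') : ∀ l : List Γ', (emitAll l).eval n env = l
  | [] => rfl
  | a :: l => by simp [emitAll, eval, eval_emitAll n env l]

theorem wf_emitAll (n : ℕ) : ∀ l : List Γ', (emitAll l).WF n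
  | [] => trivial
  | _ :: l => ⟨trivial, wf_emitAll n l⟩

/-- Run several programs. -/
def seqAll : List PtrProg → PtrProg
  | [] => skip
  | p :: l => seq p (seqAll l)

theorem eval_seqAll (n : ℕ) (env : ℕ → List Γ') : ∀ l : List PtrProg,
    (seqAll l).eval n env = l.flatMap fun p => p.eval n env
  | [] => rfl
  | p :: l => by simp [seqAll, eval, eval_seqAll n env l]

theorem wf_seqAll {n : ℕ} : ∀ {l : List PtrProg}, (∀ p ∈ l, p.WF n) → (seqAll l).WF n
  | [], _ => trivial
  | p :: _, h => ⟨h p (by simp), wf_seqAll fun q hq => h q (by simp [hq])⟩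

/-- Loop over the literals from the position of a variable. -/
def loopPos (n src : ℕ) (p : PtrProg) : PtrProg :=
  loop src (test posStep posAcc n n p skip)

theorem wf_loopPos {n src : ℕ} {p : PtrProg} (h : src < n) (hp : p.WF (n + 1)) :
    (loopPos n src p).WF n :=
  ⟨h, Nat.lt_succ_self n, Nat.lt_succ_self n, hp, trivial⟩

theorem eval_loopPos (n src : ℕ) (p : PtrProg) (env : ℕ → List Γ') :
    (loopPos n src p).eval n env = (ThreeSAT.positions (env src)).flatMap fun s =>
      p.eval (n + 1) (Function.update env n s) := by
  rw [loopPos, eval, ThreeSAT.positions]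
  induction suffixes (env src) with
  | nil => rfl
  | cons s l ih =>
    rw [List.flatMap_cons, ih, eval, Function.update_self, ← posClass]
    by_cases h : posAcc (posClass s) = true
    · rw [if_pos h, List.filter_cons_of_pos (p := fun s => posAcc (posClass s)) h, List.flatMap_cons]
    · rw [if_neg h, List.filter_cons_of_neg (p := fun s => posAcc (posClass s)) h]
      simp [eval]

/-- Loop over words of length `r`. -/
def loopWords : ℕ → ℕ → PtrProg → PtrProg
  | 0, _, p => p
  | r + 1, n, p => loopPos n 0 (loopWords r (n + 1) p)

theorem wf_loopWords {p : PtrProg} : ∀ {r n : ℕ}, 0 < n → p.WF (n + r) → (loopWords r n p).WF n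
  | 0, _, _, h => h
  | r + 1, n, hn, h => wf_loopPos hn (wf_loopWords (Nat.succ_pos n) (by
      rwa [add_right_comm] : p.WF (n + 1 + r)))

/-- The variables from `b` on hold the positions of the letters of a word. -/
def Loaded (φ : ThreeSAT) (b : ℕ) (env : ℕ → List Γ') : List ℕ → Prop
  | [] => True
  | p :: w => (p < φ.width ∧ env (b + w.length) = φ.suffixAt p) ∧ Loaded φ b env w

variable {φ : ThreeSAT}

theorem Loaded.congr {b : ℕ} {env env' : ℕ → List Γ'} : ∀ {w : List ℕ}, Loaded φ b env w →
    (∀ i < b + w.length, env' i = env i) → Loaded φ b env' w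
  | [], _, _ => trivial
  | p :: w, h, he => ⟨⟨h.1.1, by
      rw [he _ (by simp)]
      exact h.1.2⟩, h.2.congr fun i hi => he i (by simp; omega)⟩

theorem Loaded.drop {b : ℕ} {env : ℕ → List Γ'} : ∀ {w : List ℕ}, Loaded φ b env w →
    ∀ i, Loaded φ b env (w.drop i)
  | w, h, 0 => h
  | [], _, i + 1 => by simp [Loaded]
  | _ :: _, h, i + 1 => by
    rw [List.drop_succ_cons]
    exact h.2.drop i

theorem flatMap_positions {p : ℕ} (hp : p ≤ φ.width) (f : List Γ' → List Γ') :
    (ThreeSAT.positions (φ.suffixAt p)).flatMap f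
      = (List.range (φ.width - p)).flatMap fun i => f (φ.suffixAt (p + i)) := by
  rw [φ.positions_suffixAt (φ.width - p) p (by omega), List.flatMap_map]

/-- Inner loops add letters in front of the word, so the oldest letter is the last one. Hence the
letter `p` of `p :: w` is in the variable `b + w.length`, and dropping letters frees the highest
variables. -/
theorem eval_loopWords {b : ℕ} (hb : 0 < b) {p : PtrProg} {out : List ℕ → List Γ'}
    {env₀ : ℕ → List Γ'} (h0 : env₀ 0 = φ.suffixAt 0) :
    ∀ (r n : ℕ) (w : List ℕ) (env : ℕ → List Γ'), (∀ i < b, env i = env₀ i) →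
    Loaded φ b env w → n = b + w.length →
    (∀ env' W, W ∈ extensions φ.width r w → Loaded φ b env' W → (∀ i < b, env' i = env₀ i) →
      p.eval (n + r) env' = out W) →
    (loopWords r n p).eval n env = (extensions φ.width r w).flatMap out
  | 0, n, w, env, he, hw, hn, h => by
    simpa [loopWords, extensions] using h env w (by simp [extensions]) hw he
  | r + 1, n, w, env, he, hw, hn, h => by
    rw [loopWords, eval_loopPos, he 0 hb, h0, flatMap_positions (Nat.zero_le _), Nat.sub_zero,
      extensions, List.flatMap_assoc]
    refine List.flatMap_congr fun q hq => ?_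
    rw [List.mem_range] at hq
    rw [Nat.zero_add]
    refine eval_loopWords hb h0 r (n + 1) (q :: w) _ (fun i hi => ?_) ⟨⟨hq, ?_⟩, ?_⟩ ?_ ?_
    · rw [Function.update_of_ne (by omega), he i hi]
    · rw [← hn, Function.update_self]
    · exact hw.congr fun i hi => Function.update_of_ne (by omega) _ _
    · simp [hn, add_assoc]
    · intro env' W hW hl he'
      rw [add_assoc, add_comm 1 r]
      refine h env' W ?_ hl he'
      rw [extensions, List.mem_flatMap]
      exact ⟨q, List.mem_range.2 hq, hW⟩

/-! #### Numbers in unary -/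

/-- Print `(M + 1) ^ e` in unary, where `M` is the number of literals. -/
def powProg : ℕ → ℕ → PtrProg
  | 0, _ => emit (.bit true)
  | e + 1, n => seq (loopPos n 0 (powProg e (n + 1))) (powProg e n)

theorem wf_powProg : ∀ (e : ℕ) {n : ℕ}, 0 < n → (powProg e n).WF n
  | 0, _, _ => trivial
  | e + 1, n, hn => ⟨wf_loopPos hn (wf_powProg e (Nat.succ_pos n)), wf_powProg e hn⟩

theorem flatMap_const_replicate {α : Type} (a : Γ') (k : ℕ) (l : List α) :
    (l.flatMap fun _ => List.replicate k a) = List.replicate (l.length * k) a := by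
  induction l with
  | nil => simp
  | cons x l ih => rw [List.flatMap_cons, ih, List.replicate_append_replicate, List.length_cons,
      Nat.succ_mul, add_comm]

/-- `(M + 1) ^ (e + 1)` is `M` copies of `(M + 1) ^ e`, printed by the loop, and one more copy. -/
theorem eval_powProg : ∀ (e : ℕ) {n : ℕ} {env : ℕ → List Γ'}, 0 < n →
    env 0 = φ.suffixAt 0 →
    (powProg e n).eval n env = List.replicate ((φ.width + 1) ^ e) (.bit true)
  | 0, n, env, _, _ => by simp [powProg, eval]
  | e + 1, n, env, hn, h => by
    rw [powProg, eval, eval_loopPos, h, flatMap_positions (Nat.zero_le _), eval_powProg e hn h]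
    rw [List.flatMap_congr (g := fun _ => List.replicate ((φ.width + 1) ^ e) (.bit true))
      fun i _ => eval_powProg e (Nat.succ_pos n) (by
        rw [Function.update_of_ne (by omega), h])]
    rw [flatMap_const_replicate, List.replicate_append_replicate, List.length_range, Nat.sub_zero,
      pow_succ']
    ring_nf

/-- Print `(M + 1) ^ e` times the number with the address of a word of length `κ` as digits. -/
def addressProg (n b : ℕ) : ℕ → ℕ → PtrProg
  | 0, _ => skip
  | κ + 1, e => seq (loopPos n (b + κ) (powProg e (n + 1))) (addressProg n b κ (e + 1))

theorem wf_addressProg {n b : ℕ} : ∀ {κ : ℕ} (e : ℕ), b + κ ≤ n → (addressProg n b κ e).WF n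
  | 0, _, _ => trivial
  | κ + 1, e, h => ⟨wf_loopPos (by omega) (wf_powProg e (Nat.succ_pos n)),
      wf_addressProg (e + 1) (by omega)⟩

/-- A loop from the position `p` to the end runs `M - p` times, which is the digit; each run prints
the weight `(M + 1) ^ e` of that digit. -/
theorem eval_addressProg {n b : ℕ} {env : ℕ → List Γ'} (hn : 0 < n) (h0 : env 0 = φ.suffixAt 0) :
    ∀ (w : List ℕ) (e : ℕ), Loaded φ b env w → (addressProg n b w.length e).eval n env
      = List.replicate ((φ.width + 1) ^ e * Nat.ofDigits (φ.width + 1) (address φ.width w))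
        (.bit true)
  | [], e, _ => by simp [addressProg, eval, address]
  | p :: w, e, h => by
    rw [List.length_cons, addressProg, eval, eval_addressProg hn h0 w (e + 1) h.2, eval_loopPos,
      h.1.2, flatMap_positions h.1.1.le]
    rw [List.flatMap_congr (g := fun _ => List.replicate ((φ.width + 1) ^ e) (.bit true))
      fun i _ => eval_powProg e (Nat.succ_pos n) (by
        rw [Function.update_of_ne (by omega), h0])]
    rw [flatMap_const_replicate, List.replicate_append_replicate, List.length_range]
    congr 1
    have : address φ.width (p :: w) = (φ.width - p) :: address φ.width w := rfl
    rw [this, Nat.ofDigits_cons]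
    ring

/-- Print the number of the source of a word of length `κ`. -/
def sourceProg (n b : ℕ) : ℕ → PtrProg
  | 0 => skip
  | κ + 1 => test posStep (· = 2) (b + κ) (b + κ) (sourceProg n b κ)
      (seq (emit (.bit true)) (addressProg n b (κ + 1) 0))

theorem wf_sourceProg {n b : ℕ} : ∀ {κ : ℕ}, b + κ ≤ n → (sourceProg n b κ).WF n
  | 0, _ => trivial
  | κ + 1, h => ⟨by omega, by omega, wf_sourceProg (by omega), trivial, wf_addressProg 0 h⟩

/-- State `2` of `posStep` means `p % 3 = 0`. The single bit printed otherwise raises the lowest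
digit from `M - p` to `M - p + 1`. -/
theorem eval_sourceProg {γ n b : ℕ} {env : ℕ → List Γ'} (hn : 0 < n)
    (h0 : env 0 = φ.suffixAt 0) : ∀ w : List ℕ, Loaded φ b env w →
    (sourceProg n b w.length).eval n env
      = List.replicate (vertexNum γ φ.width (wordSource φ.width w)) (.bit true)
  | [], _ => by simp [sourceProg, eval, wordSource, vertexNum]
  | p :: w, h => by
    rw [List.length_cons, sourceProg, eval, h.1.2, ← posClass, φ.posClass_suffixAt h.1.1,
      wordSource]
    by_cases hp : p % 3 = 0
    · simpa [hp] using eval_sourceProg hn h0 w h.2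
    · have : (if p % 3 = 1 then (4 : Fin 6) else 3) ≠ 2 := by split <;> decide
      rw [if_neg hp, if_neg hp, if_neg (by simpa using this)]
      have := eval_addressProg hn h0 (p :: w) 0 h
      rw [List.length_cons] at this
      rw [eval, eval, this, List.singleton_append, ← List.replicate_succ]
      congr 1
      simp only [vertexNum, address, List.map_cons, Nat.ofDigits_cons]
      ring

/-- Print the number of the target of a word of length `κ`. -/
def targetProg (γ n b : ℕ) : ℕ → PtrProg
  | 0 => powProg γ n
  | κ + 1 => test posStep (· = 3) (b + κ) (b + κ) (targetProg γ n b κ)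
      (addressProg n b (κ + 1) 0)

theorem wf_targetProg {γ n b : ℕ} (hn : 0 < n) : ∀ {κ : ℕ}, b + κ ≤ n →
    (targetProg γ n b κ).WF n
  | 0, _ => wf_powProg γ hn
  | κ + 1, h => ⟨by omega, by omega, wf_targetProg hn (by omega), wf_addressProg 0 h⟩

theorem eval_targetProg {γ n b : ℕ} {env : ℕ → List Γ'} (hn : 0 < n)
    (h0 : env 0 = φ.suffixAt 0) : ∀ w : List ℕ, Loaded φ b env w →
    (targetProg γ n b w.length).eval n env
      = List.replicate (vertexNum γ φ.width (wordTarget φ.width w)) (.bit true)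
  | [], _ => by
    rw [List.length_nil, targetProg, eval_powProg γ hn h0]
    rfl
  | p :: w, h => by
    rw [List.length_cons, targetProg, eval, h.1.2, ← posClass, φ.posClass_suffixAt h.1.1,
      wordTarget]
    by_cases hp : p % 3 = 2
    · simpa [hp] using eval_targetProg hn h0 w h.2
    · have : (if p % 3 = 0 then (2 : Fin 6) else if p % 3 = 1 then 4 else 3) ≠ 3 := by
        obtain h | h : p % 3 = 0 ∨ p % 3 = 1 := by omega
        · rw [if_pos h]; decide
        · rw [if_neg (by omega), if_pos h]; decide
      rw [if_neg hp, if_neg (by simpa using this)]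
      have := eval_addressProg hn h0 (p :: w) 0 h
      rw [List.length_cons] at this
      rw [this, pow_zero, one_mul]
      rfl

/-- Print the endpoints of a word of length `κ`. -/
def endsProg (γ n b κ : ℕ) : PtrProg :=
  seq (seq (sourceProg n b κ) (emit .comma)) (seq (targetProg γ n b κ) (emit .comma))

theorem wf_endsProg {γ n b κ : ℕ} (hn : 0 < n) (h : b + κ ≤ n) : (endsProg γ n b κ).WF n :=
  ⟨⟨wf_sourceProg h, trivial⟩, wf_targetProg hn h, trivial⟩

theorem eval_endsProg {γ n b : ℕ} {env : ℕ → List Γ'} (hn : 0 < n)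
    (h0 : env 0 = φ.suffixAt 0) {w : List ℕ} (h : Loaded φ b env w) :
    (endsProg γ n b w.length).eval n env
      = encUnary (vertexNum γ φ.width (wordSource φ.width w)) ++
        encUnary (vertexNum γ φ.width (wordTarget φ.width w)) := by
  simp only [endsProg, eval, eval_sourceProg (γ := γ) hn h0 w h, eval_targetProg hn h0 w h,
    encUnary]

/-! #### Comparisons of words -/

/-- Branch on the equality of two words of length `κ`. -/
def ifEq (b b' : ℕ) : ℕ → PtrProg → PtrProg → PtrProg
  | 0, p, _ => p
  | κ + 1, p, q => test eqStep eqAcc (b + κ) (b' + κ) (ifEq b b' κ p q) q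

theorem wf_ifEq {n b b' : ℕ} {p q : PtrProg} (hp : p.WF n) (hq : q.WF n) : ∀ {κ : ℕ},
    b + κ ≤ n → b' + κ ≤ n → (ifEq b b' κ p q).WF n
  | 0, _, _ => hp
  | κ + 1, h, h' => ⟨by omega, by omega, wf_ifEq hp hq (by omega) (by omega), hq⟩

theorem eval_ifEq {n b b' : ℕ} {env : ℕ → List Γ'} {p q : PtrProg} : ∀ {w w' : List ℕ},
    Loaded φ b env w → Loaded φ b' env w' → w.length = w'.length →
    (ifEq b b' w.length p q).eval n env = if w = w' then p.eval n env else q.eval n env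
  | [], [], _, _, _ => by simp [ifEq]
  | [], _ :: _, _, _, h => by simp at h
  | _ :: _, [], _, _, h => by simp at h
  | a :: w, a' :: w', h, h', hl => by
    have hl' : w.length = w'.length := by simpa using hl
    rw [List.length_cons, ifEq, eval, h.1.2, hl', h'.1.2, ← hl', eval_ifEq h.2 h'.2 hl']
    have key : eqAcc (lockstep eqStep 0 (φ.suffixAt a) (φ.suffixAt a')) = true ↔ a = a' := by
      rw [eqAcc, decide_eq_true_iff, lockstep_eqStep, φ.suffixAt_inj h.1.1 h'.1.1]
      simp
    by_cases ha : a = a'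
    · rw [if_pos (key.2 ha)]
      simp [ha]
    · rw [if_neg (fun e => ha (key.1 e)), if_neg (by simp [ha])]

/-- Branch on the clash of two words at level `k`. -/
def ifClash (b b' k : ℕ) (p q : PtrProg) : PtrProg :=
  ifEq b b' k (test conflictStep conflictAcc (b + k) (b' + k) p q) q

theorem wf_ifClash {n b b' k : ℕ} {p q : PtrProg} (hp : p.WF n) (hq : q.WF n)
    (h : b + k < n) (h' : b' + k < n) : (ifClash b b' k p q).WF n :=
  wf_ifEq (show WF n (test _ _ _ _ p q) from ⟨h, h', hp, hq⟩) hq h.le h'.le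

theorem eval_ifClash {γ n b b' k : ℕ} {env : ℕ → List Γ'} {p q : PtrProg} (hk : k < γ)
    {W W' : List ℕ} (h : Loaded φ b env W) (h' : Loaded φ b' env W') (hW : W.length = γ)
    (hW' : W'.length = γ) : (ifClash b b' k p q).eval n env
      = if φ.Clash γ k W W' then p.eval n env else q.eval n env := by
  have hl (V : List ℕ) (hV : V.length = γ) : (V.drop (γ - k)).length = k := by
    rw [List.length_drop]; omega
  have hd (V : List ℕ) (hV : V.length = γ) :
      ∃ a, V.drop (γ - (k + 1)) = a :: V.drop (γ - k) := by
    refine ⟨V[γ - (k + 1)], ?_⟩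
    rw [List.drop_eq_getElem_cons (by omega)]
    congr 2
    omega
  obtain ⟨a, ha⟩ := hd W hW
  obtain ⟨a', ha'⟩ := hd W' hW'
  have e := h.drop (γ - (k + 1))
  have e' := h'.drop (γ - (k + 1))
  rw [ha] at e
  rw [ha'] at e'
  have := eval_ifEq (n := n) (p := test conflictStep conflictAcc (b + k) (b' + k) p q) (q := q)
    e.2 e'.2 ((hl W hW).trans (hl W' hW').symm)
  rw [hl W hW] at this
  have e1 := e.1.2
  have e1' := e'.1.2
  rw [hl W hW] at e1
  rw [hl W' hW'] at e1'
  have hC : φ.Clash γ k W W' ↔ W.drop (γ - k) = W'.drop (γ - k) ∧ φ.Conflict a a' := by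
    simp [ThreeSAT.Clash, ha, ha']
  rw [ifClash, this, eval, e1, e1']
  have key := φ.conflictAcc_suffixAt e.1.1 e'.1.1
  by_cases c1 : W.drop (γ - k) = W'.drop (γ - k)
  · by_cases c2 : φ.Conflict a a'
    · rw [if_pos c1, if_pos (key.2 c2), if_pos (hC.2 ⟨c1, c2⟩)]
    · rw [if_pos c1, if_neg (fun c => c2 (key.1 c)), if_neg (fun c => c2 (hC.1 c).2)]
  · rw [if_neg c1, if_neg (fun c => c1 (hC.1 c).1)]

end PtrProg

/-! ### Printing commodities, inequalities and the whole instance. -/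

namespace PtrProg

variable {φ : ThreeSAT}

/-- Loop over the commodities. -/
def loopCommodities (γ n : ℕ) (p : ℕ → PtrProg) : PtrProg :=
  seqAll ((List.range (γ + 1)).map fun κ => loopWords γ n (p κ))

theorem wf_loopCommodities {γ n : ℕ} {p : ℕ → PtrProg} (hn : 0 < n)
    (h : ∀ κ ≤ γ, (p κ).WF (n + γ)) : (loopCommodities γ n p).WF n := by
  refine wf_seqAll fun q hq => ?_
  obtain ⟨κ, hκ, rfl⟩ := List.mem_map.1 hq
  exact wf_loopWords hn (h κ (Nat.lt_succ_iff.1 (List.mem_range.1 hκ)))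

theorem eval_loopLeaves {γ n : ℕ} {p : PtrProg} {out : List ℕ → List Γ'} {env : ℕ → List Γ'}
    (hn : 0 < n) (h0 : env 0 = φ.suffixAt 0)
    (h : ∀ env' W, W ∈ extensions φ.width γ [] → Loaded φ n env' W →
      (∀ i < n, env' i = env i) → p.eval (n + γ) env' = out W) :
    (loopWords γ n p).eval n env = (extensions φ.width γ []).flatMap out :=
  eval_loopWords hn h0 γ n [] env (fun _ _ => rfl) trivial rfl h

theorem eval_loopCommodities {γ n : ℕ} {p : ℕ → PtrProg} {out : ℕ × List ℕ → List Γ'}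
    {env : ℕ → List Γ'} (hn : 0 < n) (h0 : env 0 = φ.suffixAt 0)
    (h : ∀ κ ≤ γ, ∀ env' W, W ∈ extensions φ.width γ [] → Loaded φ n env' W →
      (∀ i < n, env' i = env i) → (p κ).eval (n + γ) env' = out (κ, W)) :
    (loopCommodities γ n p).eval n env = (commodityList γ φ.width).flatMap out := by
  rw [loopCommodities, eval_seqAll, commodityList, List.flatMap_map, List.flatMap_assoc]
  refine List.flatMap_congr fun κ hκ => ?_
  rw [List.flatMap_map]
  exact eval_loopLeaves hn h0 (h κ (Nat.lt_succ_iff.1 (List.mem_range.1 hκ)))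

/-- The code of an inequality. -/
def rowCode (γ : ℕ) (φ : ThreeSAT) (R : DemandRow) : List Γ' :=
  encList (fun c => encRat (R.1 c)) (commodityList γ φ.width) ++ [Γ'.bra, Γ'.ket] ++ encRat R.2

/-- Print an inequality. -/
def rowProg (γ n : ℕ) (entry : ℕ → PtrProg) (rhs : ℚ) : PtrProg :=
  seq (emit .bra) (seq (loopCommodities γ n entry)
    -- The second pair of brackets is the row of `B`, empty since there are no auxiliary variables.
    (emitAll (Γ'.ket :: Γ'.bra :: Γ'.ket :: encRat rhs)))

theorem wf_rowProg {γ n : ℕ} {entry : ℕ → PtrProg} {rhs : ℚ} (hn : 0 < n)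
    (h : ∀ κ ≤ γ, (entry κ).WF (n + γ)) : (rowProg γ n entry rhs).WF n :=
  ⟨trivial, wf_loopCommodities hn h, wf_emitAll _ _⟩

theorem eval_rowProg {γ n : ℕ} {entry : ℕ → PtrProg} {R : DemandRow} {env : ℕ → List Γ'}
    (hn : 0 < n) (h0 : env 0 = φ.suffixAt 0)
    (h : ∀ κ ≤ γ, ∀ env' V, V ∈ extensions φ.width γ [] → Loaded φ n env' V →
      (∀ i < n, env' i = env i) → (entry κ).eval (n + γ) env' = encRat (R.1 (κ, V))) :
    (rowProg γ n entry R.2).eval n env = rowCode γ φ R := by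
  rw [rowProg, eval, eval, eval, eval_emitAll,
    eval_loopCommodities (out := fun c => encRat (R.1 c)) hn h0 h]
  simp [rowCode, encList]

/-- Print the entries of a multiple of a unit vector. -/
def unitEntry (γ κ₀ : ℕ) (a : ℚ) (κ : ℕ) : PtrProg :=
  -- The variables from `1` on hold the word of the row, those from `1 + γ` on the word of the
  -- column.
  if κ = κ₀ then ifEq (1 + γ) 1 γ (emitAll (encRat a)) (emitAll (encRat 0))
  else emitAll (encRat 0)

theorem wf_unitEntry (γ κ₀ : ℕ) (a : ℚ) (κ : ℕ) : (unitEntry γ κ₀ a κ).WF (1 + γ + γ) := by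
  rw [unitEntry]
  split
  · exact wf_ifEq (wf_emitAll _ _) (wf_emitAll _ _) le_rfl (by omega)
  · exact wf_emitAll _ _

theorem eval_ifEq_leaves {γ n b b' : ℕ} {env : ℕ → List Γ'} {p q : PtrProg} {V W : List ℕ}
    (hV : Loaded φ b env V) (hW : Loaded φ b' env W) (lV : V.length = γ) (lW : W.length = γ) :
    (ifEq b b' γ p q).eval n env = if V = W then p.eval n env else q.eval n env := by
  have := eval_ifEq (n := n) (p := p) (q := q) hV hW (lV.trans lW.symm)
  rwa [lV] at this

theorem eval_unitRow {γ κ₀ : ℕ} {a rhs : ℚ} {W : List ℕ} {env : ℕ → List Γ'}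
    (h0 : env 0 = φ.suffixAt 0) (hW : W ∈ extensions φ.width γ []) (hl : Loaded φ 1 env W) :
    (rowProg γ (1 + γ) (unitEntry γ κ₀ a) rhs).eval (1 + γ) env
      = rowCode γ φ (fun x => if x = (κ₀, W) then a else 0, rhs) := by
  refine eval_rowProg (R := (fun x => if x = (κ₀, W) then a else 0, rhs)) (by omega) h0
    fun κ hκ env' V hV hl' he => ?_
  have lW := (mem_leaves.1 hW).1
  have lV := (mem_leaves.1 hV).1
  have hl1 : Loaded φ 1 env' W := hl.congr fun i hi => he i (by omega)
  rw [unitEntry]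
  by_cases hk : κ = κ₀
  · rw [if_pos hk, eval_ifEq_leaves hl' hl1 lV lW, eval_emitAll, eval_emitAll]
    by_cases hVW : V = W <;> simp [hVW, hk]
  · rw [if_neg hk, eval_emitAll]
    simp [hk]

/-- Print the entries of `ThreeSAT.linkRow`. -/
def linkEntry (ρ : ℚ) (γ k κ : ℕ) : PtrProg :=
  if κ = k + 1 then
    -- The words `W` and `W'` of the row start at the variables `1` and `1 + γ`, the word of the
    -- column at `1 + γ + γ`.
    ifEq (1 + γ + γ) 1 γ (emitAll (encRat (1 / share ρ γ (k + 1))))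
      (ifClash 1 (1 + γ) k
        (ifEq (1 + γ + γ) (1 + γ) γ (emitAll (encRat (1 / share ρ γ (k + 1))))
          (emitAll (encRat 0)))
        (emitAll (encRat 0)))
  else if κ = k then
    ifEq (1 + γ + γ) 1 γ (emitAll (encRat (-1 / share ρ γ k))) (emitAll (encRat 0))
  else emitAll (encRat 0)

theorem wf_linkEntry {ρ : ℚ} {γ k κ : ℕ} (hk : k < γ) :
    (linkEntry ρ γ k κ).WF (1 + γ + γ + γ) := by
  have w (l : List Γ') := wf_emitAll (1 + γ + γ + γ) l
  rw [linkEntry]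
  split
  · exact wf_ifEq (w _) (wf_ifClash (wf_ifEq (w _) (w _) le_rfl (by omega)) (w _) (by omega)
      (by omega)) le_rfl (by omega)
  · split
    · exact wf_ifEq (w _) (w _) le_rfl (by omega)
    · exact w _

theorem eval_linkRow {ρ : ℚ} {γ k : ℕ} (hk : k < γ) {W W' : List ℕ} {env : ℕ → List Γ'}
    (h0 : env 0 = φ.suffixAt 0) (hW : W ∈ extensions φ.width γ []) (hl : Loaded φ 1 env W)
    (hW' : W' ∈ extensions φ.width γ []) (hl' : Loaded φ (1 + γ) env W') :
    (rowProg γ (1 + γ + γ) (linkEntry ρ γ k) 0).eval (1 + γ + γ) env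
      = rowCode γ φ (φ.linkRow ρ γ k W W') := by
  refine eval_rowProg (R := φ.linkRow ρ γ k W W') (by omega) h0 fun κ hκ env' V hV hlV he => ?_
  have lW := (mem_leaves.1 hW).1
  have lW' := (mem_leaves.1 hW').1
  have lV := (mem_leaves.1 hV).1
  have hl1 : Loaded φ 1 env' W := hl.congr fun i hi => he i (by omega)
  have hl2 : Loaded φ (1 + γ) env' W' := hl'.congr fun i hi => he i (by omega)
  rw [linkEntry, ThreeSAT.linkRow]
  by_cases h1 : κ = k + 1
  · rw [if_pos h1, eval_ifEq_leaves hlV hl1 lV lW, eval_ifClash hk hl1 hl2 lW lW',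
      eval_ifEq_leaves hlV hl2 lV lW']
    simp only [eval_emitAll, h1, if_true]
    split_ifs <;> rfl
  · rw [if_neg h1]
    by_cases h2 : κ = k
    · rw [if_pos h2, eval_ifEq_leaves hlV hl1 lV lW]
      simp only [eval_emitAll, if_neg h1, if_pos h2]
      split_ifs <;> rfl
    · rw [if_neg h2]
      simp only [eval_emitAll, h1, h2, if_false]

/-- Print the inequalities of the polytope. -/
def rowsProg (ρ : ℚ) (γ : ℕ) : PtrProg :=
  seq (seq
    (loopCommodities γ 1 fun κ => rowProg γ (1 + γ) (unitEntry γ κ (-1)) 0)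
    (loopCommodities γ 1 fun κ => rowProg γ (1 + γ) (unitEntry γ κ 1) (share ρ γ κ)))
    (seqAll ((List.range γ).map fun k => loopWords γ 1 (loopWords γ (1 + γ)
      (rowProg γ (1 + γ + γ) (linkEntry ρ γ k) 0))))

theorem wf_rowsProg (ρ : ℚ) (γ : ℕ) : (rowsProg ρ γ).WF 1 := by
  refine ⟨⟨wf_loopCommodities one_pos fun κ _ => wf_rowProg (by omega) fun _ _ =>
    wf_unitEntry _ _ _ _, wf_loopCommodities one_pos fun κ _ => wf_rowProg (by omega) fun _ _ =>
    wf_unitEntry _ _ _ _⟩, wf_seqAll fun q hq => ?_⟩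
  obtain ⟨k, hk, rfl⟩ := List.mem_map.1 hq
  exact wf_loopWords one_pos (wf_loopWords (by omega) (wf_rowProg (by omega) fun _ _ =>
    wf_linkEntry (List.mem_range.1 hk)))

theorem eval_rowsProg {ρ : ℚ} {γ : ℕ} {env : ℕ → List Γ'} (h0 : env 0 = φ.suffixAt 0) :
    (rowsProg ρ γ).eval 1 env = (φ.demandRows ρ γ).flatMap (rowCode γ φ) := by
  rw [rowsProg, eval, eval, ThreeSAT.demandRows, List.flatMap_append, List.flatMap_append]
  congr 1
  · congr 1
    · rw [List.flatMap_map]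
      exact eval_loopCommodities one_pos h0 fun κ hκ env' W hW hl he =>
        eval_unitRow ((he 0 one_pos).trans h0) hW hl
    · rw [List.flatMap_map]
      exact eval_loopCommodities one_pos h0 fun κ hκ env' W hW hl he =>
        eval_unitRow ((he 0 one_pos).trans h0) hW hl
  · rw [eval_seqAll, List.flatMap_map, List.flatMap_assoc]
    refine List.flatMap_congr fun k hk => ?_
    rw [List.flatMap_assoc]
    refine eval_loopLeaves one_pos h0 fun env' W hW hl he => ?_
    rw [List.flatMap_map]
    have h0' := (he 0 one_pos).trans h0
    have lW := (mem_leaves.1 hW).1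
    refine eval_loopLeaves (by omega) h0' fun env'' W' hW' hl' he' => ?_
    exact eval_linkRow (List.mem_range.1 hk) ((he' 0 (by omega)).trans h0') hW
      (hl.congr fun i hi => he' i (by omega)) hW' hl'

/-- Print the instance of a formula. -/
def instanceProg (ρ : ℚ) (γ : ℕ) : PtrProg :=
  seqAll [powProg γ 1, emitAll [.bit true, .comma, .bra],
    loopWords γ 1 (seq (endsProg γ (1 + γ) 1 γ) (emitAll (encRat 1))),
    emitAll [.ket, .bra],
    loopCommodities γ 1 fun κ => endsProg γ (1 + γ) 1 κ,
    emitAll [.ket, .comma, .bra], rowsProg ρ γ, emitAll [.ket]]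

theorem wf_instanceProg (ρ : ℚ) (γ : ℕ) : (instanceProg ρ γ).WF 1 := by
  refine ⟨wf_powProg γ one_pos, wf_emitAll _ _, wf_loopWords one_pos
    ⟨wf_endsProg (by omega) le_rfl, wf_emitAll _ _⟩, wf_emitAll _ _,
    wf_loopCommodities one_pos fun κ hκ => wf_endsProg (by omega) (by omega), wf_emitAll _ _,
    wf_rowsProg ρ γ, wf_emitAll _ _, trivial⟩

theorem _root_.map_get_finRange {α : Type} (l : List α) : (List.finRange l.length).map l.get = l := by
  rw [← List.ofFn_eq_map, List.ofFn_get]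

theorem flatMap_finRange {α : Type} (l : List α) (f : α → List Γ') :
    ((List.finRange l.length).flatMap fun i => f (l.get i)) = l.flatMap f := by
  conv_rhs => rw [← map_get_finRange l, List.flatMap_map]

theorem eval_instanceProg {ρ : ℚ} (hρ : ρ < 1) {γ : ℕ} {env : ℕ → List Γ'}
    (h0 : env 0 = φ.suffixAt 0) :
    (instanceProg ρ γ).eval 1 env = (φ.toCongestion ρ hρ γ).encode := by
  have h1 : (loopWords γ 1 (seq (endsProg γ (1 + γ) 1 γ) (emitAll (encRat 1)))).eval 1 env
      = (List.finRange (φ.toCongestion ρ hρ γ).numE).flatMap (φ.toCongestion ρ hρ γ).encEdge := by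
    rw [eval_loopLeaves (out := fun W =>
      encUnary (vertexNum γ φ.width (wordSource φ.width W)) ++
        encUnary (vertexNum γ φ.width (wordTarget φ.width W)) ++ encRat 1) one_pos h0]
    · exact (flatMap_finRange _ _).symm
    · intro env' W hW hl he
      have := eval_endsProg (γ := γ) (n := 1 + γ) (by omega) ((he 0 one_pos).trans h0) hl
      rw [(mem_leaves.1 hW).1] at this
      rw [eval, this, eval_emitAll]
  have h2 : (loopCommodities γ 1 fun κ => endsProg γ (1 + γ) 1 κ).eval 1 env
      = (List.finRange (φ.toCongestion ρ hρ γ).numH).flatMap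
          (φ.toCongestion ρ hρ γ).encCommodity := by
    rw [eval_loopCommodities (out := fun c =>
      encUnary (vertexNum γ φ.width (wordSource φ.width (node γ c))) ++
        encUnary (vertexNum γ φ.width (wordTarget φ.width (node γ c)))) one_pos h0]
    · exact (flatMap_finRange _ _).symm
    · intro κ hκ env' W hW hl he
      have hc : (κ, W) ∈ commodityList γ φ.width :=
        mem_commodityList.2 ⟨hκ, mem_leaves.1 hW⟩
      have := eval_endsProg (γ := γ) (n := 1 + γ) (w := node γ (κ, W)) (by omega)
        ((he 0 one_pos).trans h0) (hl.drop _)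
      rwa [length_node hc] at this
  have h3 : (List.finRange (φ.toCongestion ρ hρ γ).poly.numRows).flatMap
      (φ.toCongestion ρ hρ γ).poly.encRow = (φ.demandRows ρ γ).flatMap (rowCode γ φ) := by
    rw [← flatMap_finRange (φ.demandRows ρ γ)]
    refine List.flatMap_congr fun i _ => ?_
    have e1 : encList encRat (List.ofFn ((φ.toCongestion ρ hρ γ).poly.A i))
        = encList (fun c => encRat (((φ.demandRows ρ γ).get i).1 c))
          (commodityList γ φ.width) := by
      have : List.ofFn ((φ.toCongestion ρ hρ γ).poly.A i)
          = (commodityList γ φ.width).map ((φ.demandRows ρ γ).get i).1 := by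
        conv_rhs => rw [← map_get_finRange (commodityList γ φ.width), List.map_map]
        rw [List.ofFn_eq_map]
        rfl
      rw [this, encList, encList, List.flatMap_map]
    have e2 : encList encRat (List.ofFn ((φ.toCongestion ρ hρ γ).poly.B i)) = [.bra, .ket] := rfl
    rw [PolyhedronData.encRow, e1, e2]
    rfl
  rw [CongestionInstance.encode, PolyhedronData.encode, instanceProg, eval_seqAll]
  simp only [List.flatMap_cons, List.flatMap_nil, eval_emitAll, h1, h2, eval_rowsProg h0,
    eval_powProg γ one_pos h0, encList, h3]
  -- The extra bit accounts for the summand `1` in the number of vertices.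
  have e1 : encUnary (φ.toCongestion ρ hρ γ).numV
      = List.replicate ((φ.width + 1) ^ γ) (.bit true) ++ [.bit true, .comma] := by
    change List.replicate ((φ.width + 1) ^ γ + 1) _ ++ _ = _
    rw [List.replicate_succ', List.append_assoc]
    rfl
  have e2 : encUnary (φ.toCongestion ρ hρ γ).poly.numAux = [.comma] := rfl
  rw [e1, e2]
  simp

end PtrProg

theorem ThreeSAT.polyTimeMap_toCongestion {ρ : ℚ} (hρ : ρ < 1) (γ : ℕ) :
    PolyTimeMap fun φ => φ.toCongestion ρ hρ γ :=
  PtrProg.polyTime (PtrProg.instanceProg ρ γ) (PtrProg.wf_instanceProg ρ γ) fun φ =>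
    PtrProg.eval_instanceProg hρ φ.encode_eq_suffixAt

/-! ### Sums over words -/

/-- The sum of a function over the words of length `r + w.length` that end in `w`. -/
def leafSum (M r : ℕ) (w : List ℕ) (f : List ℕ → ℝ) : ℝ := ((extensions M r w).map f).sum

theorem sum_map_range (n : ℕ) (f : ℕ → ℝ) :
    ((List.range n).map f).sum = ∑ i ∈ Finset.range n, f i := by
  induction n with
  | zero => simp
  | succ n ih => rw [List.range_succ, List.map_append, List.sum_append, ih,
      Finset.sum_range_succ]; simp

theorem leafSum_zero (M : ℕ) (w : List ℕ) (f : List ℕ → ℝ) : leafSum M 0 w f = f w := by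
  simp [leafSum, extensions]

theorem leafSum_succ (M r : ℕ) (w : List ℕ) (f : List ℕ → ℝ) :
    leafSum M (r + 1) w f = ∑ p ∈ Finset.range M, leafSum M r (p :: w) f := by
  rw [leafSum, extensions, List.map_flatMap, List.flatMap, List.sum_flatten, List.map_map,
    ← sum_map_range]
  rfl

theorem leafSum_congr {M r : ℕ} {w : List ℕ} {f g : List ℕ → ℝ}
    (h : ∀ W ∈ extensions M r w, f W = g W) : leafSum M r w f = leafSum M r w g := by
  rw [leafSum, leafSum, List.map_congr_left h]

theorem leafSum_le {M r : ℕ} {w : List ℕ} {f g : List ℕ → ℝ}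
    (h : ∀ W ∈ extensions M r w, f W ≤ g W) : leafSum M r w f ≤ leafSum M r w g :=
  List.sum_le_sum h

theorem leafSum_mul_left {M r : ℕ} {w : List ℕ} (a : ℝ) (f : List ℕ → ℝ) :
    leafSum M r w (fun W => a * f W) = a * leafSum M r w f :=
  List.sum_map_mul_left _ _ _

theorem leafSum_const {M r : ℕ} {w : List ℕ} (a : ℝ) :
    leafSum M r w (fun _ => a) = (M : ℝ) ^ r * a := by
  simp [leafSum, length_extensions]

theorem leafSum_nonneg {M r : ℕ} {w : List ℕ} {f : List ℕ → ℝ}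
    (h : ∀ W ∈ extensions M r w, 0 ≤ f W) : 0 ≤ leafSum M r w f := by
  have := leafSum_le (f := fun _ => 0) h
  rwa [leafSum_const, mul_zero] at this

theorem le_leafSum {M r : ℕ} {w W : List ℕ} {f : List ℕ → ℝ}
    (h : ∀ W ∈ extensions M r w, 0 ≤ f W) (hW : W ∈ extensions M r w) :
    f W ≤ leafSum M r w f := by
  refine List.single_le_sum ?_ _ (List.mem_map_of_mem hW)
  intro x hx
  obtain ⟨V, hV, rfl⟩ := List.mem_map.1 hx
  exact h V hV

theorem sum_get {α : Type} (l : List α) (f : α → ℝ) : ∑ i, f (l.get i) = (l.map f).sum := by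
  conv_rhs => rw [← map_get_finRange l, List.map_map, ← List.ofFn_eq_map, List.sum_ofFn]
  rfl

theorem sum_commodityList (γ M : ℕ) (f : ℕ × List ℕ → ℝ) : ((commodityList γ M).map f).sum
    = ∑ κ ∈ Finset.range (γ + 1), leafSum M γ [] fun W => f (κ, W) := by
  rw [commodityList, List.map_flatMap, List.flatMap, List.sum_flatten, List.map_map,
    ← sum_map_range]
  congr 1
  refine List.map_congr_left fun κ _ => ?_
  simp only [Function.comp_apply, List.map_map]
  rfl

/-- Going down from `w`, only the branch towards `w₀` contributes, and there is none unless `w₀`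
ends in `w`. -/
theorem leafSum_ite_drop {M r : ℕ} {w₀ : List ℕ} (hw₀ : IsWord M w₀) (g : List ℕ → ℝ) :
    ∀ (k : ℕ) (w : List ℕ), w₀.length = k + w.length →
      leafSum M (r + k) w (fun W => if W.drop r = w₀ then g W else 0)
        = if w₀.drop k = w then leafSum M r w₀ g else 0
  | 0, w, _ => by
    have e : leafSum M r w (fun W => if W.drop r = w₀ then g W else 0)
        = leafSum M r w (fun W => if w = w₀ then g W else 0) :=
      leafSum_congr fun W hW => by rw [drop_of_mem_extensions hW]
    rw [add_zero, e, List.drop_zero]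
    by_cases h : w = w₀
    · simp [h]
    · simp [h, Ne.symm h, leafSum_const]
  | k + 1, w, h => by
    rw [← add_assoc, leafSum_succ]
    have hk : k < w₀.length := by omega
    rw [Finset.sum_congr rfl fun p _ => leafSum_ite_drop hw₀ g k (p :: w) (by
      rw [h, List.length_cons]; omega)]
    rw [List.drop_eq_getElem_cons hk]
    simp only [List.cons.injEq]
    have hp : w₀[k] < M := hw₀ _ (List.getElem_mem hk)
    by_cases hd : w₀.drop (k + 1) = w
    · simp [hd, hp]
    · simp [hd]

theorem leafSum_drop (M r : ℕ) (g : List ℕ → ℝ) : ∀ (k : ℕ) (w : List ℕ),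
    leafSum M (r + k) w (fun W => g (W.drop r)) = (M : ℝ) ^ r * leafSum M k w g
  | 0, w => by
    rw [add_zero, leafSum_congr (g := fun _ => g w) fun W hW => by rw [drop_of_mem_extensions hW],
      leafSum_const, leafSum_zero]
  | k + 1, w => by
    rw [← add_assoc, leafSum_succ, leafSum_succ, Finset.mul_sum]
    exact Finset.sum_congr rfl fun p _ => leafSum_drop M r g k (p :: w)

theorem sum_range_three_mul (f : ℕ → ℝ) (m : ℕ) : ∑ p ∈ Finset.range (3 * m), f p
    = ∑ C ∈ Finset.range m, (f (3 * C) + f (3 * C + 1) + f (3 * C + 2)) := by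
  induction m with
  | zero => simp
  | succ m ih =>
    rw [Finset.sum_range_succ, ← ih, mul_add, mul_one, Finset.sum_range_succ,
      Finset.sum_range_succ, Finset.sum_range_succ]
    ring

/-! ### Flows -/

/-- `x` is a flow of intensity `a` from the source to the target of `w`, on the edges below `w`.
Conservation is tested against the functions on the vertices. -/
def IsWordFlow (M r : ℕ) (w : List ℕ) (a : ℝ) (x : List ℕ → ℝ) : Prop :=
  ∀ π : Option (List ℕ) → ℝ,
    leafSum M r w (fun W => x W * (π (wordSource M W) - π (wordTarget M W)))
      = a * (π (wordSource M w) - π (wordTarget M w))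

/-- The flow that is obtained by sending `a C w` along the `C`-th path of every word `w`; the
amount which enters `w` is `A w`. -/
noncomputable def pathFlow (a : ℕ → List ℕ → ℝ) (A : List ℕ → ℝ) : ℕ → List ℕ → ℝ
  | 0, _ => 1
  | r + 1, W => pathFlow a A r W *
      (a ((W.drop r).headD 0 / 3) (W.drop (r + 1)) / A (W.drop r))

/-- The target of each edge of a path is the source of the next one, so the differences of `π`
telescope along the three edges of the path of `C`. -/
theorem sum_ends {m : ℕ} (w : List ℕ) (π : Option (List ℕ) → ℝ) (f : ℕ → ℝ) :
    ∑ p ∈ Finset.range (3 * m), f (p / 3) *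
      (π (wordSource (3 * m) (p :: w)) - π (wordTarget (3 * m) (p :: w)))
      = (∑ C ∈ Finset.range m, f C) * (π (wordSource (3 * m) w) - π (wordTarget (3 * m) w)) := by
  rw [sum_range_three_mul, Finset.sum_mul]
  refine Finset.sum_congr rfl fun C hC => ?_
  rw [Finset.mem_range] at hC
  have e0 : 3 * C / 3 = C := by omega
  have e1 : (3 * C + 1) / 3 = C := by omega
  have e2 : (3 * C + 2) / 3 = C := by omega
  have m0 : 3 * C % 3 = 0 := by omega
  have m1 : (3 * C + 1) % 3 = 1 := by omega
  have m2 : (3 * C + 2) % 3 = 2 := by omega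
  have d1 : 3 * m - (3 * C + 1) + 1 = 3 * m - 3 * C := by omega
  have d2 : 3 * m - (3 * C + 2) + 1 = 3 * m - (3 * C + 1) := by omega
  simp only [wordSource, wordTarget, e0, e1, e2, m0, m1, m2, d1, d2, address, List.map_cons]
  norm_num
  ring

/-- Induction on the height: the flow of intensity `A (p :: w)` through a child is rescaled to the
amount `a (p / 3) w` prescribed for its path. Hypothesis `ha` makes the division harmless when `A (p
:: w) = 0`. -/
theorem isWordFlow_pathFlow {m γ : ℕ} {a : ℕ → List ℕ → ℝ} {A : List ℕ → ℝ}
    (hA : ∀ w, w.length = γ → A w = 1)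
    (hA' : ∀ w, w.length < γ → A w = ∑ C ∈ Finset.range m, a C w)
    (ha : ∀ p w, p < 3 * m → IsWord (3 * m) w → w.length < γ → A (p :: w) = 0 →
      a (p / 3) w = 0) :
    ∀ (r : ℕ) (w : List ℕ), IsWord (3 * m) w → r + w.length = γ →
      IsWordFlow (3 * m) r w (A w) (pathFlow a A r)
  | 0, w, _, hw, π => by
    rw [leafSum_zero, hA w (by omega), pathFlow]
  | r + 1, w, hM, hw, π => by
    rw [leafSum_succ, hA' w (by omega), ← sum_ends]
    refine Finset.sum_congr rfl fun p hp => ?_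
    rw [Finset.mem_range] at hp
    have ih := isWordFlow_pathFlow hA hA' ha r (p :: w) (isWord_cons.2 ⟨hp, hM⟩) (by
      rw [List.length_cons]; omega) π
    have e : leafSum (3 * m) r (p :: w) (fun W => pathFlow a A (r + 1) W *
        (π (wordSource (3 * m) W) - π (wordTarget (3 * m) W)))
        = leafSum (3 * m) r (p :: w) (fun W => a (p / 3) w / A (p :: w) * (pathFlow a A r W *
        (π (wordSource (3 * m) W) - π (wordTarget (3 * m) W)))) := by
      refine leafSum_congr fun W hW => ?_
      have h1 := drop_of_mem_extensions hW
      have h2 : W.drop (r + 1) = w := by rw [← List.tail_drop, h1, List.tail_cons]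
      rw [pathFlow, h1, h2, List.headD_cons]
      ring
    rw [e, leafSum_mul_left, ih, ← mul_assoc]
    congr 1
    rw [div_mul_cancel_of_imp (ha p w hp hM (by omega))]

theorem pathFlow_nonneg {m γ : ℕ} {a : ℕ → List ℕ → ℝ} {A : List ℕ → ℝ}
    (ha : ∀ p w, p < 3 * m → IsWord (3 * m) w → w.length < γ →
      0 ≤ a (p / 3) w ∧ 0 ≤ A (p :: w)) {W : List ℕ} (hW : IsWord (3 * m) W)
    (hl : W.length = γ) : ∀ r ≤ γ, 0 ≤ pathFlow a A r W
  | 0, _ => zero_le_one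
  | r + 1, hr => by
    have hd := List.drop_eq_getElem_cons (l := W) (i := r) (by omega)
    have := ha W[r] (W.drop (r + 1)) (hW _ (List.getElem_mem _)) (hW.drop _) (by
      rw [List.length_drop]; omega)
    rw [pathFlow]
    refine mul_nonneg (pathFlow_nonneg ha hW hl r (by omega)) ?_
    rw [hd, List.headD_cons]
    exact div_nonneg this.1 this.2

/-- Word flows are flows of the instance. -/
theorem ThreeSAT.isFlow_of_isWordFlow {ρ : ℚ} (hρ : ρ < 1) {γ : ℕ} {φ : ThreeSAT} {a : ℝ}
    {x : List ℕ → ℝ} (h : Fin (commodityList γ φ.width).length)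
    (hx : ∀ π : Option (List ℕ) → ℝ, leafSum φ.width γ [] (fun W => x W *
      (π (wordSource φ.width W) - π (wordTarget φ.width W)))
      = a * (π (wordSource φ.width (node γ ((commodityList γ φ.width).get h)))
        - π (wordTarget φ.width (node γ ((commodityList γ φ.width).get h))))) :
    (φ.toCongestion ρ hρ γ).IsFlow ((φ.toCongestion ρ hρ γ).source h)
      ((φ.toCongestion ρ hρ γ).sink h) a (fun e => x ((extensions φ.width γ []).get e)) := by
  intro v
  -- Testing against the indicator of a vertex gives conservation at this vertex.
  have key := hx fun u => if vertexNum γ φ.width u = v then 1 else 0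
  rw [leafSum, ← sum_get] at key
  have e1 : ∀ W : List ℕ, x W * ((if vertexNum γ φ.width (wordSource φ.width W) = v then 1 else 0)
      - (if vertexNum γ φ.width (wordTarget φ.width W) = v then 1 else 0))
      = (if vertexNum γ φ.width (wordSource φ.width W) = v then x W else 0)
      - (if vertexNum γ φ.width (wordTarget φ.width W) = v then x W else 0) := by
    intro W
    split_ifs <;> ring
  simp only [e1, Finset.sum_sub_distrib] at key
  have e2 (u w : Fin (φ.toCongestion ρ hρ γ).numV) : u = w ↔ (u : ℕ) = w := Fin.ext_iff
  simp only [e2]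
  refine Eq.trans key ?_
  have e3 (n : ℕ) : (n = (v : ℕ)) ↔ (v : ℕ) = n := eq_comm
  rw [mul_sub]
  simp only [mul_ite, mul_one, mul_zero, e3]
  rfl

/-! ### Fractional assignments -/

namespace ThreeSAT

/-- The assignment `τ` satisfies the `C`-th clause. -/
def SatAt (φ : ThreeSAT) (τ : ℕ → Bool) (C : ℕ) : Prop :=
  ∃ j : Fin 3, τ (φ.literal (3 * C + j)).1 = (φ.literal (3 * C + j)).2

open Classical in
theorem countP_sat (τ : ℕ → Bool) : ∀ l : List Clause,
    l.countP (fun C => decide (C.Sat τ)) = ∑ C ∈ Finset.range l.length,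
      if (∃ j : Fin 3, τ ((l.flatMap fun C => [C 0, C 1, C 2]).getD (3 * C + j) (0, true)).1
        = ((l.flatMap fun C => [C 0, C 1, C 2]).getD (3 * C + j) (0, true)).2) then 1 else 0
  | [] => by simp
  | c :: l => by
    rw [List.countP_cons, countP_sat τ l, List.length_cons, Finset.sum_range_succ']
    congr 1
    · refine Finset.sum_congr rfl fun C _ => ?_
      have (j : ℕ) : ((c :: l).flatMap fun C => [C 0, C 1, C 2]).getD (3 * (C + 1) + j) (0, true)
          = (l.flatMap fun C => [C 0, C 1, C 2]).getD (3 * C + j) (0, true) := by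
        rw [show 3 * (C + 1) + j = 3 * C + j + 1 + 1 + 1 by ring]
        simp [List.flatMap_cons]
      simp only [this]
    · have h (j : Fin 3) : ((c :: l).flatMap fun C => [C 0, C 1, C 2]).getD (3 * 0 + j) (0, true)
          = c j := by
        fin_cases j <;> simp [List.flatMap_cons]
      simp only [h, Clause.Sat]
      by_cases hc : ∃ j, τ (c j).1 = (c j).2 <;> simp [hc]

open Classical in
theorem numSat_eq (φ : ThreeSAT) (τ : ℕ → Bool) :
    φ.numSat τ = ∑ C ∈ Finset.range φ.numClauses, if φ.SatAt τ C then 1 else 0 := by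
  refine (countP_sat τ φ.clauses).trans (Finset.sum_congr rfl fun C _ => ?_)
  congr

theorem bddAbove_numSat (φ : ThreeSAT) : BddAbove (Set.range φ.numSat) := by
  refine ⟨φ.numClauses, ?_⟩
  rintro _ ⟨τ, rfl⟩
  exact List.countP_le_length

theorem numSat_le_maxSat (φ : ThreeSAT) (τ : ℕ → Bool) : φ.numSat τ ≤ φ.maxSat :=
  le_csSup φ.bddAbove_numSat ⟨τ, rfl⟩

theorem exists_satAt_of_val_eq_one (φ : ThreeSAT) (h : φ.val = 1) :
    ∃ τ, ∀ C < φ.numClauses, φ.SatAt τ C := by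
  classical
  obtain ⟨τ, hτ⟩ : φ.maxSat ∈ Set.range φ.numSat :=
    Nat.sSup_mem (Set.range_nonempty _) φ.bddAbove_numSat
  have hm : (φ.numClauses : ℚ) ≠ 0 := Nat.cast_ne_zero.2 φ.numClauses_pos.ne'
  rw [val, div_eq_one_iff_eq hm, Nat.cast_inj] at h
  refine ⟨τ, fun C hC => ?_⟩
  by_contra hn
  have h1 := φ.numSat_eq τ
  rw [hτ, h] at h1
  have h2 : ∑ C ∈ Finset.range φ.numClauses, (if φ.SatAt τ C then 1 else 0)
      < ∑ C ∈ Finset.range φ.numClauses, 1 :=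
    Finset.sum_lt_sum (fun i _ => by split_ifs <;> omega)
      ⟨C, Finset.mem_range.2 hC, by rw [if_neg hn]; exact one_pos⟩
  simp only [Finset.sum_const, Finset.card_range, smul_eq_mul, mul_one] at h2
  omega

theorem maxSat_le_of_val_lt {φ : ThreeSAT} {ρ : ℚ} (h : φ.val < ρ) :
    (φ.maxSat : ℝ) ≤ ρ * φ.numClauses := by
  have hm : (0 : ℚ) < φ.numClauses := Nat.cast_pos.2 φ.numClauses_pos
  rw [val, div_lt_iff₀ hm] at h
  exact_mod_cast h.le

theorem satAt_of_literal {φ : ThreeSAT} {τ : ℕ → Bool} {p : ℕ}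
    (h : τ (φ.literal p).1 = (φ.literal p).2) : φ.SatAt τ (p / 3) :=
  ⟨⟨p % 3, Nat.mod_lt _ (by norm_num)⟩, by
    have : 3 * (p / 3) + p % 3 = p := Nat.div_add_mod p 3
    simpa only [this] using h⟩

open MeasureTheory in
/-- Values of the literals that are at most the values in a fractional assignment are worth at
most as much as an assignment. -/
theorem sum_value_le (φ : ThreeSAT) {t : ℝ} (ht : 0 ≤ t) {l : ℕ → ℝ}
    (h0 : ∀ p < φ.width, 0 ≤ l p) (h1 : ∀ p < φ.width, l p ≤ t)
    (h2 : ∀ p < φ.width, ∀ q < φ.width, φ.Conflict p q → l p + l q ≤ t)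
    {s : ℕ → ℕ} (hs : ∀ C < φ.numClauses, s C < φ.width ∧ s C / 3 = C) :
    ∑ C ∈ Finset.range φ.numClauses, l (s C) ≤ φ.maxSat * t := by
  classical
  -- Threshold rounding: for `θ` in `[0, t)`, a variable is true when one of its positive
  -- occurrences has value above `θ`.
  let τ (θ : ℝ) (v : ℕ) : Bool := decide (∃ p < φ.width, φ.literal p = (v, true) ∧ θ < l p)
  -- A set of thresholds, of measure `l p`, that make the `p`-th literal true. Negative literals use
  -- the upper end of `[0, t)`: by `h2` their intervals avoid those of the opposite positive
  -- literals.
  let I (p : ℕ) : Set ℝ := if (φ.literal p).2 then Set.Ico 0 (l p) else Set.Ico (t - l p) t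
  have hI (p : ℕ) (hp : p < φ.width) (θ : ℝ) (hθ : θ ∈ I p) :
      τ θ (φ.literal p).1 = (φ.literal p).2 := by
    cases hs : (φ.literal p).2 with
    | true =>
      simp only [I, hs, if_true] at hθ
      exact decide_eq_true ⟨p, hp, by rw [← hs], hθ.2⟩
    | false =>
      simp only [I, hs, Bool.false_eq_true, if_false] at hθ
      refine decide_eq_false ?_
      rintro ⟨q, hq, e, hlt⟩
      have := h2 p hp q hq ⟨by rw [e], by rw [e, hs]; simp⟩
      linarith [hθ.1]
  have hIsub (p : ℕ) (hp : p < φ.width) : I p ⊆ Set.Ico 0 t := by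
    simp only [I]
    split
    · exact Set.Ico_subset_Ico_right (h1 p hp)
    · exact Set.Ico_subset_Ico_left (by linarith [h1 p hp])
  have hImeas (p : ℕ) : MeasurableSet (I p) := by
    simp only [I]
    split <;> exact measurableSet_Ico
  have hIvol (p : ℕ) (hp : p < φ.width) : volume.real (I p) = l p := by
    simp only [I]
    split
    · rw [Real.volume_real_Ico_of_le (h0 p hp), sub_zero]
    · rw [Real.volume_real_Ico_of_le (by linarith [h0 p hp])]
      ring
  have hIfin (p : ℕ) : volume (I p) ≠ ⊤ := by
    simp only [I]
    split <;> simp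
  have hint (p : ℕ) : Integrable ((I p).indicator fun _ => (1 : ℝ)) :=
    (integrable_indicator_iff (hImeas p)).2 (integrableOn_const (hIfin p))
  have hle (θ : ℝ) : ∑ C ∈ Finset.range φ.numClauses, (I (s C)).indicator (fun _ => (1 : ℝ)) θ
      ≤ (Set.Ico 0 t).indicator (fun _ => (φ.maxSat : ℝ)) θ := by
    by_cases hθ : θ ∈ Set.Ico 0 t
    · rw [Set.indicator_of_mem hθ]
      refine le_trans ?_ (Nat.cast_le.2 (φ.numSat_le_maxSat (τ θ)))
      rw [numSat_eq, Nat.cast_sum]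
      refine Finset.sum_le_sum fun C hC => ?_
      obtain ⟨hC1, hC2⟩ := hs C (Finset.mem_range.1 hC)
      by_cases hm : θ ∈ I (s C)
      · have := satAt_of_literal (hI (s C) hC1 θ hm)
        rw [hC2] at this
        simp [this, hm]
      · rw [Set.indicator_of_notMem hm]
        positivity
    · rw [Set.indicator_of_notMem hθ]
      refine (Finset.sum_eq_zero fun C hC => Set.indicator_of_notMem (fun hm => hθ ?_) _).le
      exact hIsub _ (hs C (Finset.mem_range.1 hC)).1 hm
  -- For every threshold the literals `s C` made true lie in distinct satisfied clauses, at most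
  -- `maxSat` in number; integrating over `[0, t)` gives the claim.
  have key := integral_mono (integrable_finsetSum _ fun C _ => hint (s C))
    ((integrable_indicator_iff measurableSet_Ico).2
      (integrableOn_const (by simp : volume (Set.Ico (0 : ℝ) t) ≠ ⊤))) hle
  rw [integral_finsetSum _ fun C _ => hint (s C), integral_indicator_const _ measurableSet_Ico,
    Real.volume_real_Ico_of_le ht, sub_zero, smul_eq_mul, mul_comm t] at key
  refine le_trans (le_of_eq ?_) key
  refine Finset.sum_congr rfl fun C hC => ?_
  rw [integral_indicator_const _ (hImeas _), hIvol _ (hs C (Finset.mem_range.1 hC)).1, smul_eq_mul,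
    mul_one]

/-- The largest value of a literal in the `C`-th clause. -/
noncomputable def clauseMax (l : ℕ → ℝ) (C : ℕ) : ℝ :=
  max (l (3 * C)) (max (l (3 * C + 1)) (l (3 * C + 2)))

theorem exists_clauseMax (l : ℕ → ℝ) (C : ℕ) : ∃ p, p / 3 = C ∧ clauseMax l C = l p := by
  rcases max_choice (l (3 * C)) (max (l (3 * C + 1)) (l (3 * C + 2))) with h | h
  · exact ⟨3 * C, by omega, h⟩
  · rcases max_choice (l (3 * C + 1)) (l (3 * C + 2)) with h' | h'
    · exact ⟨3 * C + 1, by omega, h.trans h'⟩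
    · exact ⟨3 * C + 2, by omega, h.trans h'⟩

theorem le_clauseMax (l : ℕ → ℝ) (p : ℕ) : l p ≤ clauseMax l (p / 3) := by
  obtain h | h | h : p = 3 * (p / 3) ∨ p = 3 * (p / 3) + 1 ∨ p = 3 * (p / 3) + 2 := by omega
  · exact (congrArg l h).le.trans (le_max_left _ _)
  · exact (congrArg l h).le.trans ((le_max_left _ _).trans (le_max_right _ _))
  · exact (congrArg l h).le.trans ((le_max_right _ _).trans (le_max_right _ _))

theorem sum_clauseMax_le (φ : ThreeSAT) {t : ℝ} (ht : 0 ≤ t) {l : ℕ → ℝ}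
    (h0 : ∀ p < φ.width, 0 ≤ l p) (h1 : ∀ p < φ.width, l p ≤ t)
    (h2 : ∀ p < φ.width, ∀ q < φ.width, φ.Conflict p q → l p + l q ≤ t) :
    ∑ C ∈ Finset.range φ.numClauses, clauseMax l C ≤ φ.maxSat * t := by
  choose s hs1 hs2 using exists_clauseMax l
  rw [Finset.sum_congr rfl fun C _ => hs2 C]
  refine φ.sum_value_le ht h0 h1 h2 fun C hC => ⟨?_, hs1 C⟩
  have := hs1 C
  rw [width]
  omega

end ThreeSAT

/-! ### Demands -/

theorem sum_get_ite {γ M : ℕ} (g : ℕ × List ℕ → ℝ) {c : ℕ × List ℕ}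
    (hc : c ∈ commodityList γ M) :
    ∑ h, (if (commodityList γ M).get h = c then g ((commodityList γ M).get h) else 0) = g c := by
  obtain ⟨i, rfl⟩ := List.get_of_mem hc
  rw [Fintype.sum_eq_single i fun j hj =>
    if_neg fun e => hj ((nodup_commodityList γ M).injective_get e), if_pos rfl]

namespace ThreeSAT

theorem not_clash_self (φ : ThreeSAT) (γ k : ℕ) (W : List ℕ) : ¬ φ.Clash γ k W W :=
  fun h => h.2.2 rfl

theorem sum_linkRow {ρ : ℚ} {γ : ℕ} {φ : ThreeSAT} (g : ℕ × List ℕ → ℝ) {k : ℕ} (hk : k < γ)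
    {W W' : List ℕ} (hW : W ∈ extensions φ.width γ []) (hW' : W' ∈ extensions φ.width γ []) :
    ∑ h, ((φ.linkRow ρ γ k W W').1 ((commodityList γ φ.width).get h) : ℝ)
        * g ((commodityList γ φ.width).get h)
      = g (k + 1, W) / share ρ γ (k + 1)
        + (if φ.Clash γ k W W' then g (k + 1, W') / share ρ γ (k + 1) else 0)
        - g (k, W) / share ρ γ k := by
  rw [mem_leaves] at hW hW'
  have m1 : (k + 1, W) ∈ commodityList γ φ.width := mem_commodityList.2 ⟨hk, hW⟩
  have m2 : (k + 1, W') ∈ commodityList γ φ.width := mem_commodityList.2 ⟨hk, hW'⟩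
  have m3 : (k, W) ∈ commodityList γ φ.width := mem_commodityList.2 ⟨hk.le, hW⟩
  rw [← sum_get_ite (fun x => if φ.Clash γ k W W' then g x / (share ρ γ (k + 1) : ℝ) else 0) m2,
    ← sum_get_ite (fun x => g x / (share ρ γ (k + 1) : ℝ)) m1,
    ← sum_get_ite (fun x => g x / (share ρ γ k : ℝ)) m3, ← Finset.sum_add_distrib,
    ← Finset.sum_sub_distrib]
  refine Finset.sum_congr rfl fun h _ => ?_
  obtain ⟨x1, x2⟩ := (commodityList γ φ.width).get h
  simp only [linkRow, Prod.mk.injEq]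
  by_cases h1 : x1 = k + 1
  · subst h1
    by_cases h2 : x2 = W
    · subst h2
      by_cases h3 : x2 = W'
      · subst h3
        simp [φ.not_clash_self, div_eq_mul_inv, mul_comm]
      · simp [h3, div_eq_mul_inv, mul_comm]
    · by_cases h3 : x2 = W'
      · subst h3
        by_cases h4 : φ.Clash γ k W x2 <;> simp [h2, h4, div_eq_mul_inv, mul_comm]
      · simp [h2, h3]
  · by_cases h2 : x1 = k ∧ x2 = W
    · simp [h2, div_eq_mul_inv, mul_comm]
    · rw [not_and] at h2
      by_cases h3 : x1 = k
      · simp [h3, h2 h3]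
      · simp [h1, h3]

theorem mem_demandPolytope_iff {ρ : ℚ} {γ : ℕ} {φ : ThreeSAT} {g : ℕ × List ℕ → ℝ} :
    (fun h => g ((commodityList γ φ.width).get h)) ∈ (demandPolytope ρ γ φ).toSet ↔
      (∀ c ∈ commodityList γ φ.width, 0 ≤ g c) ∧
      (∀ c ∈ commodityList γ φ.width, g c ≤ share ρ γ c.1) ∧
      ∀ k < γ, ∀ W ∈ extensions φ.width γ [], ∀ W' ∈ extensions φ.width γ [],
        g (k + 1, W) / share ρ γ (k + 1)
          + (if φ.Clash γ k W W' then g (k + 1, W') / share ρ γ (k + 1) else 0)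
          ≤ g (k, W) / share ρ γ k := by
  constructor
  · intro h
    refine ⟨fun c hc => ?_, fun c hc => ?_, fun k hk W hW W' hW' => ?_⟩
    · obtain ⟨i, rfl⟩ := List.get_of_mem hc
      exact nonneg_of_mem_demandPolytope h i
    · obtain ⟨i, rfl⟩ := List.get_of_mem hc
      exact le_share_of_mem_demandPolytope h i
    · have := mem_demandPolytope.1 h (φ.linkRow ρ γ k W W') (by
        simp only [demandRows, List.mem_append, List.mem_flatMap, List.mem_map, List.mem_range]
        exact Or.inr ⟨k, hk, W, hW, W', hW', rfl⟩)
      rw [sum_linkRow g hk hW hW'] at this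
      simp only [linkRow, Rat.cast_zero] at this
      linarith
  · rintro ⟨h1, h2, h3⟩
    rw [mem_demandPolytope]
    intro R hR
    simp only [demandRows, List.mem_append, List.mem_flatMap, List.mem_map, List.mem_range] at hR
    rcases hR with (⟨c, hc, rfl⟩ | ⟨c, hc, rfl⟩) | ⟨k, hk, W, hW, W', hW', rfl⟩
    · have := sum_get_ite (fun x => - g x) hc
      simp only [nonnegRow]
      refine le_trans (le_of_eq ?_) ((neg_nonpos.2 (h1 c hc)).trans_eq Rat.cast_zero.symm)
      rw [← this]
      exact Finset.sum_congr rfl fun h _ => by split_ifs <;> simp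
    · have := sum_get_ite g hc
      simp only [shareRow]
      refine le_trans (le_of_eq ?_) (h2 c hc)
      rw [← this]
      exact Finset.sum_congr rfl fun h _ => by split_ifs <;> simp
    · rw [sum_linkRow g hk hW hW']
      simp only [linkRow, Rat.cast_zero]
      linarith [h3 k hk W hW W' hW']

theorem exists_eq_get {γ : ℕ} {φ : ThreeSAT} (d : Fin (commodityList γ φ.width).length → ℝ) :
    ∃ g : ℕ × List ℕ → ℝ, d = fun h => g ((commodityList γ φ.width).get h) :=
  ⟨Function.extend (commodityList γ φ.width).get d 0, funext fun h =>
    ((nodup_commodityList γ φ.width).injective_get.extend_apply d 0 h).symm⟩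

end ThreeSAT

/-! ### The weights of the words under a demand vector. -/

/-- The maximum of `0` and of the values of a function on a list. -/
noncomputable def listMax {α : Type} (l : List α) (f : α → ℝ) : ℝ :=
  l.foldr (fun a x => max (f a) x) 0

theorem listMax_nonneg {α : Type} (l : List α) (f : α → ℝ) : 0 ≤ listMax l f := by
  induction l with
  | nil => exact le_rfl
  | cons a l ih => exact le_max_of_le_right ih

theorem le_listMax {α : Type} {l : List α} (f : α → ℝ) {a : α} (h : a ∈ l) :
    f a ≤ listMax l f := by
  induction l with
  | nil => simp at h
  | cons b l ih =>
    rcases List.mem_cons.1 h with rfl | h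
    · exact le_max_left _ _
    · exact le_max_of_le_right (ih h)

theorem listMax_eq {α : Type} (l : List α) (f : α → ℝ) :
    listMax l f = 0 ∨ ∃ a ∈ l, listMax l f = f a := by
  induction l with
  | nil => exact Or.inl rfl
  | cons b l ih =>
    rcases max_choice (f b) (listMax l f) with h | h
    · exact Or.inr ⟨b, List.mem_cons_self, h⟩
    · rcases ih with h' | ⟨a, ha, h'⟩
      · exact Or.inl (h.trans h')
      · exact Or.inr ⟨a, List.mem_cons_of_mem _ ha, h.trans h'⟩

theorem extensions_cons_subset {M r p : ℕ} {w W : List ℕ} (hp : p < M)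
    (h : W ∈ extensions M r (p :: w)) : W ∈ extensions M (r + 1) w := by
  rw [extensions, List.mem_flatMap]
  exact ⟨p, List.mem_range.2 hp, h⟩

theorem mem_leaves_of_mem_extensions {M γ r : ℕ} {w W : List ℕ} (hw : IsWord M w)
    (hr : r + w.length = γ) (h : W ∈ extensions M r w) : W ∈ extensions M γ [] := by
  rw [mem_leaves, length_of_mem_extensions h]
  obtain ⟨v, -, hv, rfl⟩ := mem_extensions.1 h
  refine ⟨hr, fun p hp => ?_⟩
  rcases List.mem_append.1 hp with hp | hp
  · exact hv p hp
  · exact hw p hp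

namespace ThreeSAT

/-- Each demand vector comes with a fractional assignment on every level. -/
theorem exists_weights {ρ : ℚ} (hρ : ρ < 1) {γ : ℕ} {φ : ThreeSAT} {g : ℕ × List ℕ → ℝ}
    (hg : (fun h => g ((commodityList γ φ.width).get h)) ∈ (demandPolytope ρ γ φ).toSet) :
    ∃ l : List ℕ → ℝ, (∀ w, 0 ≤ l w) ∧
      (∀ w, IsWord φ.width w → w.length ≤ γ → l w ≤ 1) ∧
      (∀ r w, IsWord φ.width w → r + w.length = γ → ∀ W ∈ extensions φ.width r w,
        g (w.length, W) ≤ share ρ γ w.length * l w) ∧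
      (∀ p w, p < φ.width → IsWord φ.width w → w.length < γ → l (p :: w) ≤ l w) ∧
      ∀ p q w, p < φ.width → q < φ.width → IsWord φ.width w → w.length < γ → φ.Conflict p q →
        l (p :: w) + l (q :: w) ≤ l w := by
  obtain ⟨h0, h1, h2⟩ := mem_demandPolytope_iff.1 hg
  have hs (κ : ℕ) : (0 : ℝ) < share ρ γ κ := Rat.cast_pos.2 (share_pos hρ γ κ)
  let n (w W : List ℕ) : ℝ := g (w.length, W) / share ρ γ w.length
  -- All commodities of the node `w` count, one for each leaf word below `w`; the weight is the
  -- largest of their normalized demands.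
  let l (w : List ℕ) : ℝ := listMax (extensions φ.width (γ - w.length) w) (n w)
  have hle (w W) (hW : W ∈ extensions φ.width (γ - w.length) w) : n w W ≤ l w := le_listMax _ hW
  have hleaf {w W} (hw : IsWord φ.width w) (hl : w.length ≤ γ)
      (hW : W ∈ extensions φ.width (γ - w.length) w) : W ∈ extensions φ.width γ [] :=
    mem_leaves_of_mem_extensions hw (Nat.sub_add_cancel hl) hW
  have hc {w W} (hw : IsWord φ.width w) (hl : w.length ≤ γ)
      (hW : W ∈ extensions φ.width (γ - w.length) w) :
      (w.length, W) ∈ commodityList γ φ.width :=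
    mem_commodityList.2 ⟨hl, mem_leaves.1 (hleaf hw hl hW)⟩
  have hn0 {w W} (hw : IsWord φ.width w) (hl : w.length ≤ γ)
      (hW : W ∈ extensions φ.width (γ - w.length) w) : 0 ≤ n w W :=
    div_nonneg (h0 _ (hc hw hl hW)) (hs _).le
  have hcons {p w W} (hp : p < φ.width) (hl : w.length < γ)
      (hW : W ∈ extensions φ.width (γ - (p :: w).length) (p :: w)) :
      W ∈ extensions φ.width (γ - w.length) w := by
    have := extensions_cons_subset hp hW
    rwa [show γ - (p :: w).length + 1 = γ - w.length by rw [List.length_cons]; omega] at this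
  have hstep {p w W} (hp : p < φ.width) (hw : IsWord φ.width w) (hl : w.length < γ)
      (hW : W ∈ extensions φ.width (γ - (p :: w).length) (p :: w)) : n (p :: w) W ≤ n w W := by
    have hWl := hleaf hw hl.le (hcons hp hl hW)
    have := h2 w.length hl W hWl W hWl
    rwa [if_neg (φ.not_clash_self _ _ _), add_zero] at this
  have mono {p w} (hp : p < φ.width) (hw : IsWord φ.width w) (hl : w.length < γ) :
      l (p :: w) ≤ l w := by
    rcases listMax_eq (extensions φ.width (γ - (p :: w).length) (p :: w)) (n (p :: w)) with
      h | ⟨W, hW, h⟩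
    · exact h.trans_le (listMax_nonneg _ _)
    · exact h.trans_le ((hstep hp hw hl hW).trans (hle w W (hcons hp hl hW)))
  refine ⟨l, fun w => listMax_nonneg _ _, fun w hw hl => ?_, fun r w hw hr W hW => ?_,
    fun p w hp hw hl => mono hp hw hl, fun p q w hp hq hw hl hpq => ?_⟩
  · rcases listMax_eq (extensions φ.width (γ - w.length) w) (n w) with h | ⟨W, hW, h⟩
    · exact h.trans_le zero_le_one
    · exact h.trans_le (div_le_one_of_le₀ (h1 _ (hc hw hl hW)) (hs _).le)
  · obtain rfl : r = γ - w.length := by omega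
    exact (div_le_iff₀' (hs _)).1 (hle w W hW)
  · rcases listMax_eq (extensions φ.width (γ - (p :: w).length) (p :: w)) (n (p :: w)) with
      h | ⟨W, hW, h⟩
    · have : l (p :: w) = 0 := h
      rw [this, zero_add]
      exact mono hq hw hl
    · rcases listMax_eq (extensions φ.width (γ - (q :: w).length) (q :: w)) (n (q :: w)) with
        h' | ⟨W', hW', h'⟩
      · have : l (q :: w) = 0 := h'
        rw [this, add_zero]
        exact mono hp hw hl
      · have e : l (p :: w) = n (p :: w) W := h
        have e' : l (q :: w) = n (q :: w) W' := h'
        rw [e, e']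
        -- The leaf words `W` and `W'` that attain the two maxima agree up to `w` and go on with `p`
        -- and `q`: they clash, and their link inequality is the claim. Conflicts are imposed on all
        -- pairs of leaf words for this purpose.
        refine le_trans ?_ (hle w W (hcons hp hl hW))
        have := h2 w.length hl W (hleaf hw hl.le (hcons hp hl hW)) W'
          (hleaf hw hl.le (hcons hq hl hW'))
        rwa [if_pos] at this
        have d := drop_of_mem_extensions hW
        have d' := drop_of_mem_extensions hW'
        rw [List.length_cons] at d d'
        refine ⟨?_, ?_⟩
        · rw [drop_of_mem_extensions (hcons hp hl hW), drop_of_mem_extensions (hcons hq hl hW')]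
        · rw [d, d']
          exact hpq

end ThreeSAT

/-! ### Routings -/

/-- The flow of intensity `b` for the commodity `c` along the paths given by `a`. -/
noncomputable def treeFlow (a : ℕ → List ℕ → ℝ) (A : List ℕ → ℝ) (γ : ℕ) (c : ℕ × List ℕ) (b : ℝ)
    (W : List ℕ) : ℝ :=
  if W.drop (γ - c.1) = node γ c then b / A (node γ c) * pathFlow a A (γ - c.1) W else 0

theorem treeFlow_eq_mul (a : ℕ → List ℕ → ℝ) (A : List ℕ → ℝ) (γ : ℕ) (c : ℕ × List ℕ) (b : ℝ)
    (W : List ℕ) : treeFlow a A γ c b W = b * treeFlow a A γ c 1 W := by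
  simp only [treeFlow]
  split_ifs <;> ring

namespace ThreeSAT

theorem isFlow_treeFlow {ρ : ℚ} (hρ : ρ < 1) {γ : ℕ} {φ : ThreeSAT} {a : ℕ → List ℕ → ℝ}
    {A : List ℕ → ℝ} (hA : ∀ w, w.length = γ → A w = 1)
    (hA' : ∀ w, w.length < γ → A w = ∑ C ∈ Finset.range φ.numClauses, a C w)
    (ha : ∀ p w, p < φ.width → IsWord φ.width w → w.length < γ → A (p :: w) = 0 →
      a (p / 3) w = 0) {b : ℝ} (h : Fin (commodityList γ φ.width).length)
    (hb : A (node γ ((commodityList γ φ.width).get h)) = 0 → b = 0) :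
    (φ.toCongestion ρ hρ γ).IsFlow ((φ.toCongestion ρ hρ γ).source h)
      ((φ.toCongestion ρ hρ γ).sink h) b
      (fun e => treeFlow a A γ ((commodityList γ φ.width).get h) b
        ((extensions φ.width γ []).get e)) := by
  refine isFlow_of_isWordFlow hρ h fun π => ?_
  have hc : (commodityList γ φ.width).get h ∈ commodityList γ φ.width := List.get_mem _ _
  obtain ⟨c, hce⟩ : ∃ c, (commodityList γ φ.width).get h = c := ⟨_, rfl⟩
  rw [hce] at hc hb ⊢
  have hw := isWord_node hc
  have hl := length_node hc
  have hκ := (mem_commodityList.1 hc).1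
  have hr : γ - c.1 + c.1 = γ := by omega
  have flow : IsWordFlow φ.width (γ - c.1) (node γ c) (A (node γ c)) (pathFlow a A (γ - c.1)) :=
    isWordFlow_pathFlow hA hA' ha _ _ hw (by omega)
  have e := leafSum_ite_drop (r := γ - c.1) hw (fun W => b / A (node γ c) *
    (pathFlow a A (γ - c.1) W * (π (wordSource φ.width W) - π (wordTarget φ.width W)))) c.1 []
    (by rw [hl, List.length_nil, add_zero])
  rw [hr, if_pos (by rw [← hl, List.drop_length]), leafSum_mul_left] at e
  rw [flow π, ← mul_assoc, div_mul_cancel_of_imp hb] at e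
  rw [← e]
  refine leafSum_congr fun W _ => ?_
  simp only [treeFlow]
  split_ifs <;> ring

theorem treeFlow_nonneg {γ : ℕ} {φ : ThreeSAT} {a : ℕ → List ℕ → ℝ} {A : List ℕ → ℝ}
    (ha : ∀ p w, p < φ.width → IsWord φ.width w → w.length < γ →
      0 ≤ a (p / 3) w ∧ 0 ≤ A (p :: w))
    (hA : ∀ w, IsWord φ.width w → w.length ≤ γ → 0 ≤ A w) {c : ℕ × List ℕ}
    (hc : c ∈ commodityList γ φ.width) {b : ℝ} (hb : 0 ≤ b) {W : List ℕ}
    (hW : W ∈ extensions φ.width γ []) : 0 ≤ treeFlow a A γ c b W := by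
  rw [mem_leaves] at hW
  rw [treeFlow]
  split_ifs
  · exact mul_nonneg (div_nonneg hb (hA _ (isWord_node hc) (length_node_le hc)))
      (pathFlow_nonneg (m := φ.numClauses) ha hW.2 hW.1 _ (Nat.sub_le _ _))
  · exact le_rfl

/-- Only commodities whose node is an ancestor `e.drop r` of the edge `e` use `e`; they are grouped
by ancestor. -/
theorem sum_treeFlow {γ : ℕ} {φ : ThreeSAT} (a : ℕ → List ℕ → ℝ) (A : List ℕ → ℝ)
    (g : ℕ × List ℕ → ℝ) {e : List ℕ} (he : e ∈ extensions φ.width γ []) :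
    ∑ h, treeFlow a A γ ((commodityList γ φ.width).get h) (g ((commodityList γ φ.width).get h)) e
      = ∑ r ∈ Finset.range (γ + 1),
        leafSum φ.width r (e.drop r) (fun W => g (γ - r, W)) / A (e.drop r) * pathFlow a A r e := by
  rw [mem_leaves] at he
  rw [sum_get _ fun c => treeFlow a A γ c (g c) e, sum_commodityList,
    ← Finset.sum_range_reflect]
  refine Finset.sum_congr rfl fun r hr => ?_
  have hr : r ≤ γ := Nat.lt_succ_iff.1 (Finset.mem_range.1 hr)
  have e1 : γ + 1 - 1 - r = γ - r := by omega
  have e2 : γ - (γ - r) = r := by omega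
  have key := leafSum_ite_drop (r := r) (he.2.drop r) (fun W => g (γ - r, W) / A (e.drop r)
    * pathFlow a A r e) (γ - r) [] (by simp [he.1])
  rw [if_pos (List.drop_eq_nil_of_le (by rw [List.length_drop, he.1])), show r + (γ - r) = γ by omega] at key
  rw [e1]
  refine Eq.trans (leafSum_congr fun W _ => ?_) (key.trans ?_)
  · simp only [treeFlow, node, e2, @eq_comm _ (e.drop r)]
    split_ifs with h
    · rw [h]
    · rfl
  · rw [div_mul_eq_mul_div, mul_comm (leafSum _ _ _ _), ← div_mul_eq_mul_div,
      ← leafSum_mul_left]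
    exact leafSum_congr fun W _ => by ring

/-- A routing which uses no edge more than once. -/
theorem routable_one {ρ : ℚ} (hρ : ρ < 1) {γ : ℕ} {φ : ThreeSAT} {a : ℕ → List ℕ → ℝ}
    {A R : List ℕ → ℝ} (hA : ∀ w, w.length = γ → A w = 1)
    (hA' : ∀ w, w.length < γ → A w = ∑ C ∈ Finset.range φ.numClauses, a C w)
    (ha : ∀ p w, p < φ.width → IsWord φ.width w → w.length < γ →
      0 ≤ a (p / 3) w ∧ a (p / 3) w ≤ R (p :: w))
    (hR : ∀ w, IsWord φ.width w → w.length ≤ γ → 0 ≤ R w) {g : ℕ × List ℕ → ℝ}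
    (hg : ∀ c ∈ commodityList γ φ.width, 0 ≤ g c)
    (hD : ∀ r w, IsWord φ.width w → r + w.length = γ →
      leafSum φ.width r w (fun W => g (w.length, W)) ≤ A w - R w) :
    (φ.toCongestion ρ hρ γ).Routable 1 fun h => g ((commodityList γ φ.width).get h) := by
  -- `A w` is the intensity carried by `w`, and `R w` the part of it kept for the commodities of the
  -- ancestors. The rest serves the demands of `w` itself.
  have hD0 {r w} (hw : IsWord φ.width w) (hl : r + w.length = γ) {W}
      (hW : W ∈ extensions φ.width r w) : 0 ≤ g (w.length, W) :=
    hg _ (mem_commodityList.2 ⟨by omega, mem_leaves.1 (mem_leaves_of_mem_extensions hw hl hW)⟩)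
  have hRA (w) (hw : IsWord φ.width w) (hl : w.length ≤ γ) : R w ≤ A w := by
    have := hD (γ - w.length) w hw (by omega)
    have h0 := leafSum_nonneg fun W hW => hD0 hw (by omega : γ - w.length + w.length = γ) hW
    linarith
  have hA0 (w) (hw : IsWord φ.width w) (hl : w.length ≤ γ) : 0 ≤ A w :=
    (hR w hw hl).trans (hRA w hw hl)
  have hcons {p w} (hp : p < φ.width) (hw : IsWord φ.width w) (hl : w.length < γ) :
      IsWord φ.width (p :: w) ∧ (p :: w).length ≤ γ :=
    ⟨isWord_cons.2 ⟨hp, hw⟩, hl⟩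
  have haA (p w) (hp : p < φ.width) (hw : IsWord φ.width w) (hl : w.length < γ) :
      0 ≤ a (p / 3) w ∧ 0 ≤ A (p :: w) :=
    ⟨(ha p w hp hw hl).1, hA0 _ (hcons hp hw hl).1 (hcons hp hw hl).2⟩
  refine ⟨fun h e => treeFlow a A γ ((commodityList γ φ.width).get h)
    (g ((commodityList γ φ.width).get h)) ((extensions φ.width γ []).get e), fun h => ?_,
    fun e => ?_⟩
  · refine isFlow_treeFlow hρ hA hA' (fun p w hp hw hl h0 => ?_) h fun h0 => ?_
    · have h1 := ha p w hp hw hl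
      have h2 := hRA _ (hcons hp hw hl).1 (hcons hp hw hl).2
      linarith
    · have hc : (commodityList γ φ.width).get h ∈ commodityList γ φ.width := List.get_mem _ _
      obtain ⟨c, hce⟩ : ∃ c, (commodityList γ φ.width).get h = c := ⟨_, rfl⟩
      change g ((commodityList γ φ.width).get h) = 0
      rw [hce] at hc h0 ⊢
      have hw := isWord_node hc
      have hl := length_node hc
      have hm := mem_commodityList.1 hc
      have hr : γ - c.1 + (node γ c).length = γ := by omega
      have hW : c.2 ∈ extensions φ.width (γ - c.1) (node γ c) :=
        mem_extensions.2 ⟨c.2.take (γ - c.1), by rw [List.length_take]; omega,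
          fun p hp => hm.2.2 p (List.mem_of_mem_take hp), (List.take_append_drop _ _).symm⟩
      have h1 := le_leafSum (f := fun W => g ((node γ c).length, W)) (fun W hW => hD0 hw hr hW) hW
      have h2 := hD _ _ hw hr
      have h3 := hR _ hw (length_node_le hc)
      rw [hl] at h1 h2
      have h4 := hg c hc
      have h5 : g (c.1, c.2) = g c := rfl
      linarith
  · have hm : (extensions φ.width γ []).get e ∈ extensions φ.width γ [] := List.get_mem _ _
    obtain ⟨W, hWe⟩ : ∃ W, (extensions φ.width γ []).get e = W := ⟨_, rfl⟩
    rw [hWe] at hm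
    have habs (h : Fin (commodityList γ φ.width).length) :
        |treeFlow a A γ ((commodityList γ φ.width).get h) (g ((commodityList γ φ.width).get h)) W|
        = treeFlow a A γ ((commodityList γ φ.width).get h) (g ((commodityList γ φ.width).get h)) W :=
      abs_of_nonneg (treeFlow_nonneg haA hA0 (List.get_mem _ _) (hg _ (List.get_mem _ _)) hm)
    simp only [hWe]
    refine (Finset.sum_congr rfl fun h _ => habs h).trans_le ?_
    refine (sum_treeFlow a A g hm).trans_le ?_
    rw [Finset.sum_range_succ]
    rw [mem_leaves] at hm
    have hZ : ∀ r ≤ γ, 0 ≤ pathFlow a A r W :=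
      pathFlow_nonneg (m := φ.numClauses) haA hm.2 hm.1
    have hlen {r} (hr : r ≤ γ) : (W.drop r).length = γ - r := by rw [List.length_drop, hm.1]
    have hDr {r} (hr : r ≤ γ) : leafSum φ.width r (W.drop r) (fun V => g (γ - r, V))
        ≤ A (W.drop r) - R (W.drop r) := by
      have := hD r (W.drop r) (hm.2.drop r) (by rw [hlen hr]; omega)
      rwa [hlen hr] at this
    -- At the ancestor `W.drop r`, the own demand and the amount sent through it from its parent sum
    -- to at most `(A - R) + R = A`. Dividing by `A` bounds the load of this level by a difference
    -- of consecutive values of `pathFlow`.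
    have step (r) (hr : r < γ) : leafSum φ.width r (W.drop r) (fun V => g (γ - r, V))
        / A (W.drop r) * pathFlow a A r W ≤ pathFlow a A r W - pathFlow a A (r + 1) W := by
      have hd := List.drop_eq_getElem_cons (l := W) (i := r) (by omega)
      have h1 := ha W[r] (W.drop (r + 1)) (hm.2 _ (List.getElem_mem _)) (hm.2.drop _) (by
        rw [hlen hr]; omega)
      rw [← hd] at h1
      have h2 : (W.drop r).headD 0 = W[r] := by rw [hd, List.headD_cons]
      rw [pathFlow, h2, mul_comm, ← mul_one_sub]
      refine mul_le_mul_of_nonneg_left ?_ (hZ r hr.le)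
      have h3 := hDr hr.le
      rcases (hA0 (W.drop r) (hm.2.drop r) (by rw [hlen hr.le]; omega)).eq_or_lt with h0 | h0
      · rw [← h0, div_zero, div_zero, sub_zero]
        exact zero_le_one
      · rw [le_sub_iff_add_le, ← add_div]
        exact div_le_one_of_le₀ (by linarith) h0.le
    have last : leafSum φ.width γ (W.drop γ) (fun V => g (γ - γ, V)) / A (W.drop γ)
        * pathFlow a A γ W ≤ pathFlow a A γ W := by
      refine mul_le_of_le_one_left (hZ γ le_rfl) (div_le_one_of_le₀ ?_ ?_)
      · have := hR (W.drop γ) (hm.2.drop γ) (by rw [hlen le_rfl]; omega)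
        linarith [hDr (le_refl γ)]
      · exact hA0 _ (hm.2.drop γ) (by rw [hlen le_rfl]; omega)
    refine (add_le_add (Finset.sum_le_sum fun r hr => step r (Finset.mem_range.1 hr)) last).trans ?_
    -- The loads telescope to `pathFlow a A 0 W = 1`.
    rw [Finset.sum_range_sub']
    simp [pathFlow]

end ThreeSAT

/-! ### Existence of reservations, and the upper bound on the congestion. -/

namespace ThreeSAT

/-- Any fixed unit flows, scaled by the demands, form a routing, and the demands are bounded by the
shares. Here the flow is split equally among the paths of every gadget. -/
theorem reservations_nonempty {ρ : ℚ} (hρ : ρ < 1) (γ : ℕ) (φ : ThreeSAT) :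
    (φ.toCongestion ρ hρ γ).reservations.Nonempty := by
  have hN : (0 : ℝ) < φ.numClauses := Nat.cast_pos.2 φ.numClauses_pos
  let a (_ : ℕ) (w : List ℕ) : ℝ := (φ.numClauses : ℝ) ^ (γ - w.length - 1)
  let A (w : List ℕ) : ℝ := (φ.numClauses : ℝ) ^ (γ - w.length)
  have hA0 (w) : 0 < A w := pow_pos hN _
  let x (h : Fin (commodityList γ φ.width).length) (b : ℝ)
    (e : Fin (extensions φ.width γ []).length) : ℝ :=
    treeFlow a A γ ((commodityList γ φ.width).get h) b ((extensions φ.width γ []).get e)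
  refine ⟨fun e => ∑ h, (share ρ γ ((commodityList γ φ.width).get h).1 : ℝ) * |x h 1 e|,
    fun d hd => ⟨fun h => x h (d h), fun h => ?_, fun e => Finset.sum_le_sum fun h _ => ?_⟩⟩
  · refine isFlow_treeFlow hρ (fun w hw => ?_) (fun w hw => ?_)
      (fun p w _ _ _ h0 => absurd h0 (hA0 _).ne') h fun h0 => absurd h0 (hA0 _).ne'
    · simp only [A, hw, Nat.sub_self, pow_zero]
    · obtain ⟨k, hk⟩ : ∃ k, γ - w.length = k + 1 := ⟨γ - w.length - 1, by omega⟩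
      simp only [A, a, hk, Finset.sum_const, Finset.card_range, nsmul_eq_mul, pow_succ',
        Nat.add_sub_cancel]
  · have e1 : x h (d h) e = d h * x h 1 e := treeFlow_eq_mul _ _ _ _ _ _
    change |x h (d h) e| ≤ _
    rw [e1, abs_mul, abs_of_nonneg (nonneg_of_mem_demandPolytope hd h)]
    exact mul_le_mul_of_nonneg_right (le_share_of_mem_demandPolytope hd h) (abs_nonneg _)

theorem one_mem_reservations {ρ : ℚ} (hρ : ρ < 1) (γ : ℕ) {φ : ThreeSAT} (hφ : φ.val < ρ) :
    1 ∈ (φ.toCongestion ρ hρ γ).reservations := by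
  intro d hd
  obtain ⟨g, rfl⟩ := exists_eq_get d
  obtain ⟨l, l0, l1, lg, lm, lc⟩ := exists_weights hρ hd
  have h0 := (mem_demandPolytope_iff.1 hd).1
  have hN : (0 : ℝ) < φ.numClauses := Nat.cast_pos.2 φ.numClauses_pos
  -- The path of `C` is limited by its busiest child: `p :: w` keeps only the fraction `1 - l (p ::
  -- w)` of its capacity for flows from above.
  let a (C : ℕ) (w : List ℕ) : ℝ :=
    (φ.numClauses : ℝ) ^ (γ - w.length - 1) * (1 - clauseMax (fun p => l (p :: w)) C)
  let A (w : List ℕ) : ℝ :=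
    if w.length = γ then 1 else ∑ C ∈ Finset.range φ.numClauses, a C w
  let R (w : List ℕ) : ℝ := (1 - l w) * (φ.numClauses : ℝ) ^ (γ - w.length)
  have hcast : ((1 : ℚ) : ℝ) = 1 := Rat.cast_one
  refine routable_one (a := a) (A := A) (R := R) hρ (fun w hw => if_pos hw)
    (fun w hw => if_neg hw.ne) (fun p w hp hw hl => ⟨?_, ?_⟩) (fun w hw hl => ?_) h0
    fun r w hw hr => ?_
  · refine mul_nonneg (pow_nonneg hN.le _) (sub_nonneg.2 ?_)
    obtain ⟨q, hq, e⟩ := exists_clauseMax (fun p => l (p :: w)) (p / 3)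
    rw [e]
    refine (lm q w ?_ hw hl).trans (l1 w hw hl.le)
    rw [width] at hp ⊢
    omega
  · have := le_clauseMax (fun p => l (p :: w)) p
    simp only [a, R, List.length_cons, Nat.sub_add_eq]
    rw [mul_comm]
    exact mul_le_mul_of_nonneg_right (by linarith) (pow_nonneg hN.le _)
  · exact mul_nonneg (sub_nonneg.2 (l1 w hw hl)) (pow_nonneg hN.le _)
  · have bound : leafSum φ.width r w (fun W => g (w.length, W))
        ≤ (φ.width : ℝ) ^ r * (share ρ γ w.length * l w) := by
      rw [← leafSum_const]
      exact leafSum_le fun W hW => lg r w hw hr W hW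
    refine bound.trans ?_
    rcases Nat.eq_zero_or_pos r with rfl | hr0
    · have hl : w.length = γ := by omega
      simp only [A, R, if_pos hl, hl, share, lt_self_iff_false, if_false, Nat.sub_self, pow_zero,
        hcast]
      linarith
    · have hl : w.length < γ := by omega
      obtain ⟨k, rfl⟩ : ∃ k, r = k + 1 := ⟨r - 1, by omega⟩
      have hk : γ - w.length = k + 1 := by omega
      have h3 := φ.sum_clauseMax_le (l0 w) (l := fun p => l (p :: w)) (fun p _ => l0 _)
        (fun p hp => lm p w hp hw hl) (fun p hp q hq => lc p q w hp hq hw hl)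
      have h4 := mul_le_mul_of_nonneg_right (maxSat_le_of_val_lt hφ) (l0 w)
      have hs : ∑ C ∈ Finset.range φ.numClauses, a C w = (φ.numClauses : ℝ) ^ k *
          (φ.numClauses - ∑ C ∈ Finset.range φ.numClauses, clauseMax (fun p => l (p :: w)) C) := by
        simp only [a, hk, Nat.add_sub_cancel]
        rw [← Finset.mul_sum, Finset.sum_sub_distrib]
        simp
      have h5 : (φ.numClauses : ℝ) ^ k * (φ.numClauses - ρ * φ.numClauses * l w)
          ≤ ∑ C ∈ Finset.range φ.numClauses, a C w := by
        rw [hs]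
        exact mul_le_mul_of_nonneg_left (by linarith) (pow_nonneg hN.le _)
      simp only [A, R, if_neg hl.ne, share, if_pos hl, hk]
      -- With `m` clauses, `A w - R w` is at least `m ^ r * ((1 - ρ * l w) - (1 - l w)) = m ^ r * (1
      -- - ρ) * l w`. This equals the bound on the demand because `(3 * m) ^ r * share = m ^ r * (1
      -- - ρ)`.
      refine le_trans (le_of_eq ?_) (sub_le_sub_right h5 _)
      have h6 : (φ.width : ℝ) = 3 * φ.numClauses := by rw [width]; push_cast; rfl
      rw [h6]
      push_cast
      field_simp
      ring

theorem cong_le_one {ρ : ℚ} (hρ : ρ < 1) (γ : ℕ) {φ : ThreeSAT} (hφ : φ.val < ρ) :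
    (φ.toCongestion ρ hρ γ).cong ≤ 1 := by
  refine (iInf₂_le 1 (one_mem_reservations hρ γ hφ)).trans (iSup_le fun e => ?_)
  simp [toCongestion]

end ThreeSAT

/-! ### Potentials -/

/-- A flow against a potential. -/
theorem CongestionInstance.IsFlow.sum_mul_sub {I : CongestionInstance} {s t : Fin I.numV} {a : ℝ}
    {x : Fin I.numE → ℝ} (hx : I.IsFlow s t a x) (p : Fin I.numV → ℝ) :
    ∑ e, x e * (p (I.src e) - p (I.tgt e)) = a * (p s - p t) := by
  have h : ∑ v, p v * ((∑ e, if I.src e = v then x e else 0) - ∑ e, if I.tgt e = v then x e else 0)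
      = ∑ v, p v * ((if v = s then a else 0) - if v = t then a else 0) :=
    Finset.sum_congr rfl fun v _ => by rw [hx v]
  simp only [mul_sub, Finset.sum_sub_distrib, Finset.mul_sum, mul_ite, mul_zero,
    Finset.sum_ite_eq', Finset.mem_univ, if_true] at h
  rw [Finset.sum_comm, Finset.sum_comm (γ := Fin I.numV)] at h
  simp only [Finset.sum_ite_eq, Finset.mem_univ, if_true] at h
  rw [mul_comm a, sub_mul, ← h, ← Finset.sum_sub_distrib]
  exact Finset.sum_congr rfl fun e _ => by ring

/-- The words made of the letters that are selected by `s`, one for every three letters. -/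
noncomputable def selected (s : ℕ → ℕ) : List ℕ → ℝ
  | [] => 1
  | p :: w => if p = s (p / 3) then selected s w else 0

theorem selected_eq_zero_or_one (s : ℕ → ℕ) : ∀ w, selected s w = 0 ∨ selected s w = 1
  | [] => Or.inr rfl
  | p :: w => by
    rw [selected]
    split
    · exact selected_eq_zero_or_one s w
    · exact Or.inl rfl

theorem selected_nonneg (s : ℕ → ℕ) (w : List ℕ) : 0 ≤ selected s w := by
  rcases selected_eq_zero_or_one s w with h | h <;> simp [h]

theorem selected_le_one (s : ℕ → ℕ) (w : List ℕ) : selected s w ≤ 1 := by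
  rcases selected_eq_zero_or_one s w with h | h <;> simp [h]

/-- Exactly one of the three letters of each clause is selected, so every level multiplies the count
by `m`. -/
theorem leafSum_selected {s : ℕ → ℕ} (hs : ∀ C, s C / 3 = C) (m : ℕ) : ∀ (r : ℕ) (w : List ℕ),
    leafSum (3 * m) r w (selected s) = (m : ℝ) ^ r * selected s w
  | 0, w => by rw [leafSum_zero, pow_zero, one_mul]
  | r + 1, w => by
    rw [leafSum_succ, sum_range_three_mul]
    simp only [leafSum_selected hs m r]
    have (C : ℕ) : (m : ℝ) ^ r * selected s (3 * C :: w) + (m : ℝ) ^ r * selected s ((3 * C + 1) :: w)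
        + (m : ℝ) ^ r * selected s ((3 * C + 2) :: w) = (m : ℝ) ^ r * selected s w := by
      have e0 : 3 * C / 3 = C := by omega
      have e1 : (3 * C + 1) / 3 = C := by omega
      have e2 : (3 * C + 2) / 3 = C := by omega
      simp only [selected, e0, e1, e2]
      have := hs C
      obtain h | h | h : s C = 3 * C ∨ s C = 3 * C + 1 ∨ s C = 3 * C + 2 := by omega
      all_goals simp [h]
    simp only [this, Finset.sum_const, Finset.card_range, nsmul_eq_mul]
    ring

/-- The potential of the source of a word. It drops by `selected s w` along `w`. -/
noncomputable def sourcePotential (s : ℕ → ℕ) : List ℕ → ℝ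
  | [] => 1
  | p :: w => sourcePotential s w - if s (p / 3) < p then selected s w else 0

/-- The potential of a vertex. -/
noncomputable def potential (s : ℕ → ℕ) (M : ℕ) : Option (List ℕ) → ℝ
  | none => 0
  | some [] => 1
  | some (i :: l) => sourcePotential s ((M + 1 - i) :: address M l)

theorem address_address {M : ℕ} {w : List ℕ} (h : IsWord M w) : address M (address M w) = w := by
  rw [address, address, List.map_map]
  refine (List.map_congr_left fun p hp => ?_).trans (List.map_id w)
  have := h p hp
  simp only [Function.comp_apply, id_eq]
  omega

/-- On the path of a clause the potential keeps the value of the source of `w` up to the selected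
edge, drops there by `selected s w`, and then keeps the value of the target of `w`. -/
theorem potential_wordSource {s : ℕ → ℕ} (hs : ∀ C, s C / 3 = C) {M : ℕ} : ∀ {w : List ℕ},
    IsWord M w → potential s M (wordSource M w) = sourcePotential s w
  | [], _ => rfl
  | p :: w, h => by
    rw [isWord_cons] at h
    rw [wordSource]
    split_ifs with hp
    · have := hs (p / 3)
      rw [potential_wordSource hs h.2, sourcePotential, if_neg (by omega), sub_zero]
    · rw [potential, address_address h.2, show M + 1 - (M - p + 1) = p by omega]

theorem potential_wordTarget {s : ℕ → ℕ} (hs : ∀ C, s C / 3 = C) {M : ℕ} : ∀ {w : List ℕ},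
    IsWord M w → potential s M (wordTarget M w) = sourcePotential s w - selected s w
  | [], _ => by simp [potential, wordTarget, sourcePotential, selected]
  | p :: w, h => by
    have hw := isWord_cons.1 h
    have := hs (p / 3)
    rw [wordTarget, sourcePotential, selected]
    split_ifs with hp h1 h2 h2 h1 h2 h2
    · omega
    · rw [potential_wordTarget hs hw.2, sub_zero]
    · rw [potential_wordTarget hs hw.2, sub_zero]
    · omega
    -- The target of `p :: w` is the source of `(p + 1) :: w`, which is on the same path since `p %
    -- 3 ≠ 2`.
    all_goals rw [address, List.map_cons, potential, ← address, address_address hw.2,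
      show M + 1 - (M - p) = p + 1 by omega, sourcePotential, show (p + 1) / 3 = p / 3 by omega]
    · omega
    · rw [if_pos (by omega), sub_zero]
    · rw [if_pos (by omega), sub_zero]
    · rw [if_neg (by omega), sub_zero, sub_zero]

theorem potential_sub {s : ℕ → ℕ} (hs : ∀ C, s C / 3 = C) {M : ℕ} {w : List ℕ} (h : IsWord M w) :
    potential s M (wordSource M w) - potential s M (wordTarget M w) = selected s w := by
  rw [potential_wordSource hs h, potential_wordTarget hs h, sub_sub_cancel]

/-- The vertex with a given number. -/
def vertexOf (γ M v : ℕ) : Option (List ℕ) :=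
  if v = (M + 1) ^ γ then none else some (Nat.digits (M + 1) v)

theorem vertexOf_vertexNum {γ M : ℕ} (hM : 0 < M) {v : Option (List ℕ)} (h : IsVertex γ M v) :
    vertexOf γ M (vertexNum γ M v) = v := by
  cases v with
  | none => simp [vertexOf, vertexNum]
  | some l => rw [vertexOf, if_neg (vertexNum_some_lt hM h).ne, digits_vertexNum hM h]

/-! ### The lower bound on the congestion of a satisfiable formula. -/

namespace ThreeSAT

/-- Weak duality: by the potential, a unit of flow between the ends of `w` has total signed length
`selected s w`, while the reservation `u` bounds the flow on each edge. -/
theorem sum_selected_le {ρ : ℚ} (hρ : ρ < 1) {γ : ℕ} {φ : ThreeSAT} {s : ℕ → ℕ}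
    (hs : ∀ C, s C / 3 = C) {u : Fin (extensions φ.width γ []).length → ℝ}
    {d : Fin (commodityList γ φ.width).length → ℝ}
    (hu : (φ.toCongestion ρ hρ γ).Routable u d) :
    ∑ h, d h * selected s (node γ ((commodityList γ φ.width).get h))
      ≤ ∑ e, u e * selected s ((extensions φ.width γ []).get e) := by
  obtain ⟨x, hx, hxu⟩ := hu
  let p (v : Fin (φ.toCongestion ρ hρ γ).numV) : ℝ := potential s φ.width (vertexOf γ φ.width v)
  have hp {w} (hw : IsWord φ.width w) (hl : w.length ≤ γ) :
      potential s φ.width (vertexOf γ φ.width (vertexNum γ φ.width (wordSource φ.width w)))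
      - potential s φ.width (vertexOf γ φ.width (vertexNum γ φ.width (wordTarget φ.width w)))
      = selected s w := by
    rw [vertexOf_vertexNum φ.width_pos ((isVertex_wordSource hw).mono hl),
      vertexOf_vertexNum φ.width_pos ((isVertex_wordTarget hw).mono hl), potential_sub hs hw]
  have h1 (h) : d h * selected s (node γ ((commodityList γ φ.width).get h))
      = ∑ e, x h e * selected s ((extensions φ.width γ []).get e) := by
    have key := (hx h).sum_mul_sub p
    have e1 : p ((φ.toCongestion ρ hρ γ).source h) - p ((φ.toCongestion ρ hρ γ).sink h)
        = selected s (node γ ((commodityList γ φ.width).get h)) :=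
      hp (isWord_node (List.get_mem _ _)) (length_node_le (List.get_mem _ _))
    rw [e1] at key
    refine key.symm.trans (Finset.sum_congr rfl fun e _ => ?_)
    have e2 : p ((φ.toCongestion ρ hρ γ).src e) - p ((φ.toCongestion ρ hρ γ).tgt e)
        = selected s ((extensions φ.width γ []).get e) := hp (isWord_leaf e) (length_leaf e).le
    rw [e2]
  calc _ = ∑ h, ∑ e, x h e * selected s ((extensions φ.width γ []).get e) :=
        Finset.sum_congr rfl fun h _ => h1 h
    _ = ∑ e, ∑ h, x h e * selected s ((extensions φ.width γ []).get e) := Finset.sum_comm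
    _ ≤ _ := Finset.sum_le_sum fun e _ => by
      rw [← Finset.sum_mul]
      exact mul_le_mul_of_nonneg_right
        ((Finset.sum_le_sum fun h _ => le_abs_self _).trans (hxu e)) (selected_nonneg s _)

/-- Selected letters of clauses are true under `τ`, so of two opposite literals at most one is
selected; the remaining inequalities hold because `selected` decreases when a letter is added. -/
theorem selected_mem {ρ : ℚ} (hρ : ρ < 1) {γ : ℕ} {φ : ThreeSAT} {τ : ℕ → Bool} {s : ℕ → ℕ}
    (hτ : ∀ C < φ.numClauses, τ (φ.literal (s C)).1 = (φ.literal (s C)).2) :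
    (fun h => (fun c => (share ρ γ c.1 : ℝ) * selected s (node γ c))
      ((commodityList γ φ.width).get h)) ∈ (demandPolytope ρ γ φ).toSet := by
  have hsh (κ : ℕ) : (0 : ℝ) < share ρ γ κ := Rat.cast_pos.2 (share_pos hρ γ κ)
  refine mem_demandPolytope_iff.2 ⟨fun c _ => mul_nonneg (hsh _).le (selected_nonneg s _),
    fun c _ => mul_le_of_le_one_right (hsh _).le (selected_le_one s _),
    fun k hk W hW W' hW' => ?_⟩
  rw [mem_leaves] at hW hW'
  have hdrop {V : List ℕ} (hV : V.length = γ ∧ IsWord φ.width V) :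
      ∃ p < φ.width, V.drop (γ - (k + 1)) = p :: V.drop (γ - k) := by
    have h1 : γ - (k + 1) < V.length := by omega
    refine ⟨V[γ - (k + 1)], hV.2 _ (List.getElem_mem h1), ?_⟩
    rw [List.drop_eq_getElem_cons h1, show γ - (k + 1) + 1 = γ - k by omega]
  obtain ⟨p, hp, ep⟩ := hdrop hW
  obtain ⟨q, hq, eq⟩ := hdrop hW'
  simp only [mul_div_cancel_left₀ _ (hsh _).ne', node]
  have key : ∀ p < φ.width, p = s (p / 3) → τ (φ.literal p).1 = (φ.literal p).2 := by
    intro p hp e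
    rw [e]
    refine hτ _ ?_
    rw [width] at hp
    omega
  by_cases hcl : φ.Clash γ k W W'
  · rw [if_pos hcl]
    obtain ⟨h1, h2⟩ := hcl
    rw [ep, eq, List.headD_cons, List.headD_cons] at h2
    rw [ep, eq, ← h1, selected, selected]
    have h0 := selected_nonneg s (W.drop (γ - k))
    split_ifs with h3 h4
    · exact absurd ((key p hp h3).symm.trans ((congrArg τ h2.1).trans (key q hq h4))) h2.2
    all_goals linarith
  · rw [if_neg hcl, add_zero, ep, selected]
    split_ifs
    · exact le_rfl
    · exact selected_nonneg s _

/-- On a level `κ < γ` there are `m ^ κ` selected nodes, each with `(3 * m) ^ (γ - κ)` commodities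
of demand `(1 - ρ) / 3 ^ (γ - κ)`. So every such level adds `(1 - ρ) * m ^ γ`, and level `γ` adds `m
^ γ`. -/
theorem sum_share_mul_selected {ρ : ℚ} {γ : ℕ} {φ : ThreeSAT} {s : ℕ → ℕ}
    (hs : ∀ C, s C / 3 = C) :
    ∑ h, (fun c : ℕ × List ℕ => (share ρ γ c.1 : ℝ) * selected s (node γ c))
      ((commodityList γ φ.width).get h) * selected s (node γ ((commodityList γ φ.width).get h))
      = (1 + γ * (1 - ρ)) * (φ.numClauses : ℝ) ^ γ := by
  rw [sum_get _ fun c => (share ρ γ c.1 : ℝ) * selected s (node γ c) * selected s (node γ c),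
    sum_commodityList]
  have hsq (w) : selected s w * selected s w = selected s w := by
    rcases selected_eq_zero_or_one s w with h | h <;> simp [h]
  have hκ {κ} (h : κ ≤ γ) : leafSum φ.width γ [] (fun W => (share ρ γ κ : ℝ) *
      selected s (node γ (κ, W)) * selected s (node γ (κ, W)))
      = share ρ γ κ * ((φ.width : ℝ) ^ (γ - κ) * (φ.numClauses : ℝ) ^ κ) := by
    simp only [mul_assoc, hsq, leafSum_mul_left, node]
    have := leafSum_drop φ.width (γ - κ) (selected s) κ []
    have e : leafSum φ.width κ [] (selected s) = (φ.numClauses : ℝ) ^ κ * selected s [] :=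
      leafSum_selected hs φ.numClauses κ []
    rw [Nat.sub_add_cancel h, e, selected, mul_one] at this
    rw [this]
  have h6 : (φ.width : ℝ) = 3 * φ.numClauses := by rw [width]; push_cast; rfl
  have hlt : ∀ κ ∈ Finset.range γ, leafSum φ.width γ [] (fun W => (share ρ γ κ : ℝ) *
      selected s (node γ (κ, W)) * selected s (node γ (κ, W)))
      = (1 - ρ) * (φ.numClauses : ℝ) ^ γ := by
    intro κ hk
    rw [Finset.mem_range] at hk
    rw [hκ hk.le, share, if_pos hk, h6, mul_pow]
    obtain ⟨r, rfl⟩ := Nat.exists_eq_add_of_le hk.le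
    rw [Nat.add_sub_cancel_left, pow_add]
    push_cast
    field_simp
  rw [Finset.sum_range_succ, hκ le_rfl, Finset.sum_congr rfl hlt, share, if_neg (lt_irrefl _)]
  simp only [Finset.sum_const, Finset.card_range, nsmul_eq_mul, Nat.sub_self, pow_zero,
    Rat.cast_one]
  ring

theorem le_cong {ρ : ℚ} (hρ : ρ < 1) (γ : ℕ) {φ : ThreeSAT} (hφ : φ.val = 1) :
    ((1 + (γ : ℝ) * (1 - (ρ : ℝ)) : ℝ) : EReal) ≤ (φ.toCongestion ρ hρ γ).cong := by
  obtain ⟨τ, hτ⟩ := φ.exists_satAt_of_val_eq_one hφ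
  have hex (C : ℕ) : ∃ p, p / 3 = C ∧
      (C < φ.numClauses → τ (φ.literal p).1 = (φ.literal p).2) := by
    by_cases hC : C < φ.numClauses
    · obtain ⟨j, hj⟩ := hτ C hC
      exact ⟨3 * C + j, by omega, fun _ => hj⟩
    · exact ⟨3 * C, by omega, fun h => absurd h hC⟩
  choose s hs1 hs2 using hex
  refine le_iInf₂ fun u hu => ?_
  have key := sum_selected_le hρ hs1 (hu _ (selected_mem hρ hs2))
  rw [sum_share_mul_selected hs1] at key
  have htot : ∑ e, selected s ((extensions φ.width γ []).get e) = (φ.numClauses : ℝ) ^ γ := by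
    rw [sum_get]
    exact (leafSum_selected hs1 φ.numClauses γ []).trans (mul_one _)
  have hpos : (0 : ℝ) < (φ.numClauses : ℝ) ^ γ := pow_pos (Nat.cast_pos.2 φ.numClauses_pos) _
  -- Averaging over the `m ^ γ` selected edges; since this number is positive, smaller values of `u`
  -- on all edges would make the sum strictly smaller.
  obtain ⟨e, he⟩ : ∃ e, 1 + (γ : ℝ) * (1 - (ρ : ℝ)) ≤ u e := by
    by_contra! hlt
    rw [← htot, Finset.mul_sum] at key
    obtain ⟨e, he⟩ : ∃ e, 0 < selected s ((extensions φ.width γ []).get e) := by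
      by_contra! h0
      exact absurd (htot.symm.trans_le (Finset.sum_nonpos fun e _ => h0 e)) (not_le.2 hpos)
    exact absurd key (not_le.2 (Finset.sum_lt_sum
      (fun i _ => mul_le_mul_of_nonneg_right (hlt i).le (selected_nonneg s _))
      ⟨e, Finset.mem_univ _, mul_lt_mul_of_pos_right (hlt e) he⟩))
  refine le_trans ?_ (le_iSup _ e)
  rw [EReal.coe_le_coe_iff]
  simpa [toCongestion] using he

end ThreeSAT

/-! ### The size of the instance -/

/-- The numbers in the description of the uncertainty polytope. -/
def coefficients (ρ : ℚ) (γ : ℕ) : Finset ℚ :=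
  {0, 1, -1} ∪ (Finset.range (γ + 1)).biUnion fun κ =>
    {share ρ γ κ, 1 / share ρ γ κ, -1 / share ρ γ κ}

theorem mem_coefficients {ρ : ℚ} {γ κ : ℕ} (h : κ ≤ γ) : share ρ γ κ ∈ coefficients ρ γ ∧
    1 / share ρ γ κ ∈ coefficients ρ γ ∧ -1 / share ρ γ κ ∈ coefficients ρ γ := by
  have : κ ∈ Finset.range (γ + 1) := Finset.mem_range.2 (Nat.lt_succ_of_le h)
  refine ⟨?_, ?_, ?_⟩ <;>
  exact Finset.mem_union_right _ (Finset.mem_biUnion.2 ⟨κ, this, by simp⟩)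

theorem zero_mem_coefficients (ρ : ℚ) (γ : ℕ) : 0 ∈ coefficients ρ γ := by simp [coefficients]

namespace ThreeSAT

/-- The entries belong to a finite set independent of the formula, so their code lengths are bounded
by a constant and only their number matters. -/
theorem mem_coefficients_of_mem_demandRows {ρ : ℚ} {γ : ℕ} {φ : ThreeSAT} {R : DemandRow}
    (hR : R ∈ demandRows ρ γ φ) : (∀ x, R.1 x ∈ coefficients ρ γ) ∧ R.2 ∈ coefficients ρ γ := by
  have h0 := zero_mem_coefficients ρ γ
  simp only [demandRows, List.mem_append, List.mem_flatMap, List.mem_map, List.mem_range] at hR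
  rcases hR with (⟨c, hc, rfl⟩ | ⟨c, hc, rfl⟩) | ⟨k, hk, W, hW, W', hW', rfl⟩
  · refine ⟨fun x => ?_, h0⟩
    simp only [nonnegRow]
    split_ifs
    · simp [coefficients]
    · exact h0
  · refine ⟨fun x => ?_, (mem_coefficients (mem_commodityList.1 hc).1).1⟩
    simp only [shareRow]
    split_ifs
    · simp [coefficients]
    · exact h0
  · refine ⟨fun x => ?_, h0⟩
    have h1 := (mem_coefficients (ρ := ρ) (γ := γ) (κ := k + 1) hk).2.1
    have h2 := (mem_coefficients (ρ := ρ) (γ := γ) (κ := k) hk.le).2.2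
    simp only [linkRow]
    split_ifs <;> assumption

theorem length_demandRows (ρ : ℚ) (γ : ℕ) (φ : ThreeSAT) : (demandRows ρ γ φ).length
    = 2 * ((γ + 1) * φ.width ^ γ) + γ * (φ.width ^ γ * φ.width ^ γ) := by
  simp only [demandRows, List.length_append, List.length_map, length_commodityList,
    List.length_flatMap, length_extensions, List.map_const', List.sum_replicate, smul_eq_mul,
    List.length_range]
  ring

/-- There are at most of order `width ^ (2 * γ)` rows, one per level and pair of leaf words for the
links, and of order `width ^ γ` columns. This is the origin of the constant `3` in the exponent. -/
theorem size_demandPolytope_le (ρ : ℚ) (γ : ℕ) (φ : ThreeSAT) : (demandPolytope ρ γ φ).size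
    ≤ 3 * (γ + 1) * (γ + 2) * (coefficients ρ γ).sup (fun q => (encRat q).length)
      * φ.width ^ (3 * γ) := by
  obtain ⟨L, hL⟩ : ∃ L, (coefficients ρ γ).sup (fun q => (encRat q).length) = L := ⟨_, rfl⟩
  obtain ⟨P, hP⟩ : ∃ P, φ.width ^ γ = P := ⟨_, rfl⟩
  have hP1 : 1 ≤ P := hP ▸ Nat.one_le_pow _ _ φ.width_pos
  have hP3 : φ.width ^ (3 * γ) = P ^ 3 := by rw [← hP, mul_comm, pow_mul]
  have hle {q} (hq : q ∈ coefficients ρ γ) : (encRat q).length ≤ L :=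
    hL ▸ Finset.le_sup (f := fun q => (encRat q).length) hq
  have hrow (i : Fin (demandPolytope ρ γ φ).numRows) :
      (∑ h, (encRat ((demandPolytope ρ γ φ).A i h)).length)
      + (∑ a, (encRat ((demandPolytope ρ γ φ).B i a)).length)
      + (encRat ((demandPolytope ρ γ φ).b i)).length ≤ (γ + 1) * P * L + 0 + L := by
    have hm := mem_coefficients_of_mem_demandRows (List.get_mem (demandRows ρ γ φ) i)
    refine add_le_add (add_le_add ?_ ?_) (hle hm.2)
    · refine (Finset.sum_le_card_nsmul _ _ L fun h _ => hle (hm.1 _)).trans_eq ?_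
      rw [Finset.card_univ, Fintype.card_fin, length_commodityList, hP, smul_eq_mul]
    · exact (Fintype.sum_eq_zero _ fun a : Fin 0 => a.elim0).le
  have hsum : (demandPolytope ρ γ φ).size
      ≤ (demandRows ρ γ φ).length * ((γ + 1) * P * L + 0 + L) := by
    refine (Finset.sum_le_card_nsmul _ _ _ fun i _ => hrow i).trans_eq ?_
    rw [Finset.card_univ, Fintype.card_fin, smul_eq_mul]
    rfl
  refine hsum.trans ?_
  rw [length_demandRows, hL, hP, hP3]
  have h1 : 2 * ((γ + 1) * P) + γ * (P * P) ≤ 3 * (γ + 1) * P ^ 2 := by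
    nlinarith [Nat.mul_le_mul_left (γ + 1) (Nat.le_mul_self P)]
  have h2 : (γ + 1) * P * L + 0 + L ≤ (γ + 2) * P * L := by nlinarith [Nat.zero_le L]
  exact (Nat.mul_le_mul h1 h2).trans_eq (by ring)

theorem exists_size_bound {ρ : ℚ} (hρ : ρ < 1) (γ : ℕ) : ∃ K : ℕ, ∀ φ : ThreeSAT,
    (φ.toCongestion ρ hρ γ).numV ≤ K * φ.numClauses ^ γ ∧
    (φ.toCongestion ρ hρ γ).numE ≤ K * φ.numClauses ^ γ ∧
    (φ.toCongestion ρ hρ γ).poly.size ≤ K * φ.numClauses ^ (3 * γ) := by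
  obtain ⟨S, hS⟩ : ∃ S, 3 * (γ + 1) * (γ + 2) *
    (coefficients ρ γ).sup (fun q => (encRat q).length) = S := ⟨_, rfl⟩
  have p3 := Nat.zero_le (3 ^ γ)
  have p4 := Nat.zero_le (4 ^ γ)
  have pS := Nat.zero_le (S * 3 ^ (3 * γ))
  refine ⟨4 ^ γ + 1 + 3 ^ γ + S * 3 ^ (3 * γ), fun φ => ⟨?_, ?_, ?_⟩⟩
  · change (φ.width + 1) ^ γ + 1 ≤ _
    -- For `m ≥ 1` clauses, `3 * m + 1 ≤ 4 * m`.
    have h1 : (φ.width + 1) ^ γ ≤ 4 ^ γ * φ.numClauses ^ γ := by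
      rw [← mul_pow]
      refine Nat.pow_le_pow_left ?_ γ
      have := φ.numClauses_pos
      rw [width]
      omega
    have h2 : 1 ≤ φ.numClauses ^ γ := Nat.one_le_pow _ _ φ.numClauses_pos
    have h3 : 4 ^ γ * φ.numClauses ^ γ + 1 * φ.numClauses ^ γ
        ≤ (4 ^ γ + 1 + 3 ^ γ + S * 3 ^ (3 * γ)) * φ.numClauses ^ γ := by
      rw [← add_mul]
      exact Nat.mul_le_mul_right _ (by linarith)
    omega
  · change (extensions φ.width γ []).length ≤ _
    rw [length_extensions, width, mul_pow]
    exact Nat.mul_le_mul_right _ (by linarith)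
  · refine (size_demandPolytope_le ρ γ φ).trans ?_
    rw [hS, width, mul_pow, ← mul_assoc]
    exact Nat.mul_le_mul_right _ (by linarith)

end ThreeSAT

theorem lemma1 (ρ : ℚ) (hρ0 : 0 < ρ) (hρ1 : ρ < 1) :
    ∃ c : ℕ, 0 < c ∧ ∀ γ : ℕ, ∃ f : ThreeSAT → CongestionInstance,
      PolyTimeMap f ∧
      (∃ K : ℕ, ∀ φ : ThreeSAT,
        (f φ).numV ≤ K * φ.numClauses ^ γ ∧
        (f φ).numE ≤ K * φ.numClauses ^ γ ∧
        (f φ).poly.size ≤ K * φ.numClauses ^ (c * γ)) ∧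
      ∀ φ : ThreeSAT,
        (f φ).reservations.Nonempty ∧
        (φ.val = 1 → ((1 + (γ : ℝ) * (1 - (ρ : ℝ)) : ℝ) : EReal) ≤ (f φ).cong) ∧
        (φ.val < ρ → (f φ).cong ≤ 1) := by
  exact ⟨3, three_pos, fun γ => ⟨fun φ => φ.toCongestion ρ hρ1 γ,
    ThreeSAT.polyTimeMap_toCongestion hρ1 γ, ThreeSAT.exists_size_bound hρ1 γ,
    fun φ => ⟨φ.reservations_nonempty hρ1 γ, ThreeSAT.le_cong hρ1 γ, ThreeSAT.cong_le_one hρ1 γ⟩⟩⟩
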